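/- **Setting.** Two reservoirs $r=I,II$ of non-interacting spinless fermions in $\mathbb R^d$, $d\ge 3$, have one-particle space $L^2(\mathbb R^d)$ and one-particle energy $-\Delta$ ($\hbar=1$). Let $a^\#(x,r)$ denote their creation and annihilation operators, and let $\omega^0$ be the product of their infinite-volume equilibrium states at inverse temperatures $\beta^r$ and chemical potentials $\mu^r$, i.e. the gauge-invariant quasi-free state with momentum-space two-point functions $\omega^0(a^*(k,r)a(l,r))=\delta(k-l)\rho_r(k)$, $\rho_r(k)=(e^{\beta^r(|k|^2-\mu^r)}+1)^{-1}$. The reservoirs are coupled by $W=g\sum_{N\ge1}\xi^N W_N$, where $W_N=\int dX\,dY\,a^*(X_1)\cdots a^*(X_N)\,w_N(X,Y)\,a(Y_1)\cdots a(Y_N)$, $X_j,Y_j\in\mathbb R^d\times\{I,II\}$. Assume that $W_1$ is selfadjoint, $w_1(Y,X)=\overline{w_1(X,Y)}$, and that for all $r,r'$ the function $w_1((\cdot,r),(\cdot,r'))$ is continuous on $\mathbb R^{2d}$ with finite norm $\|f\|'=2^{-3d}\langle f,\prod_{k=1}^{2d}(-\partial_k^2+x_k^2+1)^3f\rangle^{1/2}$,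 i.e. it is the sum of its Hermite series and $\sum_{q\in\mathbb N^{2d}}\prod_k(q_k+1)^3|c_q|^2<\infty$ for its Hermite coefficients $c_q$. Put $\widehat w_1((k,r),(l,r'))=(2\pi)^{-d}\int e^{-i(k\cdot x+l\cdot y)}w_1((x,r),(y,r'))\,dx\,dy$. Let $\mathcal J_{2,2}$ be the term of order $g^2\xi^2$ in the Dyson expansion of the stationary particle current into reservoir $I$, $\mathcal J=\lim_{t\to\infty}\omega^0(\alpha^0_{-t}\alpha_t(-i[N\otimes 1,W]))$, where $N\otimes 1$ is the particle number of reservoir $I$, and $\alpha^0_t$, $\alpha_t$ are the time evolutions of the uncoupled and of the coupled reservoirs; thus $\mathcal J_{2,2}=\lim_{t\to\infty}\int_0^t\omega^0([\alpha^0_{-s}(W_1),[N\otimes1,W_1]])\,ds$. Define the resistance $R(\mu,\beta)$, $\beta>0$, by $$R(\mu,\beta)^{-1}=2\pi\beta\int_{\mathbb R^{2d}}dk\,dl\;\delta(|k|^2-|l|^2)\,\frac{|\widehat w_1((-k,II),(l,I))|^2\,e^{\beta(|k|^2-\mu)}}{(e^{\beta(|k|^2-\mu)}+1)^2},$$ where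 $\int dl\,\delta(|k|^2-|l|^2)G(l)=\tfrac12|k|^{d-2}\int_{S^{d-1}}G(|k|\theta)\,d\sigma(\theta)$. **Claims.** 1. (Ohm's law.) The integral defining $R(\mu,\beta)^{-1}$ converges for all $\mu\in\mathbb R$, $\beta>0$. If $\beta^I=\beta^{II}=\beta$, $\mu^I=\mu$ and $\mu^{II}=\mu+\Delta\mu$, then the limit $\mathcal J_{2,2}$ exists and is real for every $\Delta\mu\in\mathbb R$, and $$\mathcal J_{2,2}=\frac{\Delta\mu}{R(\mu,\beta)}+O((\Delta\mu)^2)\qquad(\Delta\mu\to0),$$ where $\Delta\mu/R(\mu,\beta)$ means $\Delta\mu\cdot R(\mu,\beta)^{-1}$. 2. (High temperature.) If $\widehat w_1((k,II),(l,I))\neq0$ for some $k,l$ with $|k|=|l|$, then $0<R(\mu,\beta)<\infty$ for all $\mu\in\mathbb R$, $\beta>0$, and for every $\mu>0$ the resistance grows linearly in $T$: $R(\mu,1/T)/T$ has a limit in $(0,\infty)$ as $T\to\infty$. 3. (Low temperature.) Let $d=3$ and let $\widehat w_1((k,II),(l,I))=g(|k|,|l|)$ depend on $|k|$ and $|l|$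 only. Put $f(r)=8\pi^3\,r\,|g(\sqrt r,\sqrt r)|^2$. Then $f\in C^2((0,\infty))$, and for every $\mu>0$ $$R(\mu,1/T)^{-1}=f(\mu)+\tfrac{\pi^2}{6}T^2f''(\mu)+o(T^2)\qquad(T\downarrow0).$$ If $f(\mu)\ne0$, then also $$R(\mu,1/T)=\frac{1}{f(\mu)+\pi^2T^2f''(\mu)/6}+o(T^2)\qquad(T\downarrow 0),$$ so that $R(\mu,\infty):=\lim_{\beta\to\infty}R(\mu,\beta)=f(\mu)^{-1}$; moreover, for all sufficiently small $T>0$, $R(\mu,1/T)$ is strictly increasing in $T$ if $f''(\mu)<0$ and strictly decreasing in $T$ if $f''(\mu)>0$. -/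

import Mathlib

open MeasureTheory Filter Topology Complex
open scoped FourierTransform ENNReal ComplexInnerProductSpace

noncomputable section

namespace Junction

/-! ### Fermionic Fock space over a complex Hilbert space

The Fock space is taken in the occupation-number representation: an orthonormal basis of the
one-particle space `K` is fixed and linearly ordered, and the Slater determinants of basis vectors
form an orthonormal basis of the Fock space, labelled by the finite sets of occupied modes. -/

section Fock

variable (K : Type) [NormedAddCommGroup K] [InnerProductSpace ℂ K] [CompleteSpace K]

/-- Labels of a fixed orthonormal basis of `K`. -/
def Mode : Type := (exists_hilbertBasis ℂ K).choose

/-- The fixed orthonormal basis of `K`. -/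
def modeBasis : HilbertBasis (Mode K) ℂ K := (exists_hilbertBasis ℂ K).choose_spec.choose

instance : LinearOrder (Mode K) := by
  classical
  exact linearOrderOfSTO (WellOrderingRel (α := Mode K))

/-- The antisymmetric Fock space over `K`. -/
abbrev Fock : Type := lp (fun _ : Finset (Mode K) => ℂ) 2

/-- The algebra of bounded operators on Fock space. -/
abbrev FockOp : Type := Fock K →L[ℂ] Fock K

variable {K}

/-- Coefficients of `a_i ψ`, where `a_i` annihilates the mode `i`: the basis vector with occupied
set `S ∪ {i}`, `i ∉ S`, is sent to the one with occupied set `S`, with sign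
`(-1) ^ #{j ∈ S | j < i}`, and the ones with `i` empty are sent to `0`. -/
def annihModeFun (i : Mode K) (ψ : Finset (Mode K) → ℂ) (S : Finset (Mode K)) : ℂ :=
  if i ∈ S then 0 else (-1) ^ (S.filter (· < i)).card * ψ (insert i S)

/-- Toggling the occupation of the mode `i`. -/
def toggle (i : Mode K) : Finset (Mode K) ≃ Finset (Mode K) :=
  (show Function.Involutive (fun S : Finset (Mode K) => symmDiff {i} S) from fun S => by
    simp).toPerm

theorem norm_annihModeFun_le (i : Mode K) (ψ : Finset (Mode K) → ℂ) (S : Finset (Mode K)) :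
    ‖annihModeFun i ψ S‖ ≤ ‖ψ (toggle i S)‖ := by
  unfold annihModeFun
  split_ifs with h
  · simp
  · have : toggle i S = insert i S := by
      ext j
      simp only [toggle, Function.Involutive.coe_toPerm, Finset.mem_symmDiff,
        Finset.mem_singleton, Finset.mem_insert]
      by_cases hj : j = i
      · subst hj; simp [h]
      · simp [hj]
    simp [this]

theorem summable_toggle (i : Mode K) (ψ : Fock K) :
    Summable fun S => ‖ψ (toggle i S)‖ ^ (2 : ℝ≥0∞).toReal :=
  (toggle i).summable_iff.2 ((lp.memℓp ψ).summable (by simp))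

theorem summable_annihModeFun (i : Mode K) (ψ : Fock K) :
    Summable fun S => ‖annihModeFun i ψ S‖ ^ (2 : ℝ≥0∞).toReal :=
  (summable_toggle i ψ).of_nonneg_of_le (fun _ => by positivity) fun S =>
    Real.rpow_le_rpow (norm_nonneg _) (norm_annihModeFun_le i ψ S) (by simp)

/-- The annihilation operator of a single mode. -/
def annihMode (i : Mode K) : FockOp K :=
  LinearMap.mkContinuous
    { toFun := fun ψ => ⟨annihModeFun i ψ, memℓp_gen (summable_annihModeFun i ψ)⟩
      map_add' := fun ψ φ => by
        ext S
        simp only [annihModeFun, lp.coeFn_add, Pi.add_apply]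
        split_ifs <;> ring
      map_smul' := fun c ψ => by
        ext S
        simp only [annihModeFun, lp.coeFn_smul, Pi.smul_apply, smul_eq_mul, RingHom.id_apply]
        split_ifs <;> ring }
    1 fun ψ => by
      rw [one_mul]
      refine lp.norm_le_of_tsum_le (by simp) (norm_nonneg _) ?_
      rw [lp.norm_rpow_eq_tsum (by simp) ψ,
        ← (toggle i).tsum_eq fun S => ‖ψ S‖ ^ (2 : ℝ≥0∞).toReal]
      exact (summable_annihModeFun i ψ).tsum_le_tsum
        (fun S => Real.rpow_le_rpow (norm_nonneg _) (norm_annihModeFun_le i ψ S) (by simp))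
        (summable_toggle i ψ)

/-- The annihilation operator `a(f)`, antilinear in `f`. The series converges in operator norm,
because of the canonical anticommutation relations. -/
def annih (f : K) : FockOp K := ∑' i : Mode K, ⟪f, modeBasis K i⟫ • annihMode i

/-- The creation operator `a*(f)`. -/
def creat (f : K) : FockOp K := ContinuousLinearMap.adjoint (annih f)

variable (K) in
/-- The vacuum vector. -/
def vacuum : Fock K := lp.single 2 (∅ : Finset (Mode K)) (1 : ℂ)

end Fock

/-! ### The two reservoirs of free spinless fermions -/

/-- The labels of the two reservoirs. -/
inductive Reservoir
  | I
  | II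
  deriving DecidableEq

instance : Fintype Reservoir := ⟨{.I, .II}, fun x => by cases x <;> simp⟩

/-- The function on the set of reservoirs with values `a` at `I` and `b` at `II`. -/
def Reservoir.pick {α : Type} (a b : α) : Reservoir → α
  | .I => a
  | .II => b

/-- Physical space, as well as momentum space. -/
abbrev Space (d : ℕ) : Type := EuclideanSpace ℝ (Fin d)

/-- The one-particle space `L²(ℝᵈ)` of a reservoir. -/
abbrev OneParticle (d : ℕ) : Type := Lp ℂ 2 (volume : Measure (Space d))

variable {d : ℕ}

open Classical in
/-- The class in `L²` of a square-integrable function (all functions it is used for are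
square-integrable). -/
def toL2 (f : Space d → ℂ) : OneParticle d := if h : MemLp f 2 volume then h.toLp f else 0

/-- The bounded function `m(-Δ)` of the one-particle energy `-Δ`. In the normalization
`e^{-2πi⟨x,ξ⟩}` of the Fourier transform used here, `-Δ` is multiplication by `(2π|ξ|)²`. -/
def energyFunction (m : ℝ → ℂ) (f : OneParticle d) : OneParticle d :=
  𝓕⁻ (toL2 fun ξ => m ((2 * Real.pi * ‖ξ‖) ^ 2) * (𝓕 f : OneParticle d) ξ)

/-- The Fermi distribution `1 / (e^{β(ω - μ)} + 1)`. -/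
def fermi (β μ ω : ℝ) : ℝ := (Real.exp (β * (ω - μ)) + 1)⁻¹

/-- Two reservoirs, and two components (particles and holes) for each of them. -/
abbrev Doubled (d : ℕ) : Type := PiLp 2 fun _ : Reservoir × Bool => OneParticle d

/-- The annihilation operator `a(f, r)`, `f ∈ L²(ℝᵈ)`, of the reservoir `r`, in the (Araki--Wyss)
representation of the canonical anticommutation relations in which the vacuum vector implements
the product `ω⁰` of the infinite-volume equilibrium states of the reservoirs at inverse
temperatures `β r` and chemical potentials `μ r`, that is, the gauge-invariant quasi-free state
with `ω⁰(a*(f, r) a(g, r)) = ⟨g, ρ_r(-Δ) f⟩`, `ρ_r = fermi (β r) (μ r)`: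
`a(f, r) = a(√(1 - ρ_r) f ⊕ 0) + a*(0 ⊕ conj (√ρ_r f))`.
Operators of different reservoirs anticommute. -/
def field (β μ : Reservoir → ℝ) (r : Reservoir) (f : OneParticle d) : FockOp (Doubled d) :=
  annih (PiLp.single 2 (r, true)
      (energyFunction (fun ω => (Real.sqrt (1 - fermi (β r) (μ r) ω) : ℂ)) f)) +
    creat (PiLp.single 2 (r, false)
      (star (energyFunction (fun ω => (Real.sqrt (fermi (β r) (μ r) ω) : ℂ)) f)))

/-- The creation operator `a*(f, r)`. -/
def fieldStar (β μ : Reservoir → ℝ) (r : Reservoir) (f : OneParticle d) : FockOp (Doubled d) :=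
  ContinuousLinearMap.adjoint (field β μ r f)

/-- The expectation in the state `ω⁰`. -/
def expect (A : FockOp (Doubled d)) : ℂ := ⟪vacuum (Doubled d), A (vacuum (Doubled d))⟫

/-! ### Hermite functions and interactions -/

/-- The Hermite functions
`φ_q(x) = (-1)^q / (√(2^q q!) π^{1/4}) e^{x²/2} (d/dx)^q e^{-x²}` on `ℝ`. -/
def hermiteFun (q : ℕ) (x : ℝ) : ℝ :=
  (-1) ^ q / (Real.sqrt (2 ^ q * q.factorial) * Real.pi ^ (1 / 4 : ℝ)) * Real.exp (x ^ 2 / 2) *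
    iteratedDeriv q (fun y : ℝ => Real.exp (-y ^ 2)) x

/-- Products of Hermite functions, on `ℝᵈ`. -/
def hermiteSpace (q : Fin d → ℕ) (x : Space d) : ℝ := ∏ i, hermiteFun (q i) (x i)

/-- An `N`-body interaction kernel `w_N(X, Y)`, `X, Y ∈ (ℝᵈ × {I, II})^N`. -/
abbrev Kernel (d N : ℕ) : Type :=
  (Fin N → Space d × Reservoir) → (Fin N → Space d × Reservoir) → ℂ

/-- Products of Hermite functions, on `ℝ^{dN}`. -/
def hermiteMulti {N : ℕ} (q : Fin N → Fin d → ℕ) (x : Fin N → Space d) : ℝ :=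
  ∏ j, hermiteSpace (q j) (x j)

/-- The weighted Sobolev space of interaction kernels: for all values of the reservoir labels,
`w_N` is, as a function on `ℝ^{2dN}`, a Hermite series with coefficients `c` for which
`∑ ∏ (q + 1)³ (q' + 1)³ |c|²` is finite. This sum is the square of the norm
`‖f‖' = 2^{-3M/2} ⟨f, ∏_{k ≤ M} (-∂_k² + x_k² + 1)³ f⟩^{1/2}`, `M = 2dN`, because
`(-∂² + x² + 1) φ_q = 2 (q + 1) φ_q`. -/
def WeightedSobolev {N : ℕ} (w : Kernel d N) : Prop :=
  ∀ r r' : Fin N → Reservoir, ∃ c : (Fin N → Fin d → ℕ) × (Fin N → Fin d → ℕ) → ℂ,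
    (Summable fun q => (∏ j, ∏ i, ((q.1 j i : ℝ) + 1) ^ 3 * ((q.2 j i : ℝ) + 1) ^ 3) *
      ‖c q‖ ^ 2) ∧
    ∀ x y : Fin N → Space d,
      HasSum (fun q => c q * (hermiteMulti q.1 x * hermiteMulti q.2 y : ℝ))
        (w (fun j => (x j, r j)) (fun j => (y j, r' j)))

/-- The kernel of a selfadjoint operator. -/
def HermitianKernel {N : ℕ} (w : Kernel d N) : Prop :=
  ∀ X Y, w Y X = starRingEnd ℂ (w X Y)

/-- The labels `(q, r)` of the one-particle states `φ_q` in the reservoir `r`. -/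
abbrev Label (d : ℕ) : Type := (Fin d → ℕ) × Reservoir

/-- The Hermite coefficients `w̃_N(Q, Q')` of an interaction kernel. -/
def hermiteCoeff {N : ℕ} (w : Kernel d N) (Q Q' : Fin N → Label d) : ℂ :=
  ∫ p : (Fin N → Space d) × (Fin N → Space d),
    w (fun j => (p.1 j, (Q j).2)) (fun j => (p.2 j, (Q' j).2)) *
      (hermiteMulti (fun j => (Q j).1) p.1 * hermiteMulti (fun j => (Q' j).1) p.2 : ℝ)

/-- The interaction `W_N = ∫ dX dY a*(X_1)⋯a*(X_N) w_N(X, Y) a(Y_1)⋯a(Y_N)`, expanded in Hermite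
functions, after the substitution `f ↦ U r f` in all the operators `a(f, r)`, `a*(f, r)`. For
`U = id` this is `W_N` itself; for unitary `U` it is the image of `W_N` under the corresponding
(Bogoliubov) automorphism of the algebra of the reservoirs. -/
def interaction (β μ : Reservoir → ℝ) {N : ℕ} (w : Kernel d N)
    (U : Reservoir → OneParticle d → OneParticle d) : FockOp (Doubled d) :=
  ∑' Q : (Fin N → Label d) × (Fin N → Label d),
    hermiteCoeff w Q.1 Q.2 •
      ((List.ofFn fun j => fieldStar β μ (Q.1 j).2
          (U (Q.1 j).2 (toL2 fun x => (hermiteSpace (Q.1 j).1 x : ℂ)))).prod *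
        (List.ofFn fun j => field β μ (Q.2 j).2
          (U (Q.2 j).2 (toL2 fun x => (hermiteSpace (Q.2 j).1 x : ℂ)))).prod)

/-- The freely evolved interaction `W_N(t) = α⁰_{-t}(W_N)`, where
`α⁰_t(a(f, r)) = a(e^{it(-Δ)} f, r)`. -/
def freeInteraction (β μ : Reservoir → ℝ) {N : ℕ} (w : Kernel d N) (t : ℝ) :
    FockOp (Doubled d) :=
  interaction β μ w fun _ => energyFunction fun ω => Complex.exp (-(Complex.I * t * ω))

/-- The interaction `φ_s(W_N) = e^{isN} W_N e^{-isN}`, for the gauge transformations generated by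
the particle number `N ⊗ 1` of the reservoir `I`. -/
def gaugedInteraction (β μ : Reservoir → ℝ) {N : ℕ} (w : Kernel d N) (s : ℝ) :
    FockOp (Doubled d) :=
  interaction β μ w (Reservoir.pick (fun f => Complex.exp (Complex.I * s) • f) id)

/-- The contribution `-i[N ⊗ 1, W_N] = -∂_s φ_s(W_N)|_{s = 0}` of `W_N` to the operator of the
particle current into the reservoir `I`. -/
def currentOperator (β μ : Reservoir → ℝ) {N : ℕ} (w : Kernel d N) : FockOp (Doubled d) :=
  -deriv (gaugedInteraction β μ w) 0

/-- For `W = g ∑_N ξ^N W_N`, the term of order `g^k ξ^l` in the Dyson series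
`∑_m i^m ∫_{t > t_m > ⋯ > t_1 > 0} [W(t_m), ⋯ [W(t_1), -i[N ⊗ 1, W]] ⋯ ]`
of `α⁰_{-t} α_t (-i[N ⊗ 1, W])`. -/
def dysonCurrent (β μ : Reservoir → ℝ) (w : (N : ℕ) → Kernel d N) :
    (k l : ℕ) → (t : ℝ) → FockOp (Doubled d)
  | 0, _, _ => 0
  | 1, l, _ => currentOperator β μ (w l)
  | k + 2, l, t => Complex.I • ∫ s in (0 : ℝ)..t, ∑ N ∈ Finset.Ico 1 l,
      ⁅freeInteraction β μ (w N) s, dysonCurrent β μ w (k + 1) (l - N) s⁆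

/-- `J` is the term `𝒥_{k,l}` of order `g^k ξ^l` of the stationary particle current
`𝒥 = ω_stat(-i[N ⊗ 1, W])`, `ω_stat = lim_{t → ∞} ω⁰ ∘ α⁰_{-t} ∘ α_t`, for `k, l ≥ 1`. -/
def IsCurrentTerm (β μ : Reservoir → ℝ) (w : (N : ℕ) → Kernel d N) (k l : ℕ) (J : ℝ) : Prop :=
  Tendsto (fun t : ℝ => expect (dysonCurrent β μ w k l t)) atTop (𝓝 (J : ℂ))

/-! ### The resistance -/

/-- The Fourier transform `ŵ_1((k, r), (l, r'))
= (2π)^{-d} ∫ e^{-i(k·x + l·y)} w_1((x, r), (y, r')) dx dy` of a one-body kernel. -/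
def kernelFourier (w : Kernel d 1) (r r' : Reservoir) (k l : Space d) : ℂ :=
  ((2 * Real.pi) ^ d : ℝ)⁻¹ • ∫ p : Space d × Space d,
    Complex.exp (-(Complex.I * ((inner ℝ k p.1 + inner ℝ l p.2 : ℝ) : ℂ))) *
      w (fun _ => (p.1, r)) (fun _ => (p.2, r'))

/-- The measure `δ(|k|² - |l|²) dk dl` on `ℝᵈ × ℝᵈ`: for fixed `k`, `δ(|k|² - |l|²) dl` is the
surface measure of the sphere `|l| = |k|` divided by `2|k|`, which is `|k|^{d-2}/2` times the
image of the surface measure of the unit sphere under `θ ↦ |k| θ`. -/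
def energyShell (d : ℕ) : Measure (Space d × Space d) :=
  Measure.map (fun p : Space d × Metric.sphere (0 : Space d) 1 => (p.1, ‖p.1‖ • (p.2 : Space d)))
    (((volume : Measure (Space d)).withDensity
      fun k => ENNReal.ofReal (‖k‖ ^ (d - 2) / 2)).prod (volume : Measure (Space d)).toSphere)

/-- The integrand
`|ŵ_1((-k, II), (l, I))|² e^{β(|k|² - μ)} / (e^{β(|k|² - μ)} + 1)²` for the resistance. -/
def resistanceIntegrand (w : Kernel d 1) (μ β : ℝ) (p : Space d × Space d) : ℝ :=
  ‖kernelFourier w .II .I (-p.1) p.2‖ ^ 2 * Real.exp (β * (‖p.1‖ ^ 2 - μ)) /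
    (Real.exp (β * (‖p.1‖ ^ 2 - μ)) + 1) ^ 2

/-- The resistance `R(μ, β)` of the junction, given by
`R(μ, β)⁻¹ = 2πβ ∫ dk dl δ(|k|² - |l|²) |ŵ_1|² e^{β(|k|² - μ)} / (e^{β(|k|² - μ)} + 1)²`. -/
def resistance (w : Kernel d 1) (μ β : ℝ) : ℝ :=
  (2 * Real.pi * β * ∫ p, resistanceIntegrand w μ β p ∂energyShell d)⁻¹

end Junction

end

noncomputable section

namespace Junction

/-! ### Hermite functions in one dimension -/

/-! Write τ(k, l) = ŵ₁((-k, II), (l, I)). At order g²ξ² only the one-body coupling enters. The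
commutator of two operators quadratic in the fields is again quadratic, by the anticommutation
relations, and ω⁰ is fixed on such operators by its two-point function. The expectation of the
commutator at time s is therefore -i(E(s) + E(-s)) with E(s) = ∫ e^{-is(|k|²-|l|²)} (ρ_II(|k|²) -
ρ_I(|l|²)) |τ(k,l)|² dk dl (`expect_commutator_current`), and the current up to time t is the
integral of E over (-t, t).

E is integrable because of dispersion: matrix elements of e^{-isω} between Hermite functions are
O(|s|^{-d/2}), and d ≥ 3. Each of the two terms of E carries a Fermi function in one momentum only,
so the decay can be taken from the other one. This needs no smoothness of the Fermi functions and
gives a constant independent of the temperatures and chemical potentials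
(`exists_norm_correlation_le`). As a function of the energy transfer δ = |l|² - |k|², E is a Fourier
transform of the integral over the shell of transfer δ, and Fourier inversion at δ = 0 gives 2π
times the integral over the energy shell (`integral_evolution_eq_energyShell`): the golden rule.

The uniformity in the chemical potentials has a second use. With chemical potentials ±n the
difference of the Fermi functions tends to 1, so by Fatou's lemma |τ|² itself is integrable over the
energy shell (`integrable_transmission_sq`). Everything else rests on this. The resistance integral
converges, a uniform first-order Taylor estimate of the Fermi function gives Ohm's law with a
quadratic error, and dominated convergence with thermal factor tending to 1/4 gives the linear
growth in T.

In three dimensions with a radial coupling, 1/R is the average of f against the rescaled bump -ρ',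
and the expansion is Sommerfeld's: the bump has moments 1, 0, π²/3 and decays fast enough that f
need only be integrable away from μ. Monotonicity of R does not follow from an expansion with error
o(T²), so the T-derivative is expanded separately. That f is C² comes from the Hermite series: its
coefficients, weighted by (q+1)^{3/4} in every variable, are absolutely summable, and (q+1)^{3/4} is
also the growth of the first two derivatives of a Hermite function on compact sets. For the second
derivative this needs the local decay (q+1)^{-1/4}, which Sonin's function provides
(`hermiteRate_mul_abs_hermiteFun_le`). -/

/-- The derivatives of the Gaussian `e^{-x²}`. -/
def gaussDeriv (q : ℕ) : ℝ → ℝ := iteratedDeriv q fun y : ℝ => Real.exp (-y ^ 2)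

theorem hasDerivAt_gaussDeriv (q : ℕ) (x : ℝ) :
    HasDerivAt (gaussDeriv q) (gaussDeriv (q + 1) x) x := by
  have h : ContDiff ℝ ⊤ fun y : ℝ => Real.exp (-y ^ 2) := by fun_prop
  have h1 : Differentiable ℝ (iteratedDeriv q fun y : ℝ => Real.exp (-y ^ 2)) :=
    h.differentiable_iteratedDeriv q (by exact_mod_cast WithTop.coe_lt_top _)
  unfold gaussDeriv
  rw [iteratedDeriv_succ]
  exact (h1 x).hasDerivAt

theorem gaussDeriv_zero (x : ℝ) : gaussDeriv 0 x = Real.exp (-x ^ 2) := by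
  simp [gaussDeriv]

theorem gaussDeriv_one (x : ℝ) : gaussDeriv 1 x = -(2 * x) * gaussDeriv 0 x := by
  have h : HasDerivAt (fun y : ℝ => Real.exp (-y ^ 2)) (Real.exp (-x ^ 2) * -(2 * x)) x := by
    have := ((hasDerivAt_pow 2 x).neg).exp
    simpa using this
  have h0 := hasDerivAt_gaussDeriv 0 x
  have e : gaussDeriv 0 = fun y : ℝ => Real.exp (-y ^ 2) := funext gaussDeriv_zero
  rw [e] at h0
  rw [h0.unique h, gaussDeriv_zero]
  ring

/-- The recurrence of the Hermite polynomials. Differentiating it once yields its successor, so the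
induction only compares two expressions for the same derivative. -/
theorem gaussDeriv_succ_succ (q : ℕ) (x : ℝ) :
    gaussDeriv (q + 2) x = -(2 * x) * gaussDeriv (q + 1) x - 2 * (q + 1) * gaussDeriv q x := by
  induction q generalizing x with
  | zero =>
    have h1 := hasDerivAt_gaussDeriv 1 x
    have e : gaussDeriv 1 = fun x => -(2 * x) * gaussDeriv 0 x := funext gaussDeriv_one
    have h2 : HasDerivAt (fun x => -(2 * x) * gaussDeriv 0 x) _ x :=
      (((hasDerivAt_id x).const_mul 2).neg).mul (hasDerivAt_gaussDeriv 0 x)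
    rw [e] at h1
    rw [h1.unique h2]
    simp
    ring
  | succ q ih =>
    have h1 := hasDerivAt_gaussDeriv (q + 2) x
    rw [show gaussDeriv (q + 2) = _ from funext ih] at h1
    have h2 := ((((hasDerivAt_id x).const_mul 2).neg).mul (hasDerivAt_gaussDeriv (q + 1) x)).sub
      ((hasDerivAt_gaussDeriv q x).const_mul (2 * ((q : ℝ) + 1)))
    rw [h1.unique h2]
    simp
    ring

/-- The matrix elements `√(q/2)` of the position operator between Hermite functions. -/
def ladder (q : ℕ) : ℝ := Real.sqrt (q / 2)

theorem ladder_zero : ladder 0 = 0 := by simp [ladder]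

theorem ladder_sq (q : ℕ) : ladder q ^ 2 = q / 2 := Real.sq_sqrt (by positivity)

theorem ladder_nonneg (q : ℕ) : 0 ≤ ladder q := Real.sqrt_nonneg _

theorem ladder_succ_pos (q : ℕ) : 0 < ladder (q + 1) := Real.sqrt_pos.2 (by positivity)

/-- The normalization constant of the Hermite function, with its sign. -/
def hermiteConst (q : ℕ) : ℝ :=
  (-1) ^ q / (Real.sqrt (2 ^ q * q.factorial) * Real.pi ^ (1 / 4 : ℝ))

theorem hermiteFun_eq (q : ℕ) (x : ℝ) :
    hermiteFun q x = hermiteConst q * Real.exp (x ^ 2 / 2) * gaussDeriv q x := rfl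

theorem hermiteConst_succ (q : ℕ) :
    hermiteConst q = -(2 * ladder (q + 1)) * hermiteConst (q + 1) := by
  unfold hermiteConst
  have h : Real.sqrt (2 ^ (q + 1) * ((q + 1).factorial : ℝ)) =
      2 * ladder (q + 1) * Real.sqrt (2 ^ q * q.factorial) := by
    rw [ladder, show (2 : ℝ) = Real.sqrt 4 by
      rw [show (4 : ℝ) = 2 ^ 2 by norm_num]; simp, ← Real.sqrt_mul (by norm_num),
      ← Real.sqrt_mul (by positivity)]
    congr 1
    rw [show Real.sqrt 4 = 2 by rw [show (4 : ℝ) = 2 ^ 2 by norm_num]; simp]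
    push_cast [Nat.factorial_succ]
    ring
  rw [h]
  have h1 := (ladder_succ_pos q).ne'
  have h2 : Real.sqrt (2 ^ q * (q.factorial : ℝ)) ≠ 0 := (Real.sqrt_pos.2 (by positivity)).ne'
  have h3 : Real.pi ^ (1 / 4 : ℝ) ≠ 0 := (Real.rpow_pos_of_pos Real.pi_pos _).ne'
  field_simp
  ring

/-- Position is the sum of the raising and the lowering operator. At `q = 0` the truncated index `q
- 1` is harmless, since its coefficient `ladder 0` vanishes; the same convention is used throughout.
-/
theorem mul_hermiteFun (q : ℕ) (x : ℝ) :
    x * hermiteFun q x =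
      ladder (q + 1) * hermiteFun (q + 1) x + ladder q * hermiteFun (q - 1) x := by
  cases q with
  | zero =>
    simp only [hermiteFun_eq, ladder_zero, zero_mul, add_zero, hermiteConst_succ 0, zero_add,
      gaussDeriv_one]
    ring
  | succ q =>
    simp only [hermiteFun_eq, Nat.add_sub_cancel, hermiteConst_succ q, hermiteConst_succ (q + 1),
      gaussDeriv_succ_succ]
    have := ladder_sq (q + 1)
    push_cast at this
    linear_combination (-4 * ladder (q + 2) * hermiteConst (q + 2) * Real.exp (x ^ 2 / 2) *
      gaussDeriv q x) * this

theorem hasDerivAt_hermiteFun (q : ℕ) (x : ℝ) :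
    HasDerivAt (hermiteFun q)
      (ladder q * hermiteFun (q - 1) x - ladder (q + 1) * hermiteFun (q + 1) x) x := by
  have h1 : HasDerivAt (fun y : ℝ => Real.exp (y ^ 2 / 2)) (Real.exp (x ^ 2 / 2) * x) x := by
    have := ((hasDerivAt_pow 2 x).div_const 2).exp
    simpa using this
  have h2 := (h1.const_mul (hermiteConst q)).mul (hasDerivAt_gaussDeriv q x)
  have e : hermiteFun q = fun x => hermiteConst q * Real.exp (x ^ 2 / 2) * gaussDeriv q x :=
    funext (hermiteFun_eq q)
  have h3 := mul_hermiteFun q x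
  rw [e]
  convert! h2 using 1
  simp only [hermiteFun_eq] at h3 ⊢
  rw [hermiteConst_succ q] at h3 ⊢
  linear_combination -h3

theorem continuous_hermiteFun (q : ℕ) : Continuous (hermiteFun q) :=
  continuous_iff_continuousAt.2 fun x => (hasDerivAt_hermiteFun q x).continuousAt

theorem hermiteFun_zero (x : ℝ) :
    hermiteFun 0 x = (Real.pi ^ (1 / 4 : ℝ))⁻¹ * Real.exp (-x ^ 2 / 2) := by
  rw [hermiteFun_eq, gaussDeriv_zero, mul_assoc, ← Real.exp_add]
  simp [hermiteConst]
  left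
  ring

/-- Solving `mul_hermiteFun` for the function of index `q + 1` trades one unit of the index for one
power of `x`, so strong induction reduces everything to the Gaussian. -/
theorem hermiteFun_rapid_decay (q n : ℕ) : ∃ C : ℝ, ∀ x : ℝ, |x| ^ n * |hermiteFun q x| ≤ C := by
  induction q using Nat.strong_induction_on generalizing n with
  | _ q ih =>
    cases q with
    | zero =>
      refine ⟨(Real.pi ^ (1 / 4 : ℝ))⁻¹ * (1 + 2 ^ n * n.factorial), fun x => ?_⟩
      have h0 : 0 < (Real.pi ^ (1 / 4 : ℝ))⁻¹ := inv_pos.2 (Real.rpow_pos_of_pos Real.pi_pos _)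
      rw [hermiteFun_zero, abs_mul, abs_of_pos h0, abs_of_pos (Real.exp_pos _), mul_left_comm]
      refine mul_le_mul_of_nonneg_left ?_ h0.le
      have h1 : |x| ^ n ≤ 1 + (x ^ 2) ^ n := by
        rw [← pow_mul, mul_comm 2 n, pow_mul, ← abs_pow]
        nlinarith [sq_nonneg (|x ^ n| - 1), sq_abs (x ^ n), abs_nonneg (x ^ n)]
      have h2 := Real.pow_div_factorial_le_exp (x ^ 2 / 2) (by positivity) n
      have h3 : Real.exp (-x ^ 2 / 2) * Real.exp (x ^ 2 / 2) = 1 := by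
        rw [← Real.exp_add]; simp; ring
      have h4 : Real.exp (-x ^ 2 / 2) ≤ 1 := Real.exp_le_one_iff.2 (by nlinarith [sq_nonneg x])
      have h5 : (x ^ 2) ^ n ≤ 2 ^ n * n.factorial * Real.exp (x ^ 2 / 2) := by
        rw [div_pow, div_div, div_le_iff₀ (by positivity)] at h2
        linarith
      calc |x| ^ n * Real.exp (-x ^ 2 / 2)
          ≤ (1 + 2 ^ n * n.factorial * Real.exp (x ^ 2 / 2)) * Real.exp (-x ^ 2 / 2) := by
            gcongr; linarith
        _ = Real.exp (-x ^ 2 / 2) + 2 ^ n * n.factorial *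
              (Real.exp (-x ^ 2 / 2) * Real.exp (x ^ 2 / 2)) := by ring
        _ ≤ _ := by rw [h3]; linarith
    | succ q =>
      obtain ⟨C1, h1⟩ := ih q (by omega) (n + 1)
      obtain ⟨C2, h2⟩ := ih (q - 1) (by omega) n
      refine ⟨(C1 + ladder q * C2) / ladder (q + 1), fun x => ?_⟩
      rw [le_div_iff₀ (ladder_succ_pos q)]
      have h3 : |ladder (q + 1) * hermiteFun (q + 1) x| ≤
          |x| * |hermiteFun q x| + ladder q * |hermiteFun (q - 1) x| := by
        rw [show ladder (q + 1) * hermiteFun (q + 1) x =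
          x * hermiteFun q x - ladder q * hermiteFun (q - 1) x by rw [mul_hermiteFun]; ring]
        refine (abs_sub _ _).trans ?_
        rw [abs_mul, abs_mul, abs_of_nonneg (ladder_nonneg q)]
      rw [abs_mul, abs_of_pos (ladder_succ_pos q)] at h3
      have h4 := mul_le_mul_of_nonneg_left h3 (pow_nonneg (abs_nonneg x) n)
      have h5 := mul_le_mul_of_nonneg_left (h2 x) (ladder_nonneg q)
      have h6 := h1 x
      rw [pow_succ] at h6
      nlinarith

theorem exists_abs_hermiteFun_le (q : ℕ) :
    ∃ C : ℝ, 0 ≤ C ∧ ∀ x : ℝ, |hermiteFun q x| ≤ C * (1 + x ^ 2)⁻¹ := by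
  obtain ⟨C1, h1⟩ := hermiteFun_rapid_decay q 0
  obtain ⟨C2, h2⟩ := hermiteFun_rapid_decay q 2
  have h0 : ∀ x, |hermiteFun q x| ≤ (C1 + C2) * (1 + x ^ 2)⁻¹ := fun x => by
    have := h1 x
    have := h2 x
    rw [sq_abs] at this
    rw [← div_eq_mul_inv, le_div_iff₀ (by positivity)]
    nlinarith
  refine ⟨C1 + C2, ?_, h0⟩
  have := (abs_nonneg _).trans (h0 0)
  simpa using this

theorem integrable_hermiteFun (q : ℕ) : Integrable (hermiteFun q) := by
  obtain ⟨C, _, h⟩ := exists_abs_hermiteFun_le q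
  exact (integrable_inv_one_add_sq.const_mul C).mono'
    (continuous_hermiteFun q).aestronglyMeasurable (ae_of_all _ h)

theorem integrable_hermiteFun_mul (p q : ℕ) :
    Integrable fun x => hermiteFun p x * hermiteFun q x := by
  obtain ⟨C, _, h⟩ := exists_abs_hermiteFun_le q
  refine (integrable_hermiteFun p).mul_bdd (c := C) (continuous_hermiteFun q).aestronglyMeasurable
    (ae_of_all _ fun x => (h x).trans ?_)
  have : (1 + x ^ 2)⁻¹ ≤ 1 := inv_le_one_of_one_le₀ (by nlinarith [sq_nonneg x])
  nlinarith

/-- Raising and lowering operators are adjoint to each other: the derivative of a product integrates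
to zero, and multiplication by `x` is symmetric. Iterating lowers both indices until one is 0, which
gives orthonormality. -/
theorem integral_hermiteFun_mul_succ (p q : ℕ) :
    ladder (q + 1) * ∫ x, hermiteFun p x * hermiteFun (q + 1) x =
      ladder p * ∫ x, hermiteFun (p - 1) x * hermiteFun q x := by
  have hI := integrable_hermiteFun_mul
  have h1 : ∫ x, ((ladder p * hermiteFun (p - 1) x - ladder (p + 1) * hermiteFun (p + 1) x) *
      hermiteFun q x + hermiteFun p x *
        (ladder q * hermiteFun (q - 1) x - ladder (q + 1) * hermiteFun (q + 1) x)) = 0 := by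
    refine integral_eq_zero_of_hasDerivAt_of_integrable
      (fun x => (hasDerivAt_hermiteFun p x).mul (hasDerivAt_hermiteFun q x)) ?_ (hI p q)
    have := (((hI (p - 1) q).const_mul (ladder p)).sub
      ((hI (p + 1) q).const_mul (ladder (p + 1)))).add
      (((hI p (q - 1)).const_mul (ladder q)).sub ((hI p (q + 1)).const_mul (ladder (q + 1))))
    refine this.congr (ae_of_all _ fun x => ?_)
    simp only [Pi.add_apply, Pi.sub_apply]
    ring
  have h2 : ∀ x, (ladder p * hermiteFun (p - 1) x - ladder (p + 1) * hermiteFun (p + 1) x) *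
      hermiteFun q x + hermiteFun p x *
        (ladder q * hermiteFun (q - 1) x - ladder (q + 1) * hermiteFun (q + 1) x) =
      2 * (ladder p * (hermiteFun (p - 1) x * hermiteFun q x)) -
      2 * (ladder (q + 1) * (hermiteFun p x * hermiteFun (q + 1) x)) := fun x => by
    linear_combination (hermiteFun q x) * mul_hermiteFun p x -
      (hermiteFun p x) * mul_hermiteFun q x
  simp_rw [h2] at h1
  rw [integral_sub (((hI _ _).const_mul _).const_mul _) (((hI _ _).const_mul _).const_mul _)] at h1
  simp only [integral_const_mul] at h1
  linarith

theorem integral_hermiteFun_zero : ∫ x, hermiteFun 0 x * hermiteFun 0 x = 1 := by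
  have h : ∀ x, hermiteFun 0 x * hermiteFun 0 x =
      (Real.pi ^ (1 / 2 : ℝ))⁻¹ * Real.exp (-1 * x ^ 2) := fun x => by
    rw [hermiteFun_zero, mul_mul_mul_comm, ← Real.exp_add, ← mul_inv, ← Real.rpow_add Real.pi_pos]
    norm_num
  simp_rw [h]
  rw [integral_const_mul, integral_gaussian, div_one, Real.sqrt_eq_rpow,
    inv_mul_cancel₀ (Real.rpow_pos_of_pos Real.pi_pos _).ne']

theorem integral_hermiteFun_mul (p q : ℕ) :
    ∫ x, hermiteFun p x * hermiteFun q x = if p = q then 1 else 0 := by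
  induction p generalizing q with
  | zero =>
    cases q with
    | zero => simpa using integral_hermiteFun_zero
    | succ q =>
      have := integral_hermiteFun_mul_succ 0 q
      rw [ladder_zero, zero_mul, mul_eq_zero] at this
      simpa using this.resolve_left (ladder_succ_pos q).ne'
  | succ p ih =>
    cases q with
    | zero =>
      have := integral_hermiteFun_mul_succ 0 p
      rw [ladder_zero, zero_mul, mul_eq_zero] at this
      simp_rw [mul_comm (hermiteFun (p + 1) _)]
      simpa using this.resolve_left (ladder_succ_pos p).ne'
    | succ q =>
      have h := integral_hermiteFun_mul_succ (p + 1) q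
      rw [Nat.add_sub_cancel, ih] at h
      by_cases hpq : p = q
      · subst hpq
        simpa [(ladder_succ_pos p).ne'] using h
      · simp only [hpq, if_false, mul_zero, mul_eq_zero] at h
        simpa [hpq] using h.resolve_left (ladder_succ_pos q).ne'

theorem integrable_sq_mul_hermiteFun_sq (q : ℕ) :
    Integrable fun x => x ^ 2 * hermiteFun q x ^ 2 := by
  have h : ∀ x, x ^ 2 * hermiteFun q x ^ 2 =
      ladder (q + 1) ^ 2 * (hermiteFun (q + 1) x * hermiteFun (q + 1) x) +
      2 * ladder (q + 1) * ladder q * (hermiteFun (q + 1) x * hermiteFun (q - 1) x) +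
      ladder q ^ 2 * (hermiteFun (q - 1) x * hermiteFun (q - 1) x) := fun x => by
    rw [← mul_pow, mul_hermiteFun]; ring
  simp_rw [h]
  exact (((integrable_hermiteFun_mul _ _).const_mul _).add
    ((integrable_hermiteFun_mul _ _).const_mul _)).add ((integrable_hermiteFun_mul _ _).const_mul _)

theorem integral_sq_mul_hermiteFun_sq (q : ℕ) :
    ∫ x, x ^ 2 * hermiteFun q x ^ 2 = q + 1 / 2 := by
  have h : ∀ x, x ^ 2 * hermiteFun q x ^ 2 =
      ladder (q + 1) ^ 2 * (hermiteFun (q + 1) x * hermiteFun (q + 1) x) +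
      2 * ladder (q + 1) * ladder q * (hermiteFun (q + 1) x * hermiteFun (q - 1) x) +
      ladder q ^ 2 * (hermiteFun (q - 1) x * hermiteFun (q - 1) x) := fun x => by
    rw [← mul_pow, mul_hermiteFun]; ring
  simp_rw [h]
  rw [integral_add, integral_add]
  · simp only [integral_const_mul, integral_hermiteFun_mul, ladder_sq]
    have : q + 1 ≠ q - 1 := by omega
    simp [this]
    ring
  all_goals
    first
    | exact (integrable_hermiteFun_mul _ _).const_mul _
    | exact ((integrable_hermiteFun_mul _ _).const_mul _).add
        ((integrable_hermiteFun_mul _ _).const_mul _)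

/-- The quantity `(q + 1)^{1/4}`, in powers of which norms of Hermite functions are measured. -/
def hermiteRate (q : ℕ) : ℝ := ((q : ℝ) + 1) ^ (1 / 4 : ℝ)

theorem hermiteRate_pow_four (q : ℕ) : hermiteRate q ^ 4 = q + 1 := by
  rw [hermiteRate, ← Real.rpow_natCast, ← Real.rpow_mul (by positivity)]
  norm_num

theorem one_le_hermiteRate (q : ℕ) : 1 ≤ hermiteRate q :=
  Real.one_le_rpow (by linarith [(Nat.cast_nonneg q : (0 : ℝ) ≤ q)]) (by norm_num)

theorem hermiteRate_pos (q : ℕ) : 0 < hermiteRate q := one_pos.trans_le (one_le_hermiteRate q)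

/-- Cauchy–Schwarz against a Cauchy weight whose width `r ^ 2 = √(q + 1)` is that of the classically
allowed region; the weighted norm is controlled by the second moment `q + 1 / 2`. -/
theorem integral_abs_hermiteFun_le (q : ℕ) : ∫ x, |hermiteFun q x| ≤ 3 * hermiteRate q := by
  set r := hermiteRate q with hr
  have r0 : 0 < r := hermiteRate_pos q
  have r4 : r ^ 4 = q + 1 := hermiteRate_pow_four q
  have hI1 : Integrable fun x => hermiteFun q x ^ 2 := by
    simpa [pow_two] using integrable_hermiteFun_mul q q
  have hI2 := integrable_sq_mul_hermiteFun_sq q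
  have hI3 : Integrable fun x : ℝ => (1 + (x / r ^ 2) ^ 2)⁻¹ :=
    integrable_inv_one_add_sq.comp_div (by positivity)
  -- Cauchy–Schwarz in pointwise form: 2y ≤ r v y² + 1/(r v) with the weight v = 1 + (x/r²)².
  have hb : ∀ x, |hermiteFun q x| ≤ r / 2 * hermiteFun q x ^ 2 +
      (2 * r ^ 3)⁻¹ * (x ^ 2 * hermiteFun q x ^ 2) + (2 * r)⁻¹ * (1 + (x / r ^ 2) ^ 2)⁻¹ := by
    intro x
    set y := |hermiteFun q x|
    set v := 1 + (x / r ^ 2) ^ 2 with hv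
    have v0 : 0 < v := by positivity
    have e : r / 2 * hermiteFun q x ^ 2 + (2 * r ^ 3)⁻¹ * (x ^ 2 * hermiteFun q x ^ 2) =
        r / 2 * v * y ^ 2 := by
      rw [sq_abs, hv]; field_simp
    rw [e]
    have : r / 2 * v * y ^ 2 + (2 * r)⁻¹ * v⁻¹ - y = (r * v * y - 1) ^ 2 / (2 * r * v) := by
      field_simp; ring
    have h2 : 0 ≤ (r * v * y - 1) ^ 2 / (2 * r * v) := by positivity
    linarith
  calc ∫ x, |hermiteFun q x| ≤ ∫ x, (r / 2 * hermiteFun q x ^ 2 +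
      (2 * r ^ 3)⁻¹ * (x ^ 2 * hermiteFun q x ^ 2) + (2 * r)⁻¹ * (1 + (x / r ^ 2) ^ 2)⁻¹) :=
        integral_mono (integrable_hermiteFun q).abs
          (((hI1.const_mul _).add (hI2.const_mul _)).add (hI3.const_mul _)) hb
    _ = r / 2 + (2 * r ^ 3)⁻¹ * (q + 1 / 2) + (2 * r)⁻¹ * (r ^ 2 * Real.pi) := by
        rw [integral_add ((hI1.const_mul _).fun_add (hI2.const_mul _)) (hI3.const_mul _),
          integral_add (hI1.const_mul _) (hI2.const_mul _)]
        simp only [integral_const_mul, integral_sq_mul_hermiteFun_sq]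
        rw [Measure.integral_comp_div (fun x : ℝ => (1 + x ^ 2)⁻¹), integral_univ_inv_one_add_sq]
        have := integral_hermiteFun_mul q q
        simp only [← pow_two, if_true] at this
        rw [this, smul_eq_mul, abs_of_pos (by positivity)]
        ring
    _ ≤ r / 2 + (2 * r ^ 3)⁻¹ * r ^ 4 + (2 * r)⁻¹ * (r ^ 2 * 4) := by
        gcongr
        · rw [r4]; linarith
        · exact Real.pi_le_four
    _ = 3 * r := by field_simp; ring

/-- Hermite functions are eigenfunctions of the Fourier transform. -/
theorem fourier_hermiteFun (q : ℕ) (t : ℝ) :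
    ∫ x : ℝ, cexp (-(I * t * x)) * hermiteFun q x =
      Real.sqrt (2 * Real.pi) * (-I) ^ q * hermiteFun q t := by
  have hm : ∀ q, Integrable fun x : ℝ => cexp (-(I * t * x)) * hermiteFun q x := fun q => by
    refine (integrable_hermiteFun q).ofReal.bdd_mul (c := 1) (by fun_prop) (ae_of_all _ fun x => ?_)
    rw [Complex.norm_exp]
    simp
  -- Integrating the derivative of `e^{-itx} φ_q` shows that the transforms obey, up to powers of
  -- `-i`, the recurrence of the Hermite functions themselves. Only the Gaussian then has to be
  -- computed.
  have hrec : ∀ q, I * t * ∫ x : ℝ, cexp (-(I * t * x)) * hermiteFun q x =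
      ladder q * (∫ x : ℝ, cexp (-(I * t * x)) * hermiteFun (q - 1) x) -
      ladder (q + 1) * ∫ x : ℝ, cexp (-(I * t * x)) * hermiteFun (q + 1) x := fun q => by
    have h0 : ∫ x : ℝ, (cexp (-(I * t * x)) * -(I * t) * hermiteFun q x +
        cexp (-(I * t * x)) * ((ladder q * hermiteFun (q - 1) x -
          ladder (q + 1) * hermiteFun (q + 1) x : ℝ) : ℂ)) = 0 := by
      refine integral_eq_zero_of_hasDerivAt_of_integrable
        (f := fun x : ℝ => cexp (-(I * t * x)) * hermiteFun q x) (fun x => ?_) ?_ (hm q)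
      · refine HasDerivAt.mul ?_ (hasDerivAt_hermiteFun q x).ofReal_comp
        have : HasDerivAt (fun x : ℝ => -(I * t * x)) (-(I * t)) x := by
          simpa using ((Complex.ofRealCLM.hasDerivAt (x := x)).const_mul (I * (t : ℂ))).fun_neg
        exact this.cexp
      · refine (((hm q).const_mul (-(I * t))).add (((hm (q - 1)).const_mul (ladder q : ℂ)).sub
          ((hm (q + 1)).const_mul (ladder (q + 1) : ℂ)))).congr (ae_of_all _ fun x => ?_)
        simp only [Pi.add_apply, Pi.sub_apply]
        push_cast
        ring
    have h1 : ∀ x : ℝ, cexp (-(I * t * x)) * -(I * t) * hermiteFun q x +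
        cexp (-(I * t * x)) * ((ladder q * hermiteFun (q - 1) x -
          ladder (q + 1) * hermiteFun (q + 1) x : ℝ) : ℂ) =
        (-(I * t)) * (cexp (-(I * t * x)) * hermiteFun q x) +
        (ladder q * (cexp (-(I * t * x)) * hermiteFun (q - 1) x) -
          ladder (q + 1) * (cexp (-(I * t * x)) * hermiteFun (q + 1) x)) := fun x => by
      push_cast; ring
    simp_rw [h1] at h0
    have h2 : Integrable fun x : ℝ => ladder q * (cexp (-(I * t * x)) * hermiteFun (q - 1) x) -
        ladder (q + 1) * (cexp (-(I * t * x)) * hermiteFun (q + 1) x) :=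
      ((hm (q - 1)).const_mul _).sub ((hm (q + 1)).const_mul _)
    rw [integral_add ((hm q).const_mul _) h2, integral_sub ((hm (q - 1)).const_mul _)
      ((hm (q + 1)).const_mul _)] at h0
    simp only [integral_const_mul] at h0
    linear_combination -h0
  induction q using Nat.strong_induction_on with
  | _ q ih =>
    cases q with
    | zero =>
      have h := fourierIntegral_gaussian (b := 1 / 2) (by norm_num) (-t)
      have e : ∀ x : ℝ, cexp (-(I * t * x)) * hermiteFun 0 x =
          ((Real.pi ^ (1 / 4 : ℝ))⁻¹ : ℝ) * (cexp (I * -t * x) * cexp (-(1 / 2) * x ^ 2)) :=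
        fun x => by
          rw [hermiteFun_zero]
          push_cast
          rw [show -(I * t * (x : ℂ)) = I * -t * x by ring,
            show -(x : ℂ) ^ 2 / 2 = -(1 / 2) * x ^ 2 by ring]
          ring
      simp_rw [e]
      rw [integral_const_mul, h, hermiteFun_zero]
      have h2 : ((Real.pi : ℂ) / (1 / 2)) ^ (1 / 2 : ℂ) = (Real.sqrt (2 * Real.pi) : ℝ) := by
        rw [Real.sqrt_eq_rpow, Complex.ofReal_cpow (by positivity)]
        congr 1
        · push_cast; ring
        · norm_num
      rw [h2]
      push_cast
      rw [show -(-(t : ℂ)) ^ 2 / (4 * (1 / 2)) = -(t : ℂ) ^ 2 / 2 by ring]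
      ring
    | succ q =>
      have h := hrec q
      rw [ih q (by omega)] at h
      have h2 := congrArg (fun x : ℝ => (x : ℂ)) (mul_hermiteFun q t)
      push_cast at h2
      have hne : (ladder (q + 1) : ℂ) ≠ 0 := by exact_mod_cast (ladder_succ_pos q).ne'
      refine mul_left_cancel₀ hne ?_
      cases q with
      | zero =>
        simp only [ladder_zero, ofReal_zero, zero_mul, zero_sub, add_zero] at h h2
        linear_combination h - I * Real.sqrt (2 * Real.pi) * h2
      | succ q =>
        rw [Nat.add_sub_cancel, ih q (by omega)] at h
        rw [Nat.add_sub_cancel] at h2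
        linear_combination (exp := 1) h + Real.sqrt (2 * Real.pi) * (-I) ^ (q + 2) * h2
          + (Real.sqrt (2 * Real.pi) * (-I) ^ q * ladder (q + 1) * hermiteFun q t) * I_sq

/-- Being its own Fourier transform up to a phase, a Hermite function is bounded by its `L¹` norm
divided by `√(2π)`. -/
theorem abs_hermiteFun_le (q : ℕ) (x : ℝ) : |hermiteFun q x| ≤ 2 * hermiteRate q := by
  have h := congrArg norm (fourier_hermiteFun q x)
  rw [norm_mul, norm_mul, norm_pow, norm_neg, norm_I, one_pow, mul_one, norm_real, norm_real,
    Real.norm_eq_abs, Real.norm_eq_abs, abs_of_nonneg (Real.sqrt_nonneg _)] at h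
  have h1 : Real.sqrt (2 * Real.pi) * |hermiteFun q x| ≤ 3 * hermiteRate q := by
    rw [← h]
    refine (norm_integral_le_integral_norm _).trans ((le_of_eq ?_).trans
      (integral_abs_hermiteFun_le q))
    refine integral_congr_ae (ae_of_all _ fun y => ?_)
    simp only [norm_mul, Complex.norm_exp, norm_real]
    simp
  have h2 : (3 / 2 : ℝ) ≤ Real.sqrt (2 * Real.pi) :=
    Real.le_sqrt_of_sq_le (by nlinarith [Real.pi_gt_three])
  nlinarith [abs_nonneg (hermiteFun q x)]

/-- The equation of the harmonic oscillator, φ'' = (x² - 2q - 1) φ. -/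
theorem hasDerivAt_hermiteFun_deriv (q : ℕ) (x : ℝ) :
    HasDerivAt (fun x => ladder q * hermiteFun (q - 1) x - ladder (q + 1) * hermiteFun (q + 1) x)
      ((x ^ 2 - (2 * q + 1)) * hermiteFun q x) x := by
  have h1 : HasDerivAt (fun x => 2 * (ladder q * hermiteFun (q - 1) x) - x * hermiteFun q x)
      (2 * (ladder q * (ladder (q - 1) * hermiteFun (q - 1 - 1) x -
        ladder (q - 1 + 1) * hermiteFun (q - 1 + 1) x)) -
        (1 * hermiteFun q x + x * (ladder q * hermiteFun (q - 1) x -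
          ladder (q + 1) * hermiteFun (q + 1) x))) x :=
    (((hasDerivAt_hermiteFun (q - 1) x).const_mul (ladder q)).const_mul 2).sub
      ((hasDerivAt_id x).mul (hasDerivAt_hermiteFun q x))
  have e : (fun x => ladder q * hermiteFun (q - 1) x - ladder (q + 1) * hermiteFun (q + 1) x) =
      fun x => 2 * (ladder q * hermiteFun (q - 1) x) - x * hermiteFun q x := by
    ext x; rw [mul_hermiteFun]; ring
  rw [e]
  convert! h1 using 1
  have h2 := mul_hermiteFun q x
  cases q with
  | zero =>
    simp only [ladder_zero, Nat.cast_zero, zero_add, zero_mul, add_zero] at h2 ⊢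
    linear_combination x * h2
  | succ q =>
    have h3 := mul_hermiteFun q x
    have h4 := ladder_sq (q + 1)
    simp only [Nat.add_sub_cancel] at h2 ⊢
    push_cast at h4 ⊢
    linear_combination x * h2 + (2 * ladder (q + 1)) * h3 + (4 * hermiteFun (q + 1) x) * h4

/-- At the origin `mul_hermiteFun` becomes a two-step recurrence with ratio (q+1)/(q+2) for the
squares; odd indices give zero. This is the q^{-1/4} size of φ_q(0) and the starting value for
Sonin's function. -/
theorem hermiteFun_zero_apply_sq (q : ℕ) : (hermiteFun q 0 ^ 2) ^ 2 * (q + 1) ≤ 1 := by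
  induction q using Nat.strong_induction_on with
  | _ q ih =>
    match q with
    | 0 =>
      have h : hermiteFun 0 0 ^ 4 = Real.pi⁻¹ := by
        rw [hermiteFun_zero]
        norm_num
        rw [← Real.rpow_natCast, ← Real.rpow_mul Real.pi_pos.le]
        norm_num
      have h2 : Real.pi⁻¹ ≤ 1 := inv_le_one_of_one_le₀ (by linarith [Real.pi_gt_three])
      rw [← pow_mul]
      simpa [h] using h2
    | 1 =>
      have h := mul_hermiteFun 0 0
      simp only [ladder_zero, zero_mul, add_zero, zero_add] at h
      have := (mul_eq_zero.1 h.symm).resolve_left (ladder_succ_pos 0).ne'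
      simp [this]
    | q + 2 =>
      have h := mul_hermiteFun (q + 1) 0
      rw [zero_mul, Nat.add_sub_cancel] at h
      have h1 : (ladder (q + 2) ^ 2 * hermiteFun (q + 2) 0 ^ 2) =
          (ladder (q + 1) ^ 2 * hermiteFun q 0 ^ 2) := by
        linear_combination (ladder (q + 1 + 1) * hermiteFun (q + 1 + 1) 0 -
          ladder (q + 1) * hermiteFun q 0) * -h
      rw [ladder_sq, ladder_sq] at h1
      have h2 := ih q (by omega)
      push_cast at h1 ⊢
      have h3 : hermiteFun (q + 2) 0 ^ 2 = (q + 1) / (q + 2) * hermiteFun q 0 ^ 2 := by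
        field_simp
        linarith
      rw [h3, mul_pow, div_pow]
      have h4 : ((q : ℝ) + 1) ^ 2 / (q + 2) ^ 2 * (q + 2 + 1) ≤ q + 1 := by
        rw [div_mul_eq_mul_div, div_le_iff₀ (by positivity)]
        nlinarith [(Nat.cast_nonneg q : (0 : ℝ) ≤ q)]
      calc _ = (hermiteFun q 0 ^ 2) ^ 2 * (((q : ℝ) + 1) ^ 2 / (q + 2) ^ 2 * (q + 2 + 1)) := by ring
        _ ≤ (hermiteFun q 0 ^ 2) ^ 2 * (q + 1) := by gcongr
        _ ≤ 1 := h2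

/-- Sonin's monotone quantity for the Hermite equation is maximal at the origin. -/
theorem sonin_le (q : ℕ) (x : ℝ) :
    (ladder q * hermiteFun (q - 1) x - ladder (q + 1) * hermiteFun (q + 1) x) ^ 2 +
      (2 * q + 1 - x ^ 2) * hermiteFun q x ^ 2 ≤
    (ladder q * hermiteFun (q - 1) 0 - ladder (q + 1) * hermiteFun (q + 1) 0) ^ 2 +
      (2 * q + 1) * hermiteFun q 0 ^ 2 := by
  set S : ℝ → ℝ := fun x =>
    (ladder q * hermiteFun (q - 1) x - ladder (q + 1) * hermiteFun (q + 1) x) ^ 2 +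
      (2 * q + 1 - x ^ 2) * hermiteFun q x ^ 2 with hS
  have hd : ∀ x, HasDerivAt S (-(2 * x * hermiteFun q x ^ 2)) x := fun x => by
    have h1 := (hasDerivAt_hermiteFun_deriv q x).pow 2
    have h2 := (((hasDerivAt_pow 2 x).const_sub (2 * (q : ℝ) + 1))).mul
      ((hasDerivAt_hermiteFun q x).pow 2)
    refine (h1.add h2).congr_deriv ?_
    simp
    ring
  have hS0 : S x ≤ S 0 := by
    have hc : Continuous S := continuous_iff_continuousAt.2 fun x => (hd x).continuousAt
    rcases le_total 0 x with h | h
    · refine antitoneOn_of_deriv_nonpos (convex_Ici 0) hc.continuousOn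
        (fun y _ => (hd y).differentiableAt.differentiableWithinAt) (fun y hy => ?_)
        (Set.mem_Ici.2 le_rfl) h h
      rw [interior_Ici, Set.mem_Ioi] at hy
      rw [(hd y).deriv]
      have : 0 ≤ 2 * y * hermiteFun q y ^ 2 := by positivity
      linarith
    · refine monotoneOn_of_deriv_nonneg (convex_Iic 0) hc.continuousOn
        (fun y _ => (hd y).differentiableAt.differentiableWithinAt) (fun y hy => ?_)
        h (Set.mem_Iic.2 le_rfl) h
      rw [interior_Iic, Set.mem_Iio] at hy
      rw [(hd y).deriv]
      nlinarith [sq_nonneg (hermiteFun q y)]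
  simpa [hS] using hS0

/-- Hermite functions are O(q^{-1/4}) on compact sets, better than the uniform bound by a factor
q^{1/2}. This is what keeps second derivatives within the weights available in the Hermite series.
-/
theorem hermiteRate_mul_abs_hermiteFun_le (q : ℕ) (x : ℝ) :
    hermiteRate q * |hermiteFun q x| ≤ 2 * (|x| + 1) := by
  set r := hermiteRate q with hr
  have r1 : 1 ≤ r := one_le_hermiteRate q
  have r4 : r ^ 4 = q + 1 := hermiteRate_pow_four q
  have hx : x ^ 2 = |x| ^ 2 := (sq_abs x).symm
  have x0 := abs_nonneg x
  -- Where x² ≤ q, Sonin's function dominates (q+1) φ(x)² and is at most 4r², its bound at the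
  -- origin. Elsewhere r² ≤ |x| + 1, so the uniform bound already suffices.
  by_cases hq : x ^ 2 ≤ q
  · have h1 := sonin_le q x
    have h2 : hermiteFun q 0 ^ 2 * r ^ 2 ≤ 1 := by
      have := hermiteFun_zero_apply_sq q
      rw [← r4] at this
      refine le_of_sq_le_sq ?_ zero_le_one
      nlinarith
    have h3 : (ladder q * hermiteFun (q - 1) 0 - ladder (q + 1) * hermiteFun (q + 1) 0) ^ 2 ≤
        2 * r ^ 2 := by
      have e := mul_hermiteFun q 0
      rw [zero_mul] at e
      rw [show ladder q * hermiteFun (q - 1) 0 - ladder (q + 1) * hermiteFun (q + 1) 0 =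
        2 * (ladder q * hermiteFun (q - 1) 0) by linarith, mul_pow, mul_pow, ladder_sq]
      cases q with
      | zero => simp; positivity
      | succ p =>
        have h4 := hermiteFun_zero_apply_sq p
        rw [Nat.add_sub_cancel]
        push_cast at r4 ⊢
        have h5 : ((p : ℝ) + 1) * hermiteFun p 0 ^ 2 ≤ r ^ 2 := by
          refine le_of_sq_le_sq ?_ (by positivity)
          have : (r ^ 2) ^ 2 = (p : ℝ) + 1 + 1 := by rw [← r4]; ring
          rw [this]
          nlinarith [(Nat.cast_nonneg p : (0 : ℝ) ≤ p)]
        nlinarith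
    have h6 : (2 * (q : ℝ) + 1) * hermiteFun q 0 ^ 2 ≤ 2 * r ^ 2 := by
      have : (2 * (q : ℝ) + 1) ≤ 2 * r ^ 4 := by rw [r4]; linarith
      nlinarith [sq_nonneg (hermiteFun q 0)]
    have h7 : r ^ 4 * hermiteFun q x ^ 2 ≤ 4 * r ^ 2 := by
      rw [r4]
      nlinarith [sq_nonneg (hermiteFun q x), sq_nonneg
        (ladder q * hermiteFun (q - 1) x - ladder (q + 1) * hermiteFun (q + 1) x)]
    have h8 : (r * |hermiteFun q x|) ^ 2 ≤ 2 ^ 2 := by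
      rw [mul_pow, sq_abs]
      have : 0 < r ^ 2 := by positivity
      nlinarith
    have := le_of_sq_le_sq h8 (by norm_num)
    linarith
  · have h1 := abs_hermiteFun_le q x
    rw [← hr] at h1
    have h2 : r ^ 2 ≤ |x| + 1 := by
      refine le_of_sq_le_sq ?_ (by positivity)
      have : (r ^ 2) ^ 2 = (q : ℝ) + 1 := by rw [← r4]; ring
      rw [this]
      nlinarith
    nlinarith

theorem ladder_le (q : ℕ) : ladder q ≤ hermiteRate q ^ 2 := by
  refine Real.sqrt_le_iff.2 ⟨by positivity, ?_⟩
  rw [← pow_mul, hermiteRate_pow_four]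
  have := (Nat.cast_nonneg q : (0 : ℝ) ≤ q)
  linarith

theorem hermiteRate_mono : Monotone hermiteRate := fun p q h => by
  unfold hermiteRate
  gcongr

theorem hermiteRate_succ_le (q : ℕ) : hermiteRate (q + 1) ≤ 2 * hermiteRate q := by
  refine le_of_pow_le_pow_left₀ (n := 4) (by norm_num)
    (mul_nonneg zero_le_two (hermiteRate_pos q).le) ?_
  rw [mul_pow, hermiteRate_pow_four, hermiteRate_pow_four]
  push_cast
  have := (Nat.cast_nonneg q : (0 : ℝ) ≤ q)
  linarith

theorem abs_hermiteFun_deriv_le (q : ℕ) (x : ℝ) :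
    |ladder q * hermiteFun (q - 1) x - ladder (q + 1) * hermiteFun (q + 1) x| ≤
      18 * hermiteRate q ^ 3 := by
  have h1 := abs_hermiteFun_le (q - 1) x
  have h2 := abs_hermiteFun_le (q + 1) x
  have h3 := ladder_le q
  have h5 := hermiteRate_mono (Nat.sub_le q 1)
  have h6 := hermiteRate_succ_le q
  have r0 := hermiteRate_pos q
  have h4 : ladder (q + 1) ≤ 2 * hermiteRate q ^ 2 - hermiteRate q ^ 2 + hermiteRate q ^ 2 := by
    refine Real.sqrt_le_iff.2 ⟨by nlinarith, ?_⟩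
    have := hermiteRate_pow_four q
    push_cast
    nlinarith [(Nat.cast_nonneg q : (0 : ℝ) ≤ q)]
  have h7 : |ladder q * hermiteFun (q - 1) x| ≤ hermiteRate q ^ 2 * (2 * hermiteRate q) := by
    rw [abs_mul, abs_of_nonneg (ladder_nonneg q)]
    exact mul_le_mul h3 (by linarith) (abs_nonneg _) (by positivity)
  have h8 : |ladder (q + 1) * hermiteFun (q + 1) x| ≤
      (2 * hermiteRate q ^ 2) * (4 * hermiteRate q) := by
    rw [abs_mul, abs_of_nonneg (ladder_nonneg _)]
    exact mul_le_mul (by linarith) (by linarith) (abs_nonneg _) (by positivity)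
  have h9 := abs_sub (ladder q * hermiteFun (q - 1) x) (ladder (q + 1) * hermiteFun (q + 1) x)
  have : 0 < hermiteRate q ^ 3 := by positivity
  nlinarith

/-- The factor of the oscillator equation costs `hermiteRate q ^ 4`, and the local decay returns one
power. The uniform bound would only give the fifth power. -/
theorem abs_hermiteFun_deriv_two_le (q : ℕ) (x : ℝ) :
    |(x ^ 2 - (2 * q + 1)) * hermiteFun q x| ≤ 8 * (|x| + 1) ^ 3 * hermiteRate q ^ 3 := by
  have h1 := hermiteRate_mul_abs_hermiteFun_le q x
  have r1 := one_le_hermiteRate q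
  have r4 := hermiteRate_pow_four q
  rw [abs_mul]
  have h2 : |x ^ 2 - (2 * (q : ℝ) + 1)| ≤ 2 * (|x| + 1) ^ 2 * hermiteRate q ^ 4 := by
    rw [r4, abs_le]
    have hx := sq_abs x
    have x0 := abs_nonneg x
    have q0 := (Nat.cast_nonneg q : (0 : ℝ) ≤ q)
    constructor
    · nlinarith [mul_nonneg x0 q0, mul_nonneg (mul_nonneg x0 x0) q0]
    · nlinarith [mul_nonneg x0 q0, mul_nonneg (mul_nonneg x0 x0) q0]
  calc _ ≤ 2 * (|x| + 1) ^ 2 * hermiteRate q ^ 4 * |hermiteFun q x| := by gcongr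
    _ = 2 * (|x| + 1) ^ 2 * hermiteRate q ^ 3 * (hermiteRate q * |hermiteFun q x|) := by ring
    _ ≤ 2 * (|x| + 1) ^ 2 * hermiteRate q ^ 3 * (2 * (|x| + 1)) := by gcongr
    _ = 4 * (|x| + 1) ^ 3 * hermiteRate q ^ 3 := by ring
    _ ≤ _ := by gcongr; norm_num

end Junction
end


noncomputable section

namespace Junction

/-! ### Canonical anticommutation relations on Fock space -/

section CAR

variable {K : Type} [NormedAddCommGroup K] [InnerProductSpace ℂ K] [CompleteSpace K]

/-- The sign picked up when the mode `i` is annihilated in front of the occupied set `S`. -/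
def modeSign (i : Mode K) (S : Finset (Mode K)) : ℂ := (-1) ^ (S.filter (· < i)).card

theorem modeSign_mul_self (i : Mode K) (S : Finset (Mode K)) :
    modeSign i S * modeSign i S = 1 := by
  rw [modeSign, ← pow_add, ← two_mul, pow_mul]; simp

theorem conj_modeSign (i : Mode K) (S : Finset (Mode K)) :
    starRingEnd ℂ (modeSign i S) = modeSign i S := by
  simp [modeSign]

/-- A mode occupied below `i` flips the sign of `i`. For two distinct modes exactly one of the two
orders does so, which is why they anticommute. -/
theorem modeSign_insert (i j : Mode K) {S : Finset (Mode K)} (h : j ∉ S) :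
    modeSign i (insert j S) = if j < i then -modeSign i S else modeSign i S := by
  unfold modeSign
  rw [Finset.filter_insert]
  split_ifs with hj
  · rw [Finset.card_insert_of_notMem (by simp [h]), pow_succ]; ring
  · rfl

theorem annihMode_apply (i : Mode K) (ψ : Fock K) (S : Finset (Mode K)) :
    annihMode i ψ S = if i ∈ S then 0 else modeSign i S * ψ (insert i S) := rfl

theorem annihMode_single (i : Mode K) (S : Finset (Mode K)) :
    annihMode i (lp.single 2 S (1 : ℂ)) =
      if i ∈ S then modeSign i (S.erase i) • lp.single 2 (S.erase i) (1 : ℂ) else 0 := by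
  ext T
  rw [annihMode_apply]
  by_cases hT : i ∈ T
  · rw [if_pos hT]
    split_ifs with hS
    · have : T ≠ S.erase i := fun h => by simp [h] at hT
      simp [lp.coeFn_smul, lp.single_apply, this]
    · simp
  · rw [if_neg hT, lp.coeFn_single]
    split_ifs with hS
    · by_cases h : T = S.erase i
      · subst h
        simp [lp.coeFn_smul, Finset.insert_erase hS]
      · have : insert i T ≠ S := fun h' => h (by rw [← h', Finset.erase_insert hT])
        simp [lp.coeFn_smul, h, this]
    · have : insert i T ≠ S := fun h' => hS (by simp [← h'])
      simp [this]

theorem adjoint_annihMode_apply (i : Mode K) (ψ : Fock K) (S : Finset (Mode K)) :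
    ContinuousLinearMap.adjoint (annihMode i) ψ S =
      if i ∈ S then modeSign i (S.erase i) * ψ (S.erase i) else 0 := by
  have h := ContinuousLinearMap.adjoint_inner_right (annihMode i) (lp.single 2 S (1 : ℂ)) ψ
  rw [lp.inner_single_left, annihMode_single] at h
  rw [show ContinuousLinearMap.adjoint (annihMode i) ψ S =
    ⟪(1 : ℂ), ContinuousLinearMap.adjoint (annihMode i) ψ S⟫ by simp, h]
  split_ifs with hS
  · rw [inner_smul_left, lp.inner_single_left, conj_modeSign]
    simp
  · simp

theorem annihMode_anticomm (i j : Mode K) :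
    annihMode i * annihMode j + annihMode j * annihMode i = 0 := by
  ext ψ S
  change annihMode i (annihMode j ψ) S + annihMode j (annihMode i ψ) S = 0
  simp only [annihMode_apply]
  by_cases hij : i = j
  · subst hij; simp
  by_cases hi : i ∈ S
  · simp [hi]
  by_cases hj : j ∈ S
  · simp [hj]
  simp only [hi, hj, if_false, Finset.mem_insert, hij, Ne.symm hij, or_self,
    modeSign_insert j i hi, modeSign_insert i j hj, Finset.insert_comm i j]
  rcases lt_or_gt_of_ne hij with h | h
  · simp [h, h.not_gt]; ring
  · simp [h, h.not_gt]; ring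

theorem annihMode_adjoint_anticomm (i j : Mode K) :
    annihMode i * ContinuousLinearMap.adjoint (annihMode j) +
      ContinuousLinearMap.adjoint (annihMode j) * annihMode i = if i = j then 1 else 0 := by
  ext ψ S
  have e : (annihMode i * ContinuousLinearMap.adjoint (annihMode j) +
      ContinuousLinearMap.adjoint (annihMode j) * annihMode i) ψ S =
    annihMode i (ContinuousLinearMap.adjoint (annihMode j) ψ) S +
      ContinuousLinearMap.adjoint (annihMode j) (annihMode i ψ) S := rfl
  rw [e]
  simp only [annihMode_apply, adjoint_annihMode_apply]
  by_cases hij : i = j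
  · subst hij
    by_cases hi : i ∈ S
    · simp [hi, ← mul_assoc, modeSign_mul_self, Finset.insert_erase hi]
    · simp [hi, ← mul_assoc, modeSign_mul_self, Finset.erase_insert hi]
  · rw [if_neg hij]
    by_cases hi : i ∈ S
    · have : i ∈ S.erase j := Finset.mem_erase.2 ⟨hij, hi⟩
      simp [hi, this]
    · by_cases hj : j ∈ S
      · have h1 : i ∉ S.erase j := fun h => hi (Finset.mem_of_mem_erase h)
        have h2 : (insert i S).erase j = insert i (S.erase j) :=
          Finset.erase_insert_of_ne hij
        have h3 : modeSign i S = if j < i then -modeSign i (S.erase j) else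
            modeSign i (S.erase j) := by
          conv_lhs => rw [← Finset.insert_erase hj]
          exact modeSign_insert i j (Finset.notMem_erase j S)
        simp only [hi, hj, h1, if_true, if_false, Finset.mem_insert, or_true, h2, h3,
          modeSign_insert j i h1]
        rcases lt_or_gt_of_ne hij with h | h
        · simp [h, h.not_gt]; ring
        · simp [h, h.not_gt]; ring
      · simp [hi, hj, Ne.symm hij]

/-- An operator with `A A* + A* A = c` has norm at most `√c`. -/
theorem norm_sq_le_of_anticomm {A : FockOp K} {c : ℝ}
    (h : A * ContinuousLinearMap.adjoint A + ContinuousLinearMap.adjoint A * A = (c : ℂ) • 1) :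
    ‖A‖ ≤ √c := by
  refine A.opNorm_le_bound (Real.sqrt_nonneg _) fun ψ => ?_
  have h1 := congrArg (fun B : FockOp K => ⟪ψ, B ψ⟫) h
  have h2 : ⟪ψ, A (ContinuousLinearMap.adjoint A ψ)⟫ +
      ⟪ψ, ContinuousLinearMap.adjoint A (A ψ)⟫ = c * ⟪ψ, ψ⟫ := by
    rw [← inner_add_right, ← inner_smul_right]
    exact h1
  rw [ContinuousLinearMap.adjoint_inner_right, ← ContinuousLinearMap.adjoint_inner_left,
    inner_self_eq_norm_sq_to_K, inner_self_eq_norm_sq_to_K, inner_self_eq_norm_sq_to_K] at h2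
  have h3 : ‖ContinuousLinearMap.adjoint A ψ‖ ^ 2 + ‖A ψ‖ ^ 2 = c * ‖ψ‖ ^ 2 := by
    apply Complex.ofReal_injective
    push_cast
    exact h2
  have h4 : ‖A ψ‖ ^ 2 ≤ c * ‖ψ‖ ^ 2 := by nlinarith [sq_nonneg ‖ContinuousLinearMap.adjoint A ψ‖]
  calc ‖A ψ‖ = √(‖A ψ‖ ^ 2) := (Real.sqrt_sq (norm_nonneg _)).symm
    _ ≤ √(c * ‖ψ‖ ^ 2) := Real.sqrt_le_sqrt h4
    _ = √c * ‖ψ‖ := by rw [Real.sqrt_mul' _ (sq_nonneg _), Real.sqrt_sq (norm_nonneg _)]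

/-- The anticommutation relations of the modes give A A* + A* A = Σ |cᵢ|² for such a sum, so the
operator norm is controlled by the ℓ² norm of the coefficients rather than the ℓ¹ norm. -/
theorem norm_sum_annihMode_le (s : Finset (Mode K)) (c : Mode K → ℂ) :
    ‖∑ i ∈ s, c i • annihMode i‖ ≤ √(∑ i ∈ s, ‖c i‖ ^ 2) := by
  refine norm_sq_le_of_anticomm ?_
  simp only [map_sum, LinearIsometryEquiv.map_smulₛₗ, Finset.sum_mul_sum]
  conv_lhs =>
    arg 2
    rw [Finset.sum_comm]
  rw [← Finset.sum_add_distrib]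
  simp_rw [← Finset.sum_add_distrib, smul_mul_smul_comm, mul_comm (starRingEnd ℂ (c _)),
    ← smul_add, annihMode_adjoint_anticomm]
  push_cast
  rw [Finset.sum_smul]
  refine Finset.sum_congr rfl fun i hi => ?_
  rw [Finset.sum_eq_single i]
  · simp [Complex.mul_conj, Complex.normSq_eq_norm_sq]
  · intro j _ hj
    simp [Ne.symm hj]
  · exact fun h => absurd hi h

theorem summable_norm_inner_modeBasis_sq (f : K) :
    Summable fun i => ‖⟪f, modeBasis K i⟫‖ ^ 2 := by
  have h := (lp.memℓp ((modeBasis K).repr f)).summable (by simp)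
  refine h.congr fun i => ?_
  rw [HilbertBasis.repr_apply_apply, ← norm_inner_symm]
  simp

/-- Cauchy criterion in operator norm: by the previous estimate the tails are bounded by ℓ² tails of
the basis coefficients. Without this the `tsum` in `annih` could be its default value 0. -/
theorem hasSum_annih (f : K) :
    HasSum (fun i => ⟪f, modeBasis K i⟫ • annihMode i) (annih f) := by
  refine Summable.hasSum ?_
  rw [summable_iff_vanishing_norm]
  intro ε hε
  obtain ⟨s, hs⟩ := summable_iff_vanishing_norm.1 (summable_norm_inner_modeBasis_sq f) (ε ^ 2)
    (by positivity)
  refine ⟨s, fun t ht => (norm_sum_annihMode_le t _).trans_lt ?_⟩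
  have := hs t ht
  rw [Real.norm_of_nonneg (Finset.sum_nonneg fun _ _ => sq_nonneg _)] at this
  rw [Real.sqrt_lt' hε]
  exact this

/-- Carries linear and bilinear identities from single modes to `annih` and `creat`, term by term.
-/
theorem eq_of_hasSum_congr {ι E : Type*} [AddCommMonoid E] [TopologicalSpace E] [T2Space E]
    {f g : ι → E} {a b : E} (hf : HasSum f a) (hg : HasSum g b) (h : ∀ i, f i = g i) : a = b :=
  hf.unique (by rwa [show f = g from funext h])

theorem hasSum_creat (f : K) :
    HasSum (fun i => ⟪modeBasis K i, f⟫ • ContinuousLinearMap.adjoint (annihMode i)) (creat f) := by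
  have h := (hasSum_annih f).map
    (ContinuousLinearMap.adjoint : FockOp K ≃ₗᵢ⋆[ℂ] FockOp K)
    (ContinuousLinearMap.adjoint : FockOp K ≃ₗᵢ⋆[ℂ] FockOp K).continuous
  have e : (fun i => ⟪modeBasis K i, f⟫ • ContinuousLinearMap.adjoint (annihMode i)) =
      (ContinuousLinearMap.adjoint : FockOp K ≃ₗᵢ⋆[ℂ] FockOp K) ∘
        fun i => ⟪f, modeBasis K i⟫ • annihMode i := by
    ext1 i
    rw [Function.comp, LinearIsometryEquiv.map_smulₛₗ, inner_conj_symm]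
  rw [e]
  exact h

theorem annih_add (f g : K) : annih (f + g) = annih f + annih g :=
  eq_of_hasSum_congr (hasSum_annih (f + g)) ((hasSum_annih f).add (hasSum_annih g)) fun i => by
    rw [inner_add_left, add_smul]

theorem annih_smul (c : ℂ) (f : K) : annih (c • f) = starRingEnd ℂ c • annih f :=
  eq_of_hasSum_congr (hasSum_annih (c • f)) ((hasSum_annih f).const_smul (starRingEnd ℂ c))
    fun i => by rw [inner_smul_left, smul_smul]

theorem creat_add (f g : K) : creat (f + g) = creat f + creat g := by
  simp [creat, annih_add]

theorem creat_smul (c : ℂ) (f : K) : creat (c • f) = c • creat f := by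
  rw [creat, annih_smul, LinearIsometryEquiv.map_smulₛₗ, Complex.conj_conj, creat]

theorem annih_anticomm (f g : K) : annih f * annih g + annih g * annih f = 0 := by
  have h1 : ∀ i, annihMode i * annih g + annih g * annihMode i = 0 := fun i => by
    refine eq_of_hasSum_congr (((hasSum_annih g).mul_left (annihMode i)).add
      ((hasSum_annih g).mul_right (annihMode i))) hasSum_zero fun j => ?_
    rw [mul_smul_comm, smul_mul_assoc, ← smul_add, annihMode_anticomm, smul_zero]
  refine eq_of_hasSum_congr (((hasSum_annih f).mul_right (annih g)).add
    ((hasSum_annih f).mul_left (annih g))) hasSum_zero fun i => ?_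
  rw [mul_smul_comm, smul_mul_assoc, ← smul_add, h1, smul_zero]

theorem annih_creat_anticomm (f g : K) :
    annih f * creat g + creat g * annih f = ⟪f, g⟫ • (1 : FockOp K) := by
  have h1 : ∀ i, annihMode i * creat g + creat g * annihMode i =
      ⟪modeBasis K i, g⟫ • (1 : FockOp K) := fun i => by
    have h2 := hasSum_single (f := fun j => ⟪modeBasis K j, g⟫ •
      (annihMode i * ContinuousLinearMap.adjoint (annihMode j) +
      ContinuousLinearMap.adjoint (annihMode j) * annihMode i)) i
      (fun j hj => by rw [annihMode_adjoint_anticomm, if_neg (Ne.symm hj), smul_zero])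
    rw [annihMode_adjoint_anticomm, if_pos rfl] at h2
    refine eq_of_hasSum_congr (((hasSum_creat g).mul_left (annihMode i)).add
      ((hasSum_creat g).mul_right (annihMode i))) h2 fun j => ?_
    rw [mul_smul_comm, smul_mul_assoc, ← smul_add]
  refine eq_of_hasSum_congr (((hasSum_annih f).mul_right (creat g)).add
    ((hasSum_annih f).mul_left (creat g)))
    (((modeBasis K).hasSum_inner_mul_inner f g).smul_const (1 : FockOp K)) fun i => ?_
  rw [mul_smul_comm, smul_mul_assoc, ← smul_add, h1, smul_smul]

theorem creat_anticomm (f g : K) : creat f * creat g + creat g * creat f = 0 := by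
  have h := congrArg (ContinuousLinearMap.adjoint : FockOp K ≃ₗᵢ⋆[ℂ] FockOp K)
    (annih_anticomm g f)
  simpa [creat, ContinuousLinearMap.mul_def, ContinuousLinearMap.adjoint_comp] using h

theorem norm_annih_le (f : K) : ‖annih f‖ ≤ ‖f‖ := by
  have h := annih_creat_anticomm f f
  rw [inner_self_eq_norm_sq_to_K] at h
  have := norm_sq_le_of_anticomm (c := ‖f‖ ^ 2) (A := annih f) (by simpa [creat] using h)
  rwa [Real.sqrt_sq (norm_nonneg _)] at this

theorem norm_creat_le (f : K) : ‖creat f‖ ≤ ‖f‖ := by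
  rw [creat, LinearIsometryEquiv.norm_map]
  exact norm_annih_le f

theorem annih_vacuum (f : K) : annih f (vacuum K) = 0 := by
  have h := (hasSum_annih f).mapL (ContinuousLinearMap.apply ℂ (Fock K) (vacuum K))
  refine eq_of_hasSum_congr h hasSum_zero fun i => ?_
  simp [vacuum, annihMode_single]

theorem norm_vacuum : ‖vacuum K‖ = 1 := by
  rw [vacuum, lp.norm_single (by simp)]
  simp

end CAR

end Junction
end


noncomputable section

namespace Junction

variable {d : ℕ}

/-! ### Functions of the one-particle energy -/

theorem coeFn_toL2 {f : Space d → ℂ} (h : MemLp f 2 volume) : toL2 f =ᵐ[volume] f := by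
  rw [toL2, dif_pos h]
  exact h.coeFn_toLp

/-- The one-particle energy in momentum space. -/
def waveEnergy (ξ : Space d) : ℝ := (2 * Real.pi * ‖ξ‖) ^ 2

theorem continuous_waveEnergy : Continuous (waveEnergy : Space d → ℝ) := by
  unfold waveEnergy; fun_prop

theorem memLp_multiplier {m : ℝ → ℂ} (hm : Measurable m) {C : ℝ} (hC : ∀ x, ‖m x‖ ≤ C)
    (F : OneParticle d) : MemLp (fun ξ => m (waveEnergy ξ) * F ξ) 2 volume :=
  (Lp.memLp F).of_le_mul (c := C)
    ((hm.comp continuous_waveEnergy.measurable).aestronglyMeasurable.mul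
      (Lp.aestronglyMeasurable F))
    (ae_of_all _ fun ξ => by rw [norm_mul]; gcongr; exact hC _)

theorem fourier_energyFunction {m : ℝ → ℂ} (hm : Measurable m) {C : ℝ} (hC : ∀ x, ‖m x‖ ≤ C)
    (f : OneParticle d) : (𝓕 (energyFunction m f) : OneParticle d) =ᵐ[volume]
      fun ξ => m (waveEnergy ξ) * (𝓕 f : OneParticle d) ξ := by
  unfold energyFunction
  rw [FourierTransform.fourier_fourierInv_eq]
  exact coeFn_toL2 (memLp_multiplier hm hC _)

theorem oneParticle_ext_fourier {f g : OneParticle d}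
    (h : (𝓕 f : OneParticle d) =ᵐ[volume] (𝓕 g : OneParticle d)) : f = g := by
  have : (𝓕 f : OneParticle d) = 𝓕 g := Lp.ext h
  exact (Lp.fourierTransformₗᵢ (Space d) ℂ).injective this

theorem energyFunction_add {m : ℝ → ℂ} (hm : Measurable m) {C : ℝ} (hC : ∀ x, ‖m x‖ ≤ C)
    (f g : OneParticle d) :
    energyFunction m (f + g) = energyFunction m f + energyFunction m g := by
  refine oneParticle_ext_fourier ?_
  rw [FourierTransform.fourier_add]
  filter_upwards [fourier_energyFunction hm hC (f + g), fourier_energyFunction hm hC f,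
    fourier_energyFunction hm hC g,
    Lp.coeFn_add (𝓕 (energyFunction m f) : OneParticle d) (𝓕 (energyFunction m g)),
    Lp.coeFn_add (𝓕 f : OneParticle d) (𝓕 g)] with ξ h1 h2 h3 h4 h5
  rw [h1, h4, Pi.add_apply, h2, h3, FourierTransform.fourier_add, h5, Pi.add_apply, mul_add]

theorem energyFunction_smul {m : ℝ → ℂ} (hm : Measurable m) {C : ℝ} (hC : ∀ x, ‖m x‖ ≤ C)
    (c : ℂ) (f : OneParticle d) : energyFunction m (c • f) = c • energyFunction m f := by
  refine oneParticle_ext_fourier ?_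
  rw [FourierTransform.fourier_smul]
  filter_upwards [fourier_energyFunction hm hC (c • f), fourier_energyFunction hm hC f,
    Lp.coeFn_smul c (𝓕 (energyFunction m f) : OneParticle d),
    Lp.coeFn_smul c (𝓕 f : OneParticle d)] with ξ h1 h2 h3 h4
  rw [h1, h3, Pi.smul_apply, h2, FourierTransform.fourier_smul, h4, Pi.smul_apply, smul_eq_mul,
    smul_eq_mul]
  ring

theorem inner_oneParticle_fourier (f g : OneParticle d) :
    ⟪f, g⟫ = ∫ ξ, starRingEnd ℂ ((𝓕 f : OneParticle d) ξ) * (𝓕 g : OneParticle d) ξ := by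
  rw [← Lp.inner_fourier_eq, L2.inner_def]
  exact integral_congr_ae (ae_of_all _ fun ξ => mul_comm _ _)

theorem inner_energyFunction {m n : ℝ → ℂ} (hm : Measurable m) (hn : Measurable n) {C : ℝ}
    (hC : ∀ x, ‖m x‖ ≤ C) (hC' : ∀ x, ‖n x‖ ≤ C) (f g : OneParticle d) :
    ⟪energyFunction m f, energyFunction n g⟫ =
      ∫ ξ, starRingEnd ℂ (m (waveEnergy ξ)) * n (waveEnergy ξ) *
        (starRingEnd ℂ ((𝓕 f : OneParticle d) ξ) * (𝓕 g : OneParticle d) ξ) := by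
  rw [inner_oneParticle_fourier]
  refine integral_congr_ae ?_
  filter_upwards [fourier_energyFunction hm hC f, fourier_energyFunction hn hC' g] with ξ h1 h2
  rw [h1, h2, map_mul]
  ring

theorem integrable_conj_mul (F G : OneParticle d) :
    Integrable fun ξ => starRingEnd ℂ (F ξ) * G ξ := by
  have := L2.integrable_inner (𝕜 := ℂ) F G
  simpa [mul_comm] using this

theorem norm_energyFunction_le {m : ℝ → ℂ} (hm : Measurable m) {C : ℝ} (hC : ∀ x, ‖m x‖ ≤ C)
    (f : OneParticle d) : ‖energyFunction m f‖ ≤ C * ‖f‖ := by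
  rw [← Lp.norm_fourier_eq (energyFunction m f), ← Lp.norm_fourier_eq f]
  refine Lp.norm_le_mul_norm_of_ae_le_mul ?_
  filter_upwards [fourier_energyFunction hm hC f] with ξ h
  rw [h, norm_mul]
  gcongr
  exact hC _

/-! ### The fields of the reservoirs -/

theorem fermi_pos (β μ ω : ℝ) : 0 < fermi β μ ω := by unfold fermi; positivity

theorem fermi_le_one (β μ ω : ℝ) : fermi β μ ω ≤ 1 :=
  inv_le_one_of_one_le₀ (by linarith [Real.exp_pos (β * (ω - μ))])

theorem continuous_fermi (β μ : ℝ) : Continuous (fermi β μ) := by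
  unfold fermi
  exact Continuous.inv₀ (by fun_prop) fun x => by positivity

/-- The multiplier `√ρ`. -/
def sqrtFermi (β μ : ℝ) (ω : ℝ) : ℂ := (Real.sqrt (fermi β μ ω) : ℂ)

/-- The multiplier `√(1 - ρ)`. -/
def sqrtFermiHole (β μ : ℝ) (ω : ℝ) : ℂ := (Real.sqrt (1 - fermi β μ ω) : ℂ)

theorem measurable_sqrtFermi (β μ : ℝ) : Measurable (sqrtFermi β μ) := by
  have := (continuous_fermi β μ).measurable
  unfold sqrtFermi; fun_prop

theorem measurable_sqrtFermiHole (β μ : ℝ) : Measurable (sqrtFermiHole β μ) := by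
  have := (continuous_fermi β μ).measurable
  unfold sqrtFermiHole; fun_prop

theorem norm_sqrtFermi_le (β μ ω : ℝ) : ‖sqrtFermi β μ ω‖ ≤ 1 := by
  rw [sqrtFermi, norm_real, Real.norm_of_nonneg (Real.sqrt_nonneg _), Real.sqrt_le_one]
  exact fermi_le_one β μ ω

theorem norm_sqrtFermiHole_le (β μ ω : ℝ) : ‖sqrtFermiHole β μ ω‖ ≤ 1 := by
  rw [sqrtFermiHole, norm_real, Real.norm_of_nonneg (Real.sqrt_nonneg _), Real.sqrt_le_one]
  linarith [fermi_pos β μ ω]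

theorem conj_sqrtFermi_mul (β μ ω : ℝ) :
    starRingEnd ℂ (sqrtFermi β μ ω) * sqrtFermi β μ ω = fermi β μ ω := by
  rw [sqrtFermi, conj_ofReal, ← ofReal_mul, Real.mul_self_sqrt (fermi_pos β μ ω).le]

theorem conj_sqrtFermiHole_mul (β μ ω : ℝ) :
    starRingEnd ℂ (sqrtFermiHole β μ ω) * sqrtFermiHole β μ ω = (1 - fermi β μ ω : ℝ) := by
  rw [sqrtFermiHole, conj_ofReal, ← ofReal_mul,
    Real.mul_self_sqrt (by linarith [fermi_le_one β μ ω])]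

/-- The form `⟨g, ρ f⟩` of the density of a reservoir. -/
def densityForm (β μ : ℝ) (g f : OneParticle d) : ℂ :=
  ⟪energyFunction (sqrtFermi β μ) g, energyFunction (sqrtFermi β μ) f⟫

theorem densityForm_eq (β μ : ℝ) (g f : OneParticle d) :
    densityForm β μ g f = ∫ ξ, (fermi β μ (waveEnergy ξ) : ℂ) *
      (starRingEnd ℂ ((𝓕 g : OneParticle d) ξ) * (𝓕 f : OneParticle d) ξ) := by
  rw [densityForm, inner_energyFunction (measurable_sqrtFermi β μ) (measurable_sqrtFermi β μ)
    (norm_sqrtFermi_le β μ) (norm_sqrtFermi_le β μ)]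
  simp_rw [conj_sqrtFermi_mul]

/-- Particles carry the weight 1 - ρ and holes the weight ρ. That these add up to 1 is why the
doubled fields satisfy the canonical anticommutation relations. -/
theorem inner_sqrtFermi_add (β μ : ℝ) (f g : OneParticle d) :
    ⟪energyFunction (sqrtFermiHole β μ) f, energyFunction (sqrtFermiHole β μ) g⟫ +
      densityForm β μ f g = ⟪f, g⟫ := by
  have hI := integrable_conj_mul (𝓕 f : OneParticle d) (𝓕 g)
  have hb : ∀ m : ℝ → ℝ, Continuous m → (∀ x, ‖m x‖ ≤ 1) → Integrable fun ξ : Space d =>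
      (m (waveEnergy ξ) : ℂ) *
        (starRingEnd ℂ ((𝓕 f : OneParticle d) ξ) * (𝓕 g : OneParticle d) ξ) :=
    fun m hm h1 => hI.bdd_mul (c := 1)
      (continuous_ofReal.comp (hm.comp continuous_waveEnergy)).aestronglyMeasurable
      (ae_of_all _ fun ξ => by rw [norm_real]; exact h1 _)
  rw [densityForm_eq, inner_energyFunction (measurable_sqrtFermiHole β μ)
    (measurable_sqrtFermiHole β μ) (norm_sqrtFermiHole_le β μ) (norm_sqrtFermiHole_le β μ),
    inner_oneParticle_fourier f g]
  simp_rw [conj_sqrtFermiHole_mul]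
  rw [← integral_add]
  · refine integral_congr_ae (ae_of_all _ fun ξ => ?_)
    simp only
    push_cast
    ring
  · refine hb (fun x => 1 - fermi β μ x) (continuous_const.sub (continuous_fermi β μ)) fun x => ?_
    rw [Real.norm_of_nonneg (by linarith [fermi_le_one β μ x])]
    linarith [fermi_pos β μ x]
  · refine hb _ (continuous_fermi β μ) fun x => ?_
    rw [Real.norm_of_nonneg (fermi_pos β μ x).le]
    exact fermi_le_one β μ x

/-- Complex conjugation is antiunitary. It makes the hole part antilinear, so that both parts of
`field` depend antilinearly on the wave function. -/
theorem inner_star_star (F G : OneParticle d) : ⟪star F, star G⟫ = ⟪G, F⟫ := by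
  rw [L2.inner_def, L2.inner_def]
  refine integral_congr_ae ?_
  filter_upwards [Lp.coeFn_star F, Lp.coeFn_star G] with x h1 h2
  rw [h1, h2]
  simp [mul_comm]

theorem inner_piLp_single {ι : Type} [Fintype ι] [DecidableEq ι] (i j : ι) (F G : OneParticle d) :
    ⟪(PiLp.single 2 i F : PiLp 2 fun _ : ι => OneParticle d), PiLp.single 2 j G⟫ =
      if i = j then ⟪F, G⟫ else 0 := by
  rw [PiLp.inner_apply, Finset.sum_eq_single i]
  · by_cases h : i = j
    · subst h; simp
    · simp [h]
  · intro k _ hk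
    simp [hk]
  · simp

theorem star_add_oneParticle (F G : OneParticle d) : star (F + G) = star F + star G := by
  refine Lp.ext ?_
  filter_upwards [Lp.coeFn_star (F + G), Lp.coeFn_star F, Lp.coeFn_star G, Lp.coeFn_add F G,
    Lp.coeFn_add (star F) (star G)] with x h1 h2 h3 h4 h5
  rw [h1, h5, Pi.add_apply, h2, h3, Pi.star_apply, h4, Pi.add_apply, star_add]
  rfl

theorem star_smul_oneParticle (c : ℂ) (F : OneParticle d) :
    star (c • F) = starRingEnd ℂ c • star F := by
  refine Lp.ext ?_
  filter_upwards [Lp.coeFn_star (c • F), Lp.coeFn_star F, Lp.coeFn_smul c F,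
    Lp.coeFn_smul (starRingEnd ℂ c) (star F)] with x h1 h2 h3 h4
  rw [h1, h4, Pi.smul_apply, h2, Pi.star_apply, h3, Pi.smul_apply, smul_eq_mul, star_mul']
  rfl

theorem norm_star_oneParticle (F : OneParticle d) : ‖star F‖ = ‖F‖ := by
  have h := inner_star_star F F
  rw [inner_self_eq_norm_sq_to_K, inner_self_eq_norm_sq_to_K] at h
  have h2 : ‖star F‖ ^ 2 = ‖F‖ ^ 2 := by
    apply Complex.ofReal_injective
    push_cast
    exact h
  exact (pow_left_inj₀ (norm_nonneg _) (norm_nonneg _) two_ne_zero).1 h2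

theorem piLp_single_smul {ι : Type} [Fintype ι] [DecidableEq ι] (i : ι) (c : ℂ)
    (F : OneParticle d) : (PiLp.single 2 i (c • F) : PiLp 2 fun _ : ι => OneParticle d) =
      c • PiLp.single 2 i F := by
  ext1 j
  by_cases h : j = i
  · subst h; simp
  · simp [h]

theorem add_mul_add_add_mul_add {R : Type*} [Ring R] (A B C D : R) :
    (A + B) * (C + D) + (C + D) * (A + B) =
      (A * C + C * A) + (A * D + D * A) + (B * C + C * B) + (B * D + D * B) := by
  noncomm_ring

section Fields

variable (β μ : Reservoir → ℝ)

/-- The particle component of a field. -/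
def particlePart (r : Reservoir) (f : OneParticle d) : Doubled d :=
  PiLp.single 2 (r, true) (energyFunction (sqrtFermiHole (β r) (μ r)) f)

/-- The hole component of a field. -/
def holePart (r : Reservoir) (f : OneParticle d) : Doubled d :=
  PiLp.single 2 (r, false) (star (energyFunction (sqrtFermi (β r) (μ r)) f))

theorem field_eq (r : Reservoir) (f : OneParticle d) :
    field β μ r f = annih (particlePart β μ r f) + creat (holePart β μ r f) := rfl

theorem fieldStar_eq (r : Reservoir) (f : OneParticle d) :
    fieldStar β μ r f = creat (particlePart β μ r f) + annih (holePart β μ r f) := by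
  simp [fieldStar, field_eq, creat]

theorem inner_holePart (r r' : Reservoir) (f g : OneParticle d) :
    ⟪holePart β μ r f, holePart β μ r' g⟫ =
      if r = r' then densityForm (β r) (μ r) g f else 0 := by
  rw [holePart, holePart, inner_piLp_single, inner_star_star]
  by_cases h : r = r'
  · subst h; simp [densityForm]
  · simp [h]

theorem inner_particlePart (r r' : Reservoir) (f g : OneParticle d) :
    ⟪particlePart β μ r f, particlePart β μ r' g⟫ =
      if r = r' then ⟪energyFunction (sqrtFermiHole (β r) (μ r)) f,
        energyFunction (sqrtFermiHole (β r) (μ r)) g⟫ else 0 := by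
  rw [particlePart, particlePart, inner_piLp_single]
  by_cases h : r = r'
  · subst h; simp
  · simp [h]

theorem inner_particlePart_holePart (r r' : Reservoir) (f g : OneParticle d) :
    ⟪particlePart β μ r f, holePart β μ r' g⟫ = 0 := by
  rw [particlePart, holePart, inner_piLp_single, if_neg (by simp)]

theorem field_anticomm (r r' : Reservoir) (f g : OneParticle d) :
    field β μ r f * field β μ r' g + field β μ r' g * field β μ r f = 0 := by
  have h1 := annih_anticomm (particlePart β μ r f) (particlePart β μ r' g)
  have h2 := creat_anticomm (holePart β μ r f) (holePart β μ r' g)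
  have h3 := annih_creat_anticomm (particlePart β μ r f) (holePart β μ r' g)
  have h4 := annih_creat_anticomm (particlePart β μ r' g) (holePart β μ r f)
  rw [inner_particlePart_holePart, zero_smul] at h3 h4
  rw [field_eq, field_eq, add_mul_add_add_mul_add, h1, h2, h3, add_comm (creat _ * annih _), h4]
  simp

theorem fieldStar_anticomm (r r' : Reservoir) (f g : OneParticle d) :
    fieldStar β μ r f * fieldStar β μ r' g + fieldStar β μ r' g * fieldStar β μ r f = 0 := by
  have h := congrArg (ContinuousLinearMap.adjoint :
    FockOp (Doubled d) ≃ₗᵢ⋆[ℂ] FockOp (Doubled d)) (field_anticomm β μ r' r g f)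
  simpa [fieldStar, ContinuousLinearMap.mul_def, ContinuousLinearMap.adjoint_comp] using h

/-- Only particle–particle and hole–hole pairings survive, and their weights recombine by
`inner_sqrtFermi_add`; different reservoirs lie in orthogonal components. -/
theorem field_fieldStar_anticomm (r r' : Reservoir) (f g : OneParticle d) :
    field β μ r f * fieldStar β μ r' g + fieldStar β μ r' g * field β μ r f =
      (if r = r' then ⟪f, g⟫ else 0) • (1 : FockOp (Doubled d)) := by
  have h1 := annih_creat_anticomm (particlePart β μ r f) (particlePart β μ r' g)
  have h2 := annih_creat_anticomm (holePart β μ r' g) (holePart β μ r f)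
  have h3 := annih_anticomm (particlePart β μ r f) (holePart β μ r' g)
  have h4 := creat_anticomm (holePart β μ r f) (particlePart β μ r' g)
  have h5 : ⟪particlePart β μ r f, particlePart β μ r' g⟫ +
      ⟪holePart β μ r' g, holePart β μ r f⟫ = if r = r' then ⟪f, g⟫ else 0 := by
    rw [inner_particlePart, inner_holePart]
    by_cases h : r = r'
    · subst h
      simpa using inner_sqrtFermi_add (β r) (μ r) f g
    · simp [h, Ne.symm h]
  rw [field_eq, fieldStar_eq, ← h5, add_smul, add_mul_add_add_mul_add, h1, h3, h4,
    add_comm (creat _ * annih _), h2]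
  simp

theorem field_vacuum (r : Reservoir) (f : OneParticle d) :
    field β μ r f (vacuum (Doubled d)) = creat (holePart β μ r f) (vacuum (Doubled d)) := by
  rw [field_eq, add_apply, annih_vacuum, zero_add]

/-- The particle part annihilates the vacuum, so both sides reduce to one created hole, and holes
have density ρ. The order of `g` and `f` is reversed by the conjugation in the hole part. -/
theorem expect_fieldStar_mul_field (r r' : Reservoir) (f g : OneParticle d) :
    expect (fieldStar β μ r f * field β μ r' g) =
      if r = r' then densityForm (β r) (μ r) g f else 0 := by
  rw [← inner_holePart, expect, mul_apply_eq_comp, fieldStar,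
    ContinuousLinearMap.adjoint_inner_right, field_vacuum, field_vacuum, creat,
    ContinuousLinearMap.adjoint_inner_left]
  have h := congrArg (fun A : FockOp (Doubled d) => A (vacuum (Doubled d)))
    (annih_creat_anticomm (holePart β μ r f) (holePart β μ r' g))
  simp only [add_apply, mul_apply_eq_comp, annih_vacuum, map_zero,
    add_zero, smul_apply, one_apply_eq_self] at h
  rw [h, inner_smul_right, inner_self_eq_norm_sq_to_K, norm_vacuum]
  simp

/-- The expectation as a continuous linear functional. -/
def expectCLM : FockOp (Doubled d) →L[ℂ] ℂ :=
  (innerSL ℂ (vacuum (Doubled d))).comp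
    (ContinuousLinearMap.apply ℂ (Fock (Doubled d)) (vacuum (Doubled d)))

theorem expectCLM_apply (A : FockOp (Doubled d)) : expectCLM A = expect A := rfl

/-- Moving `C D` through `A B` produces quartic terms that cancel, because four sign changes occur;
only the two contractions are left. For this reason the two-point function suffices at second order.
-/
theorem commutator_quadratic {R : Type*} [Ring R] [Algebra ℂ R] {A B C D : R} {x y : ℂ}
    (hAC : A * C + C * A = 0) (hBD : B * D + D * B = 0) (hBC : B * C + C * B = x • (1 : R))
    (hDA : D * A + A * D = y • (1 : R)) :
    ⁅A * B, C * D⁆ = x • (A * D) - y • (C * B) := by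
  have h1 : B * C = x • (1 : R) - C * B := eq_sub_of_add_eq hBC
  have h2 : D * A = y • (1 : R) - A * D := eq_sub_of_add_eq hDA
  have h3 : A * C = -(C * A) := eq_neg_of_add_eq_zero_left hAC
  have h4 : B * D = -(D * B) := eq_neg_of_add_eq_zero_left hBD
  have e1 : A * B * (C * D) = x • (A * D) - C * A * D * B := by
    calc A * B * (C * D) = A * (B * C) * D := by noncomm_ring
      _ = x • (A * D) - (A * C) * (B * D) := by
        rw [h1, mul_sub, sub_mul, mul_smul_comm, mul_one, smul_mul_assoc]; noncomm_ring
      _ = _ := by rw [h3, h4]; noncomm_ring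
  have e2 : C * D * (A * B) = y • (C * B) - C * A * D * B := by
    calc C * D * (A * B) = C * (D * A) * B := by noncomm_ring
      _ = _ := by
        rw [h2, mul_sub, sub_mul, mul_smul_comm, mul_one, smul_mul_assoc]; noncomm_ring
  rw [Ring.lie_def, e1, e2]
  abel

theorem expect_commutator (r₁ r₁' r₂ r₂' : Reservoir) (f₁ g₁ f₂ g₂ : OneParticle d) :
    expect ⁅fieldStar β μ r₁ f₁ * field β μ r₁' g₁, fieldStar β μ r₂ f₂ * field β μ r₂' g₂⁆ =
      if r₁' = r₂ ∧ r₁ = r₂' then ⟪g₁, f₂⟫ * densityForm (β r₁) (μ r₁) g₂ f₁ -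
        ⟪g₂, f₁⟫ * densityForm (β r₂) (μ r₂) g₁ f₂ else 0 := by
  rw [commutator_quadratic (fieldStar_anticomm β μ r₁ r₂ f₁ f₂) (field_anticomm β μ r₁' r₂' g₁ g₂)
    (field_fieldStar_anticomm β μ r₁' r₂ g₁ f₂) (field_fieldStar_anticomm β μ r₂' r₁ g₂ f₁),
    ← expectCLM_apply, map_sub, map_smul, map_smul, expectCLM_apply, expectCLM_apply,
    expect_fieldStar_mul_field, expect_fieldStar_mul_field]
  by_cases h1 : r₁' = r₂
  · by_cases h2 : r₁ = r₂'
    · simp [h1, h2]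
    · simp [h2, Ne.symm h2]
  · simp [h1, Ne.symm h1]

theorem norm_particlePart_le (r : Reservoir) (f : OneParticle d) :
    ‖particlePart β μ r f‖ ≤ ‖f‖ := by
  rw [particlePart, PiLp.norm_single]
  simpa using norm_energyFunction_le (measurable_sqrtFermiHole (β r) (μ r))
    (norm_sqrtFermiHole_le (β r) (μ r)) f

theorem norm_holePart_le (r : Reservoir) (f : OneParticle d) : ‖holePart β μ r f‖ ≤ ‖f‖ := by
  rw [holePart, PiLp.norm_single, norm_star_oneParticle]
  simpa using norm_energyFunction_le (measurable_sqrtFermi (β r) (μ r))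
    (norm_sqrtFermi_le (β r) (μ r)) f

theorem norm_field_le (r : Reservoir) (f : OneParticle d) : ‖field β μ r f‖ ≤ 2 * ‖f‖ := by
  rw [field_eq, two_mul]
  exact (norm_add_le _ _).trans (add_le_add
    ((norm_annih_le _).trans (norm_particlePart_le β μ r f))
    ((norm_creat_le _).trans (norm_holePart_le β μ r f)))

theorem norm_fieldStar_le (r : Reservoir) (f : OneParticle d) :
    ‖fieldStar β μ r f‖ ≤ 2 * ‖f‖ := by
  rw [fieldStar, LinearIsometryEquiv.norm_map]
  exact norm_field_le β μ r f

theorem field_add (r : Reservoir) (f g : OneParticle d) :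
    field β μ r (f + g) = field β μ r f + field β μ r g := by
  have h1 : particlePart β μ r (f + g) = particlePart β μ r f + particlePart β μ r g := by
    rw [particlePart, energyFunction_add (measurable_sqrtFermiHole _ _)
      (norm_sqrtFermiHole_le _ _), PiLp.single_add]
    rfl
  have h2 : holePart β μ r (f + g) = holePart β μ r f + holePart β μ r g := by
    rw [holePart, energyFunction_add (measurable_sqrtFermi _ _)
      (norm_sqrtFermi_le _ _), star_add_oneParticle, PiLp.single_add]
    rfl
  rw [field_eq, h1, h2, annih_add, creat_add, field_eq, field_eq]
  abel

theorem field_smul (r : Reservoir) (c : ℂ) (f : OneParticle d) :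
    field β μ r (c • f) = starRingEnd ℂ c • field β μ r f := by
  have h1 : particlePart β μ r (c • f) = c • particlePart β μ r f := by
    rw [particlePart, energyFunction_smul (measurable_sqrtFermiHole _ _)
      (norm_sqrtFermiHole_le _ _), piLp_single_smul]
    rfl
  have h2 : holePart β μ r (c • f) = starRingEnd ℂ c • holePart β μ r f := by
    rw [holePart, energyFunction_smul (measurable_sqrtFermi _ _)
      (norm_sqrtFermi_le _ _), star_smul_oneParticle, piLp_single_smul]
    rfl
  rw [field_eq, h1, h2, annih_smul, creat_smul, field_eq, smul_add]

theorem fieldStar_smul (r : Reservoir) (c : ℂ) (f : OneParticle d) :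
    fieldStar β μ r (c • f) = c • fieldStar β μ r f := by
  rw [fieldStar, field_smul, LinearIsometryEquiv.map_smulₛₗ, Complex.conj_conj, fieldStar]

theorem continuous_field (r : Reservoir) : Continuous (field β μ r : OneParticle d → _) := by
  refine (AddMonoidHomClass.continuous_of_bound
    (AddMonoidHom.mk' (field β μ r : OneParticle d → _) (field_add β μ r)) 2
    fun f => norm_field_le β μ r f : _)

theorem continuous_fieldStar (r : Reservoir) :
    Continuous (fieldStar β μ r : OneParticle d → _) :=
  (ContinuousLinearMap.adjoint : FockOp (Doubled d) ≃ₗᵢ⋆[ℂ] FockOp (Doubled d)).continuous.comp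
    (continuous_field β μ r)

end Fields

end Junction
end


noncomputable section

namespace Junction

variable {d : ℕ}

/-! ### Hermite functions in several dimensions -/

theorem integral_space_prod {𝕜 : Type*} [RCLike 𝕜] (f : Fin d → ℝ → 𝕜) :
    ∫ x : Space d, ∏ i, f i (x i) = ∏ i, ∫ t, f i t := by
  rw [← integral_fintype_prod_volume_eq_prod]
  exact (EuclideanSpace.volume_preserving_symm_measurableEquiv_toLp (Fin d)).integral_comp'
    (g := fun x : Fin d → ℝ => ∏ i, f i (x i))

theorem integrable_space_prod {𝕜 : Type*} [RCLike 𝕜] {f : Fin d → ℝ → 𝕜}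
    (hf : ∀ i, Integrable (f i)) : Integrable fun x : Space d => ∏ i, f i (x i) :=
  ((EuclideanSpace.volume_preserving_symm_measurableEquiv_toLp (Fin d)).integrable_comp_emb
    (MeasurableEquiv.measurableEmbedding _)).2 (Integrable.fintype_prod (𝕜 := 𝕜) hf)

theorem continuous_hermiteSpace (q : Fin d → ℕ) : Continuous (hermiteSpace q) := by
  unfold hermiteSpace
  exact continuous_finsetProd _ fun i _ => (continuous_hermiteFun (q i)).comp (by fun_prop)

theorem integrable_hermiteSpace (q : Fin d → ℕ) : Integrable (hermiteSpace q) :=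
  integrable_space_prod fun i => integrable_hermiteFun (q i)

theorem integrable_hermiteSpace_mul (p q : Fin d → ℕ) :
    Integrable fun x => hermiteSpace p x * hermiteSpace q x := by
  simp only [hermiteSpace, ← Finset.prod_mul_distrib]
  exact integrable_space_prod (f := fun i t => hermiteFun (p i) t * hermiteFun (q i) t)
    fun i => integrable_hermiteFun_mul _ _

theorem integral_hermiteSpace_mul (p q : Fin d → ℕ) :
    ∫ x, hermiteSpace p x * hermiteSpace q x = if p = q then 1 else 0 := by
  simp only [hermiteSpace, ← Finset.prod_mul_distrib]
  rw [integral_space_prod fun i t => hermiteFun (p i) t * hermiteFun (q i) t]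
  simp only [integral_hermiteFun_mul]
  split_ifs with h
  · simp [h]
  · obtain ⟨i, hi⟩ := Function.ne_iff.1 h
    exact Finset.prod_eq_zero (Finset.mem_univ i) (by simp [hi])

/-- The product of the `(q_i + 1)^{1/4}`. -/
def rateProd (q : Fin d → ℕ) : ℝ := ∏ i, hermiteRate (q i)

theorem one_le_rateProd (q : Fin d → ℕ) : 1 ≤ rateProd q :=
  Finset.one_le_prod fun i _ => one_le_hermiteRate (q i)

theorem rateProd_pos (q : Fin d → ℕ) : 0 < rateProd q := one_pos.trans_le (one_le_rateProd q)

theorem abs_hermiteSpace_le (q : Fin d → ℕ) (x : Space d) :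
    |hermiteSpace q x| ≤ 2 ^ d * rateProd q := by
  rw [hermiteSpace, Finset.abs_prod, rateProd]
  calc _ ≤ ∏ i, 2 * hermiteRate (q i) :=
        Finset.prod_le_prod (fun _ _ => abs_nonneg _) fun i _ => abs_hermiteFun_le _ _
    _ = _ := by simp [Finset.prod_mul_distrib]

theorem integral_abs_hermiteSpace_le (q : Fin d → ℕ) :
    ∫ x, |hermiteSpace q x| ≤ 3 ^ d * rateProd q := by
  simp only [hermiteSpace, Finset.abs_prod, rateProd]
  rw [integral_space_prod fun i t => |hermiteFun (q i) t|]
  calc _ ≤ ∏ i, 3 * hermiteRate (q i) :=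
        Finset.prod_le_prod (fun _ _ => integral_nonneg fun _ => abs_nonneg _)
          fun i _ => integral_abs_hermiteFun_le _
    _ = _ := by simp [Finset.prod_mul_distrib]

/-- The total degree of a multi-index. -/
def totalDegree (q : Fin d → ℕ) : ℕ := ∑ i, q i

theorem fourier_hermiteSpace (q : Fin d → ℕ) (k : Space d) :
    ∫ x : Space d, cexp (-(I * (inner ℝ k x : ℝ))) * hermiteSpace q x =
      (Real.sqrt (2 * Real.pi) : ℂ) ^ d * (-I) ^ totalDegree q * hermiteSpace q k := by
  have h : ∀ x : Space d, cexp (-(I * (inner ℝ k x : ℝ))) * hermiteSpace q x =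
      ∏ i, cexp (-(I * k i * x i)) * hermiteFun (q i) (x i) := fun x => by
    rw [Finset.prod_mul_distrib, ← Complex.exp_sum, hermiteSpace, PiLp.inner_apply]
    push_cast
    rw [Finset.mul_sum, ← Finset.sum_neg_distrib]
    congr 3
    ext i
    simp
    ring
  simp_rw [h]
  rw [integral_space_prod fun i t => cexp (-(I * k i * t)) * hermiteFun (q i) t]
  simp only [fourier_hermiteFun, Finset.prod_mul_distrib, hermiteSpace, totalDegree,
    Finset.prod_const, Finset.card_univ, Fintype.card_fin, Finset.prod_pow_eq_pow_sum]
  push_cast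
  rfl

theorem memLp_hermiteSpace (q : Fin d → ℕ) :
    MemLp (fun x : Space d => (hermiteSpace q x : ℂ)) 2 volume := by
  refine (memLp_two_iff_integrable_sq_norm
    (continuous_ofReal.comp (continuous_hermiteSpace q)).aestronglyMeasurable).2 ?_
  simpa [pow_two] using integrable_hermiteSpace_mul q q

/-- A finite set of multi-indices lies in a cube, and over a cube the sum of products is a power of
a one-dimensional sum. -/
theorem summable_pi_prod {g : ℕ → ℝ} (hg : Summable g) (h0 : ∀ n, 0 ≤ g n) :
    Summable fun q : Fin d → ℕ => ∏ i, g (q i) := by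
  refine summable_of_sum_le (c := (∑' n, g n) ^ d)
    (fun q => Finset.prod_nonneg fun i _ => h0 _) fun s => ?_
  obtain ⟨N, hN⟩ : ∃ N, ∀ q ∈ s, ∀ i, q i < N := by
    refine ⟨∑ q ∈ s, ∑ i, (q i + 1), fun q hq i => ?_⟩
    have h1 : q i + 1 ≤ ∑ i, (q i + 1) :=
      Finset.single_le_sum (f := fun i => q i + 1) (fun _ _ => Nat.zero_le _) (Finset.mem_univ i)
    have h2 : ∑ i, (q i + 1) ≤ ∑ q ∈ s, ∑ i, (q i + 1) :=
      Finset.single_le_sum (f := fun q : Fin d → ℕ => ∑ i, (q i + 1))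
        (fun _ _ => Nat.zero_le _) hq
    omega
  calc ∑ q ∈ s, ∏ i, g (q i)
      ≤ ∑ q ∈ Fintype.piFinset fun _ : Fin d => Finset.range N, ∏ i, g (q i) :=
        Finset.sum_le_sum_of_subset_of_nonneg
          (fun q hq => by simpa using hN q hq)
          (fun _ _ _ => Finset.prod_nonneg fun i _ => h0 _)
    _ = ∏ _i : Fin d, ∑ n ∈ Finset.range N, g n := (Finset.prod_univ_sum _ _).symm
    _ = (∑ n ∈ Finset.range N, g n) ^ d := by simp
    _ ≤ _ := by
        gcongr
        · exact Finset.sum_nonneg fun _ _ => h0 _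
        · exact hg.sum_le_tsum _ fun _ _ => h0 _

/-- The sixth power of `hermiteRate` is (q+1)^{3/2}, whose inverses are summable. -/
theorem summable_rateProd_inv : Summable fun q : Fin d → ℕ => (rateProd q ^ 6)⁻¹ := by
  have h1 : Summable fun n : ℕ => (hermiteRate n ^ 6)⁻¹ := by
    have h := (Real.summable_one_div_nat_add_rpow 1 (3 / 2)).2 (by norm_num)
    refine h.congr fun n => ?_
    have h0 : (0 : ℝ) < (n : ℝ) + 1 := by positivity
    rw [abs_of_pos h0, hermiteRate, ← Real.rpow_natCast, ← Real.rpow_mul h0.le]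
    norm_num
  refine (summable_pi_prod (d := d) h1 fun n => by
    have := hermiteRate_pos n
    positivity).congr fun q => ?_
  simp [rateProd, Finset.prod_pow]

/-! ### Hermite series of one-body kernels -/

/-- `v` is the sum of an absolutely convergent Hermite series with coefficients `c`. -/
structure IsHermiteSeries (v : Space d → Space d → ℂ)
    (c : (Fin d → ℕ) × (Fin d → ℕ) → ℂ) : Prop where
  summable : Summable fun q => ‖c q‖ * (rateProd q.1 ^ 3 * rateProd q.2 ^ 3)
  hasSum : ∀ x y, HasSum (fun q => c q * (hermiteSpace q.1 x * hermiteSpace q.2 y : ℝ)) (v x y)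

/-- The one-body kernel between the reservoirs `r` and `r'`. -/
def block (w : Kernel d 1) (r r' : Reservoir) (x y : Space d) : ℂ :=
  w (fun _ => (x, r)) (fun _ => (y, r'))

/-- Cauchy–Schwarz turns the weighted ℓ² hypothesis into weighted ℓ¹ summability. With A = `rateProd
q.1` and B = `rateProd q.2` the given weight is A¹²B¹²; after paying A⁻⁶B⁻⁶ for summability, A³B³
remains, and this is the weight on which all later estimates run. -/
theorem exists_isHermiteSeries {w : Kernel d 1} (hw : WeightedSobolev w) (r r' : Reservoir) :
    ∃ c, IsHermiteSeries (block w r r') c := by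
  obtain ⟨c, hc, hs⟩ := hw (fun _ => r) (fun _ => r')
  let e : (Fin d → ℕ) × (Fin d → ℕ) ≃ (Fin 1 → Fin d → ℕ) × (Fin 1 → Fin d → ℕ) :=
    (Equiv.prodCongr (Equiv.funUnique (Fin 1) _) (Equiv.funUnique (Fin 1) _)).symm
  refine ⟨fun q => c (e q), ?_, fun x y => ?_⟩
  · have h1 := (e.summable_iff.2 hc)
    have h2 : Summable fun q : (Fin d → ℕ) × (Fin d → ℕ) =>
        (rateProd q.1 ^ 6)⁻¹ * (rateProd q.2 ^ 6)⁻¹ :=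
      summable_rateProd_inv.mul_of_nonneg summable_rateProd_inv
        (fun q => by have := rateProd_pos q; positivity)
        (fun q => by have := rateProd_pos q; positivity)
    refine (h1.add h2).of_nonneg_of_le (fun q => ?_) fun q => ?_
    · have := rateProd_pos q.1
      have := rateProd_pos q.2
      positivity
    · have e1 : (∏ j, ∏ i, (((e q).1 j i : ℝ) + 1) ^ 3 * (((e q).2 j i : ℝ) + 1) ^ 3) =
          rateProd q.1 ^ 12 * rateProd q.2 ^ 12 := by
        simp only [rateProd, ← Finset.prod_pow, ← Finset.prod_mul_distrib]
        rw [Fin.prod_univ_one]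
        refine Finset.prod_congr rfl fun i _ => ?_
        rw [show hermiteRate (q.1 i) ^ 12 = (hermiteRate (q.1 i) ^ 4) ^ 3 by ring,
          show hermiteRate (q.2 i) ^ 12 = (hermiteRate (q.2 i) ^ 4) ^ 3 by ring,
          hermiteRate_pow_four, hermiteRate_pow_four]
        rfl
      simp only [Function.comp, e1]
      set A := rateProd q.1
      set B := rateProd q.2
      have hA : 0 < A := rateProd_pos _
      have hB : 0 < B := rateProd_pos _
      set y := ‖c (e q)‖
      -- Completing the square: 2 y A³B³ ≤ A¹²B¹² y² + A⁻⁶B⁻⁶.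
      have : A ^ 12 * B ^ 12 * y ^ 2 + (A ^ 6)⁻¹ * (B ^ 6)⁻¹ - 2 * (y * (A ^ 3 * B ^ 3)) =
          (A ^ 6 * B ^ 6 * y - (A ^ 3 * B ^ 3)⁻¹) ^ 2 := by
        field_simp
        ring
      have h3 : 0 ≤ y * (A ^ 3 * B ^ 3) := by positivity
      nlinarith [sq_nonneg (A ^ 6 * B ^ 6 * y - (A ^ 3 * B ^ 3)⁻¹)]
  · have h1 := e.hasSum_iff.2 (hs (fun _ => x) (fun _ => y))
    convert! h1 using 2 with q
    simp [hermiteMulti, e]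

namespace IsHermiteSeries

variable {v : Space d → Space d → ℂ} {c : (Fin d → ℕ) × (Fin d → ℕ) → ℂ}

theorem summable_of_le (h : IsHermiteSeries v c) {b : (Fin d → ℕ) × (Fin d → ℕ) → ℝ} {C : ℝ}
    (h0 : ∀ q, 0 ≤ b q)
    (hb : ∀ q, b q ≤ C * (‖c q‖ * (rateProd q.1 ^ 3 * rateProd q.2 ^ 3))) : Summable b :=
  (h.summable.mul_left C).of_nonneg_of_le h0 hb

theorem integrable_term (q : (Fin d → ℕ) × (Fin d → ℕ)) :
    Integrable (fun p : Space d × Space d => hermiteSpace q.1 p.1 * hermiteSpace q.2 p.2)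
      (volume.prod volume) :=
  (integrable_hermiteSpace q.1).mul_prod (integrable_hermiteSpace q.2)

/-- Termwise integration against a bounded function is legitimate since the `L¹` norms of the
Hermite functions grow only like `rateProd`, well within the cubic weights. -/
theorem hasSum_integral_mul (h : IsHermiteSeries v c) {f : Space d × Space d → ℂ} {M : ℝ}
    (hf : AEStronglyMeasurable f (volume.prod volume)) (hM : ∀ p, ‖f p‖ ≤ M) :
    HasSum (fun q => c q * ∫ p : Space d × Space d,
      f p * (hermiteSpace q.1 p.1 * hermiteSpace q.2 p.2 : ℝ))
      (∫ p : Space d × Space d, f p * v p.1 p.2) := by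
  have hM0 : 0 ≤ M := (norm_nonneg _).trans (hM 0)
  have h1 : ∀ q : (Fin d → ℕ) × (Fin d → ℕ), Integrable (fun p : Space d × Space d =>
      c q * (f p * (hermiteSpace q.1 p.1 * hermiteSpace q.2 p.2 : ℝ))) (volume.prod volume) :=
    fun q => ((integrable_term q).ofReal.bdd_mul hf (ae_of_all _ hM)).const_mul _
  have h2 := hasSum_integral_of_summable_integral_norm h1 (h.summable_of_le
    (C := M * (3 ^ d * 3 ^ d))
    (fun q => integral_nonneg fun p => norm_nonneg _) fun q => ?_)
  · simp only [integral_const_mul] at h2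
    convert! h2 using 1
    refine integral_congr_ae (ae_of_all _ fun p => ?_)
    simp only
    rw [← (h.hasSum p.1 p.2).tsum_eq, ← tsum_mul_left]
    exact tsum_congr fun q => by ring
  · have hp : ∫ p : Space d × Space d, |hermiteSpace q.1 p.1| * |hermiteSpace q.2 p.2|
        ∂(volume.prod volume) = (∫ x, |hermiteSpace q.1 x|) * ∫ x, |hermiteSpace q.2 x| :=
      integral_prod_mul (fun x => |hermiteSpace q.1 x|) (fun x => |hermiteSpace q.2 x|)
    calc ∫ p : Space d × Space d, ‖c q * (f p * (hermiteSpace q.1 p.1 * hermiteSpace q.2 p.2 : ℝ))‖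
          ∂(volume.prod volume)
        ≤ ∫ p : Space d × Space d, ‖c q‖ * M * (|hermiteSpace q.1 p.1| * |hermiteSpace q.2 p.2|)
          ∂(volume.prod volume) := by
          refine integral_mono (h1 q).norm ?_ fun p => ?_
          · refine Integrable.const_mul ?_ _
            simpa [abs_mul] using (integrable_term q).abs
          · simp only [norm_mul, norm_real, Real.norm_eq_abs, mul_assoc]
            gcongr
            exact hM p
      _ = ‖c q‖ * M * ((∫ x, |hermiteSpace q.1 x|) * ∫ x, |hermiteSpace q.2 x|) := by
          rw [integral_const_mul, hp]
      _ ≤ ‖c q‖ * M * ((3 ^ d * rateProd q.1 ^ 3) * (3 ^ d * rateProd q.2 ^ 3)) := by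
          have e1 := (integral_abs_hermiteSpace_le q.1).trans (mul_le_mul_of_nonneg_left
            (le_self_pow₀ (one_le_rateProd q.1) three_ne_zero) (by positivity))
          have e2 := (integral_abs_hermiteSpace_le q.2).trans (mul_le_mul_of_nonneg_left
            (le_self_pow₀ (one_le_rateProd q.2) three_ne_zero) (by positivity))
          have := rateProd_pos q.1
          gcongr
      _ = _ := by ring

/-- The coefficients of a Hermite series are Hermite coefficients. -/
theorem coeff_eq (h : IsHermiteSeries v c) (p : (Fin d → ℕ) × (Fin d → ℕ)) :
    ∫ z : Space d × Space d, v z.1 z.2 * (hermiteSpace p.1 z.1 * hermiteSpace p.2 z.2 : ℝ) =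
      c p := by
  have hs := h.hasSum_integral_mul
    (f := fun z => ((hermiteSpace p.1 z.1 * hermiteSpace p.2 z.2 : ℝ) : ℂ))
    (M := (2 ^ d * rateProd p.1) * (2 ^ d * rateProd p.2)) ?_ fun z => ?_
  · have e : ∀ q : (Fin d → ℕ) × (Fin d → ℕ), ∫ z : Space d × Space d,
        ((hermiteSpace p.1 z.1 * hermiteSpace p.2 z.2 : ℝ) : ℂ) *
          (hermiteSpace q.1 z.1 * hermiteSpace q.2 z.2 : ℝ) = if p = q then 1 else 0 := fun q => by
      have e1 : ∀ z : Space d × Space d, ((hermiteSpace p.1 z.1 * hermiteSpace p.2 z.2 : ℝ) : ℂ) *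
          (hermiteSpace q.1 z.1 * hermiteSpace q.2 z.2 : ℝ) =
          (((hermiteSpace p.1 z.1 * hermiteSpace q.1 z.1) *
            (hermiteSpace p.2 z.2 * hermiteSpace q.2 z.2) : ℝ) : ℂ) := fun z => by
        push_cast; ring
      simp_rw [e1]
      rw [integral_complex_ofReal, Measure.volume_eq_prod,
        integral_prod_mul (fun x => hermiteSpace p.1 x * hermiteSpace q.1 x)
          (fun x => hermiteSpace p.2 x * hermiteSpace q.2 x), integral_hermiteSpace_mul,
        integral_hermiteSpace_mul]
      by_cases hq : p = q
      · simp [hq]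
      · by_cases h1 : p.1 = q.1
        · have : p.2 ≠ q.2 := fun h2 => hq (Prod.ext h1 h2)
          simp [hq, this]
        · simp [hq, h1]
    simp_rw [e] at hs
    have h1 := hs.unique (hasSum_single p fun q hq => by simp [Ne.symm hq])
    simp only [if_true, mul_one] at h1
    rw [← h1]
    exact integral_congr_ae (ae_of_all _ fun z => mul_comm _ _)
  · have h1 := continuous_hermiteSpace p.1
    have h2 := continuous_hermiteSpace p.2
    exact Continuous.aestronglyMeasurable (by fun_prop)
  · rw [norm_real, Real.norm_eq_abs, abs_mul]
    exact mul_le_mul (abs_hermiteSpace_le _ _) (abs_hermiteSpace_le _ _) (abs_nonneg _)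
      (mul_nonneg (by positivity) (rateProd_pos _).le)

end IsHermiteSeries

/-- Identifies the coefficients granted by `WeightedSobolev` with the integrals that occur in
`interaction`, so that the decay of the former applies to the operator series. -/
theorem hermiteCoeff_eq {w : Kernel d 1} {r r' : Reservoir}
    {c : (Fin d → ℕ) × (Fin d → ℕ) → ℂ} (h : IsHermiteSeries (block w r r') c)
    (q q' : Fin d → ℕ) :
    hermiteCoeff w (fun _ => (q, r)) (fun _ => (q', r')) = c (q, q') := by
  rw [← h.coeff_eq (q, q'), hermiteCoeff]
  have hm := (volume_preserving_funUnique (Fin 1) (Space d)).prod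
    (volume_preserving_funUnique (Fin 1) (Space d))
  have := hm.integral_comp (MeasurableEquiv.measurableEmbedding
      (MeasurableEquiv.prodCongr (MeasurableEquiv.funUnique (Fin 1) (Space d))
        (MeasurableEquiv.funUnique (Fin 1) (Space d))))
    (fun z : Space d × Space d => block w r r' z.1 z.2 *
      (hermiteSpace q z.1 * hermiteSpace q' z.2 : ℝ))
  refine Eq.trans (integral_congr_ae (ae_of_all _ fun p => ?_)) this
  have h1 : ∀ x : Fin 1 → Space d, x = fun _ => x 0 := fun x => by
    ext1 j; rw [Subsingleton.elim j 0]
  rw [show p = (p.1, p.2) from rfl, h1 p.1, h1 p.2]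
  simp [hermiteMulti, block]

/-- The Fourier transform only multiplies Hermite coefficients by phases. Its Hermite series thus
satisfies the same summability as that of the kernel. -/
theorem hasSum_kernelFourier {w : Kernel d 1} {r r' : Reservoir}
    {c : (Fin d → ℕ) × (Fin d → ℕ) → ℂ} (h : IsHermiteSeries (block w r r') c) (k l : Space d) :
    HasSum (fun q => c q * (-I) ^ (totalDegree q.1 + totalDegree q.2) *
      (hermiteSpace q.1 k * hermiteSpace q.2 l : ℝ)) (kernelFourier w r r' k l) := by
  have hs := h.hasSum_integral_mul (f := fun p =>
      cexp (-(I * ((inner ℝ k p.1 + inner ℝ l p.2 : ℝ) : ℂ)))) (M := 1)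
    (Continuous.aestronglyMeasurable (by fun_prop)) fun p => by
      rw [Complex.norm_exp]
      simp
  have h2 := hs.const_smul ((((2 * Real.pi) ^ d : ℝ))⁻¹)
  have e : (fun q : (Fin d → ℕ) × (Fin d → ℕ) =>
      c q * (-I) ^ (totalDegree q.1 + totalDegree q.2) *
      (hermiteSpace q.1 k * hermiteSpace q.2 l : ℝ)) = fun q => (((2 * Real.pi) ^ d : ℝ))⁻¹ •
      (c q * ∫ p : Space d × Space d, cexp (-(I * ((inner ℝ k p.1 + inner ℝ l p.2 : ℝ) : ℂ))) *
        (hermiteSpace q.1 p.1 * hermiteSpace q.2 p.2 : ℝ)) := by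
    ext1 q
    have e1 : ∀ p : Space d × Space d, cexp (-(I * ((inner ℝ k p.1 + inner ℝ l p.2 : ℝ) : ℂ))) *
        (hermiteSpace q.1 p.1 * hermiteSpace q.2 p.2 : ℝ) =
        (cexp (-(I * (inner ℝ k p.1 : ℝ))) * hermiteSpace q.1 p.1) *
        (cexp (-(I * (inner ℝ l p.2 : ℝ))) * hermiteSpace q.2 p.2) := fun p => by
      push_cast
      rw [show -(I * ((inner ℝ k p.1 : ℝ) + (inner ℝ l p.2 : ℝ) : ℂ)) =
        -(I * (inner ℝ k p.1 : ℝ)) + -(I * (inner ℝ l p.2 : ℝ)) by ring, Complex.exp_add]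
      ring
    simp_rw [e1]
    rw [Measure.volume_eq_prod, integral_prod_mul
      (fun x : Space d => cexp (-(I * (inner ℝ k x : ℝ))) * hermiteSpace q.1 x)
      (fun x : Space d => cexp (-(I * (inner ℝ l x : ℝ))) * hermiteSpace q.2 x),
      fourier_hermiteSpace, fourier_hermiteSpace]
    have h3 : (Real.sqrt (2 * Real.pi) : ℂ) ^ d * (Real.sqrt (2 * Real.pi) : ℂ) ^ d =
        (2 * Real.pi : ℂ) ^ d := by
      rw [← mul_pow, ← ofReal_mul, Real.mul_self_sqrt (by positivity)]
      push_cast; rfl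
    have h4 : (2 * Real.pi : ℂ) ^ d ≠ 0 := by
      have := Real.pi_ne_zero
      simp [this]
    rw [Complex.real_smul]
    push_cast
    rw [pow_add, eq_inv_mul_iff_mul_eq₀ h4]
    linear_combination (c q * (-I) ^ totalDegree q.1 * (-I) ^ totalDegree q.2 *
      hermiteSpace q.1 k * hermiteSpace q.2 l) * -h3
  rw [e]
  exact h2

end Junction
end


noncomputable section

namespace Junction

variable {d : ℕ}

/-! ### Hermite functions as one-particle states -/

/-- On `L¹ ∩ L²`, the Fourier transform of `L²` is the Fourier integral. -/
theorem fourier_toL2 {f : Space d → ℂ} (hf : Integrable f) (hf2 : MemLp f 2 volume)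
    (h2 : MemLp (𝓕 f) 2 volume) : (𝓕 (toL2 f) : OneParticle d) = toL2 (𝓕 f) := by
  -- Both sides are tested against Schwartz functions, which are dense: the left one by Plancherel,
  -- the right one by Fubini for the Fourier integral.
  refine (SchwartzMap.denseRange_toLpCLM (p := 2) (E := Space d) (F := ℂ)
    ENNReal.ofNat_ne_top).eq_of_inner_left (𝕜 := ℂ) fun G => ?_
  have h1 : ⟪(𝓕 (toL2 f) : OneParticle d), G.toLp 2⟫ =
      ⟪toL2 f, ((𝓕⁻ G : SchwartzMap (Space d) ℂ)).toLp 2⟫ := by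
    rw [← Lp.inner_fourier_eq (toL2 f), SchwartzMap.toLp_fourier_eq,
      FourierTransform.fourier_fourierInv_eq]
  have h3 : ∫ ξ, ⟪𝓕 f ξ, G ξ⟫ = ∫ x, ⟪f x, (𝓕⁻ G : SchwartzMap (Space d) ℂ) x⟫ := by
    have h := VectorFourier.integral_sesq_fourierIntegral_eq_neg_flip (innerSL ℂ (E := ℂ))
      (L := innerₗ (Space d)) (μ := volume) (ν := volume) Real.continuous_fourierChar
      continuous_inner hf G.integrable
    simpa [SchwartzMap.fourierInv_coe] using! h
  refine h1.trans ?_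
  rw [L2.inner_def]
  refine Eq.trans ?_ (h3.symm.trans ?_)
  · refine integral_congr_ae ?_
    filter_upwards [coeFn_toL2 hf2, SchwartzMap.coeFn_toLp (𝓕⁻ G : SchwartzMap (Space d) ℂ) 2]
      with x e1 e2
    rw [e1, e2]
  · refine Eq.symm ((L2.inner_def (𝕜 := ℂ) _ _).trans ?_)
    refine integral_congr_ae ?_
    filter_upwards [coeFn_toL2 h2, SchwartzMap.coeFn_toLp G 2] with x e1 e2
    rw [e1]
    exact congrArg _ e2

/-- The one-particle state with wave function a product of Hermite functions. -/
def hermiteState (q : Fin d → ℕ) : OneParticle d := toL2 fun x => (hermiteSpace q x : ℂ)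

theorem norm_hermiteState (q : Fin d → ℕ) : ‖hermiteState q‖ = 1 := by
  have h : ⟪hermiteState q, hermiteState q⟫ = 1 := by
    rw [L2.inner_def]
    have h1 := integral_hermiteSpace_mul q q
    rw [if_pos rfl] at h1
    rw [← Complex.ofReal_one, ← h1, ← integral_complex_ofReal]
    refine integral_congr_ae ?_
    filter_upwards [coeFn_toL2 (memLp_hermiteSpace q)] with x e
    rw [hermiteState, e, RCLike.inner_apply, conj_ofReal, ofReal_mul]
  rw [inner_self_eq_norm_sq_to_K] at h
  have h2 : ‖hermiteState q‖ ^ 2 = 1 := by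
    apply Complex.ofReal_injective
    push_cast
    exact h
  exact (pow_eq_one_iff_of_nonneg (norm_nonneg _) two_ne_zero).1 h2

theorem fourier_hermiteSpace_eq (q : Fin d → ℕ) :
    (𝓕 fun x : Space d => (hermiteSpace q x : ℂ)) = fun ξ : Space d =>
      (Real.sqrt (2 * Real.pi) : ℂ) ^ d * (-I) ^ totalDegree q *
        hermiteSpace q ((2 * Real.pi) • ξ) := by
  ext ξ
  rw [Real.fourier_eq', ← fourier_hermiteSpace]
  refine integral_congr_ae (ae_of_all _ fun x => ?_)
  simp only [smul_eq_mul, inner_smul_left, conj_trivial, real_inner_comm ξ x]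
  congr 2
  push_cast
  ring

theorem fourier_hermiteState (q : Fin d → ℕ) :
    (𝓕 (hermiteState q) : OneParticle d) =ᵐ[volume] fun ξ : Space d =>
      (Real.sqrt (2 * Real.pi) : ℂ) ^ d * (-I) ^ totalDegree q *
        hermiteSpace q ((2 * Real.pi) • ξ) := by
  have h2 : MemLp (𝓕 fun x : Space d => (hermiteSpace q x : ℂ)) 2 volume := by
    rw [fourier_hermiteSpace_eq]
    refine MemLp.const_mul ?_ _
    have hc : Continuous fun ξ : Space d => (hermiteSpace q ((2 * Real.pi) • ξ) : ℂ) :=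
      continuous_ofReal.comp ((continuous_hermiteSpace q).comp (by fun_prop))
    refine (memLp_two_iff_integrable_sq_norm hc.aestronglyMeasurable).2 ?_
    have := (integrable_hermiteSpace_mul q q).comp_smul
      (R := 2 * Real.pi) (by have := Real.pi_ne_zero; positivity)
    simpa [pow_two] using this
  have h1 : Integrable fun x : Space d => (hermiteSpace q x : ℂ) :=
    (integrable_hermiteSpace q).ofReal
  have h3 := fourier_toL2 h1 (memLp_hermiteSpace q) h2
  rw [hermiteState, h3, ← fourier_hermiteSpace_eq]
  exact coeFn_toL2 h2

/-- The matrix element of the function `n` of the energy between Hermite functions. -/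
def moment (n : ℝ → ℂ) (a b : Fin d → ℕ) : ℂ :=
  ∫ k : Space d, n (‖k‖ ^ 2) * (hermiteSpace a k * hermiteSpace b k : ℝ)

theorem hermiteFun_neg (q : ℕ) (x : ℝ) : hermiteFun q (-x) = (-1) ^ q * hermiteFun q x := by
  induction q using Nat.strong_induction_on with
  | _ q ih =>
    match q with
    | 0 => simp [hermiteFun_zero]
    | 1 =>
      have h1 := mul_hermiteFun 0 x
      have h2 := mul_hermiteFun 0 (-x)
      rw [ih 0 (by omega)] at h2
      simp only [ladder_zero, zero_mul, add_zero, zero_add, pow_zero, one_mul] at h1 h2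
      refine mul_left_cancel₀ (ladder_succ_pos 0).ne' ?_
      rw [zero_add]
      linear_combination -h2 - h1
    | q + 2 =>
      have h1 := mul_hermiteFun (q + 1) x
      have h2 := mul_hermiteFun (q + 1) (-x)
      rw [ih (q + 1) (by omega), Nat.add_sub_cancel, ih q (by omega)] at h2
      rw [Nat.add_sub_cancel] at h1
      refine mul_left_cancel₀ (ladder_succ_pos (q + 1)).ne' ?_
      linear_combination -h2 - (-1) ^ (q + 1) * h1

theorem hermiteSpace_neg (q : Fin d → ℕ) (x : Space d) :
    hermiteSpace q (-x) = (-1) ^ totalDegree q * hermiteSpace q x := by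
  simp [hermiteSpace, hermiteFun_neg, Finset.prod_mul_distrib, totalDegree,
    Finset.prod_pow_eq_pow_sum]

/-- Reflecting k shows that the moment vanishes unless the two total degrees have equal parity. -/
theorem moment_neg (n : ℝ → ℂ) (a b : Fin d → ℕ) :
    moment n a b = (-1) ^ (totalDegree a + totalDegree b) * moment n a b := by
  conv_lhs => rw [moment, ← integral_neg_eq_self]
  rw [moment, ← integral_const_mul]
  refine integral_congr_ae (ae_of_all _ fun k => ?_)
  simp only [norm_neg, hermiteSpace_neg]
  push_cast
  rw [pow_add]
  ring

/-- The phases of the Fourier transforms of two Hermite functions. -/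
def phase (a b : Fin d → ℕ) : ℂ := (-I) ^ totalDegree a * I ^ totalDegree b

/-- By the parity rule the phase may be replaced by its conjugate wherever the moment is nonzero.
The form chosen in `phase` splits into the phases that appear in the Hermite coefficients of
`transmission`. -/
theorem phase_mul_moment (n : ℝ → ℂ) (a b : Fin d → ℕ) :
    I ^ totalDegree a * (-I) ^ totalDegree b * moment n a b = phase a b * moment n a b := by
  have h : ∀ m : ℕ, (-1 : ℂ) ^ m * (-1) ^ m = 1 := fun m => by
    rw [← mul_pow]; simp
  rw [phase, neg_pow I (totalDegree b), neg_pow I (totalDegree a)]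
  conv_rhs => rw [moment_neg, pow_add]
  linear_combination (I ^ totalDegree a * I ^ totalDegree b * (-1) ^ totalDegree b *
    moment n a b) * -h (totalDegree a)

theorem waveEnergy_eq (ξ : Space d) : waveEnergy ξ = ‖(2 * Real.pi) • ξ‖ ^ 2 := by
  rw [waveEnergy, norm_smul, Real.norm_of_nonneg (by positivity)]

/-- The dilation k = 2πξ passes to the momentum convention of the theorem; its Jacobian absorbs the
factor (2π)^d from the two Fourier transforms. -/
theorem integral_waveEnergy_mul (n : ℝ → ℂ) (a b : Fin d → ℕ) :
    ∫ ξ, n (waveEnergy ξ) * (starRingEnd ℂ ((𝓕 (hermiteState a) : OneParticle d) ξ) *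
      (𝓕 (hermiteState b) : OneParticle d) ξ) = phase a b * moment n a b := by
  rw [← phase_mul_moment]
  have h1 : ∫ ξ, n (waveEnergy ξ) * (starRingEnd ℂ ((𝓕 (hermiteState a) : OneParticle d) ξ) *
      (𝓕 (hermiteState b) : OneParticle d) ξ) =
      ∫ ξ : Space d, (2 * Real.pi : ℂ) ^ d * (I ^ totalDegree a * (-I) ^ totalDegree b) *
        (n (‖(2 * Real.pi) • ξ‖ ^ 2) *
          (hermiteSpace a ((2 * Real.pi) • ξ) * hermiteSpace b ((2 * Real.pi) • ξ) : ℝ)) := by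
    refine integral_congr_ae ?_
    filter_upwards [fourier_hermiteState a, fourier_hermiteState b] with ξ e1 e2
    rw [e1, e2, waveEnergy_eq]
    have h3 : (Real.sqrt (2 * Real.pi) : ℂ) ^ d * (Real.sqrt (2 * Real.pi) : ℂ) ^ d =
        (2 * Real.pi : ℂ) ^ d := by
      rw [← mul_pow, ← ofReal_mul, Real.mul_self_sqrt (by positivity)]
      push_cast; rfl
    simp only [map_mul, map_pow, map_neg, conj_I, conj_ofReal, neg_neg]
    push_cast
    linear_combination (I ^ totalDegree a * (-I) ^ totalDegree b *
      n (‖(2 * Real.pi) • ξ‖ ^ 2) * hermiteSpace a ((2 * Real.pi) • ξ) *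
      hermiteSpace b ((2 * Real.pi) • ξ)) * h3
  rw [h1, integral_const_mul, Measure.integral_comp_smul volume
    (fun k : Space d => n (‖k‖ ^ 2) * (hermiteSpace a k * hermiteSpace b k : ℝ)) (2 * Real.pi),
    ← moment, finrank_euclideanSpace_fin, abs_of_pos (by positivity), Complex.real_smul]
  have h4 : (2 * Real.pi : ℂ) ^ d ≠ 0 := by
    have := Real.pi_ne_zero
    simp [this]
  push_cast
  field_simp

/-- The multiplier `e^{-isω}` of the free time evolution. -/
def evolution (s ω : ℝ) : ℂ := cexp (-(I * s * ω))

theorem measurable_evolution (s : ℝ) : Measurable (evolution s) := by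
  unfold evolution; fun_prop

theorem norm_evolution (s ω : ℝ) : ‖evolution s ω‖ = 1 := by
  rw [evolution, Complex.norm_exp]
  simp

theorem conj_evolution (s ω : ℝ) : starRingEnd ℂ (evolution s ω) = evolution (-s) ω := by
  rw [evolution, evolution, ← Complex.exp_conj]
  simp

/-- The free evolution of one-particle states. -/
def evolve (s : ℝ) (f : OneParticle d) : OneParticle d := energyFunction (evolution s) f

theorem fourier_evolve (s : ℝ) (f : OneParticle d) :
    (𝓕 (evolve s f) : OneParticle d) =ᵐ[volume]
      fun ξ => evolution s (waveEnergy ξ) * (𝓕 f : OneParticle d) ξ :=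
  fourier_energyFunction (measurable_evolution s) (fun ω => (norm_evolution s ω).le) f

theorem norm_evolve_le (s : ℝ) (f : OneParticle d) : ‖evolve s f‖ ≤ ‖f‖ := by
  simpa [evolve] using norm_energyFunction_le (measurable_evolution s)
    (fun ω => (norm_evolution s ω).le) f

theorem inner_evolve_left (s : ℝ) (a b : Fin d → ℕ) :
    ⟪evolve s (hermiteState a), hermiteState b⟫ =
      phase a b * moment (evolution (-s)) a b := by
  rw [inner_oneParticle_fourier, ← integral_waveEnergy_mul]
  refine integral_congr_ae ?_
  filter_upwards [fourier_evolve s (hermiteState a)] with ξ e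
  rw [e, map_mul, conj_evolution, mul_assoc]

theorem inner_evolve_right (s : ℝ) (a b : Fin d → ℕ) :
    ⟪hermiteState a, evolve s (hermiteState b)⟫ = phase a b * moment (evolution s) a b := by
  rw [inner_oneParticle_fourier, ← integral_waveEnergy_mul]
  refine integral_congr_ae ?_
  filter_upwards [fourier_evolve s (hermiteState b)] with ξ e
  rw [e]
  ring

theorem densityForm_evolve_left (β μ s : ℝ) (a b : Fin d → ℕ) :
    densityForm β μ (evolve s (hermiteState a)) (hermiteState b) =
      phase a b * moment (fun ω => fermi β μ ω * evolution (-s) ω) a b := by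
  rw [densityForm_eq, ← integral_waveEnergy_mul]
  refine integral_congr_ae ?_
  filter_upwards [fourier_evolve s (hermiteState a)] with ξ e
  rw [e, map_mul, conj_evolution]
  ring

theorem densityForm_evolve_right (β μ s : ℝ) (a b : Fin d → ℕ) :
    densityForm β μ (hermiteState a) (evolve s (hermiteState b)) =
      phase a b * moment (fun ω => fermi β μ ω * evolution s ω) a b := by
  rw [densityForm_eq, ← integral_waveEnergy_mul]
  refine integral_congr_ae ?_
  filter_upwards [fourier_evolve s (hermiteState b)] with ξ e
  rw [e]
  ring

/-- Strong continuity of the free evolution, by dominated convergence on the Fourier side. It makes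
the commutators continuous in time, hence the Dyson integrand integrable. -/
theorem continuous_evolve (f : OneParticle d) : Continuous fun s => evolve s f := by
  refine continuous_iff_continuousAt.2 fun s₀ => ?_
  rw [ContinuousAt, tendsto_iff_norm_sub_tendsto_zero]
  have h1 : ∀ s, ‖evolve s f - evolve s₀ f‖ ^ 2 =
      ∫ ξ, ‖evolution s (waveEnergy ξ) - evolution s₀ (waveEnergy ξ)‖ ^ 2 *
        ‖(𝓕 f : OneParticle d) ξ‖ ^ 2 := fun s => by
    apply Complex.ofReal_injective
    have h := inner_self_eq_norm_sq_to_K (𝕜 := ℂ) (evolve s f - evolve s₀ f)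
    rw [ofReal_pow, ← integral_complex_ofReal]
    refine h.symm.trans ?_
    rw [inner_oneParticle_fourier]
    refine integral_congr_ae ?_
    have e0 : (𝓕 (evolve s f - evolve s₀ f) : OneParticle d) =
        𝓕 (evolve s f) - 𝓕 (evolve s₀ f) :=
      (Lp.fourierTransformₗᵢ (Space d) ℂ).map_sub _ _
    rw [e0]
    filter_upwards [fourier_evolve s f, fourier_evolve s₀ f,
      Lp.coeFn_sub (𝓕 (evolve s f) : OneParticle d) (𝓕 (evolve s₀ f))] with ξ e1 e2 e3
    rw [e3, Pi.sub_apply, e1, e2, ← sub_mul, Complex.conj_mul', norm_mul]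
    push_cast
    ring
  have hI : Integrable fun ξ => ‖(𝓕 f : OneParticle d) ξ‖ ^ 2 :=
    (memLp_two_iff_integrable_sq_norm (Lp.aestronglyMeasurable _)).1 (Lp.memLp _)
  have h2 : Tendsto (fun s => ‖evolve s f - evolve s₀ f‖ ^ 2) (𝓝 s₀) (𝓝 0) := by
    simp_rw [h1]
    rw [show (0 : ℝ) = ∫ ξ, ‖evolution s₀ (waveEnergy ξ) - evolution s₀ (waveEnergy ξ)‖ ^ 2 *
        ‖(𝓕 f : OneParticle d) ξ‖ ^ 2 by simp]
    refine tendsto_integral_filter_of_dominated_convergence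
      (fun ξ => 4 * ‖(𝓕 f : OneParticle d) ξ‖ ^ 2) (Eventually.of_forall fun s => ?_)
      (Eventually.of_forall fun s => ae_of_all _ fun ξ => ?_) (hI.const_mul 4)
      (ae_of_all _ fun ξ => ?_)
    · refine AEStronglyMeasurable.mul ?_ hI.aestronglyMeasurable
      refine Continuous.aestronglyMeasurable ?_
      have := continuous_waveEnergy (d := d)
      unfold evolution
      fun_prop
    · rw [Real.norm_of_nonneg (by positivity)]
      have : ‖evolution s (waveEnergy ξ) - evolution s₀ (waveEnergy ξ)‖ ≤ 2 := by
        refine (norm_sub_le _ _).trans ?_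
        rw [norm_evolution, norm_evolution]
        norm_num
      gcongr
      nlinarith [norm_nonneg (evolution s (waveEnergy ξ) - evolution s₀ (waveEnergy ξ))]
    · refine Continuous.tendsto (f := fun s => ‖evolution s (waveEnergy ξ) -
        evolution s₀ (waveEnergy ξ)‖ ^ 2 * ‖(𝓕 f : OneParticle d) ξ‖ ^ 2) ?_ s₀
      unfold evolution
      fun_prop
  have h3 := h2.sqrt
  simpa [Real.sqrt_sq (norm_nonneg _)] using h3

end Junction
end


noncomputable section

namespace Junction

variable {d : ℕ}

/-! ### Matrix elements of functions of the energy -/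

/-- Cauchy–Schwarz for normalized Hermite functions; the bound does not depend on the indices. -/
theorem norm_moment_le {n : ℝ → ℂ} {M : ℝ} (hM : ∀ ω, ‖n ω‖ ≤ M) (a b : Fin d → ℕ) :
    ‖moment n a b‖ ≤ M := by
  have hM0 : 0 ≤ M := (norm_nonneg _).trans (hM 0)
  have h1 : ∫ k : Space d, M / 2 * (hermiteSpace a k * hermiteSpace a k +
      hermiteSpace b k * hermiteSpace b k) = M := by
    rw [integral_const_mul, integral_add (integrable_hermiteSpace_mul a a)
      (integrable_hermiteSpace_mul b b), integral_hermiteSpace_mul, integral_hermiteSpace_mul]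
    simp
    ring
  rw [← h1]
  refine norm_integral_le_of_norm_le (((integrable_hermiteSpace_mul a a).add
      (integrable_hermiteSpace_mul b b)).const_mul _) (ae_of_all _ fun k => ?_)
  rw [norm_mul, norm_real, Real.norm_eq_abs, abs_mul]
  calc ‖n (‖k‖ ^ 2)‖ * (|hermiteSpace a k| * |hermiteSpace b k|)
      ≤ M * (|hermiteSpace a k| * |hermiteSpace b k|) := by gcongr; exact hM _
    _ ≤ _ := by
      nlinarith [mul_nonneg hM0 (sq_nonneg (|hermiteSpace a k| - |hermiteSpace b k|)),
        sq_abs (hermiteSpace a k), sq_abs (hermiteSpace b k)]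

/-- Each factor is replaced by the Fourier integral of itself. The momentum then enters only through
the plane wave e^{-ik·(x+y)}, so the integral over k can be carried out first and becomes Gaussian.
-/
theorem hermiteSpace_mul_eq (a b : Fin d → ℕ) (k : Space d) :
    ((hermiteSpace a k * hermiteSpace b k : ℝ) : ℂ) =
      I ^ totalDegree a * I ^ totalDegree b * ((2 * Real.pi : ℂ) ^ d)⁻¹ *
      ∫ p : Space d × Space d, cexp (-(I * (inner ℝ k (p.1 + p.2) : ℝ))) *
        (hermiteSpace a p.1 * hermiteSpace b p.2 : ℝ) := by
  have e1 : ∀ p : Space d × Space d, cexp (-(I * (inner ℝ k (p.1 + p.2) : ℝ))) *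
      (hermiteSpace a p.1 * hermiteSpace b p.2 : ℝ) =
      (cexp (-(I * (inner ℝ k p.1 : ℝ))) * hermiteSpace a p.1) *
      (cexp (-(I * (inner ℝ k p.2 : ℝ))) * hermiteSpace b p.2) := fun p => by
    rw [inner_add_right]
    push_cast
    rw [show -(I * ((inner ℝ k p.1 : ℝ) + (inner ℝ k p.2 : ℝ) : ℂ)) =
      -(I * (inner ℝ k p.1 : ℝ)) + -(I * (inner ℝ k p.2 : ℝ)) by ring, Complex.exp_add]
    ring
  simp_rw [e1]
  rw [Measure.volume_eq_prod, integral_prod_mul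
    (fun x : Space d => cexp (-(I * (inner ℝ k x : ℝ))) * hermiteSpace a x)
    (fun x : Space d => cexp (-(I * (inner ℝ k x : ℝ))) * hermiteSpace b x),
    fourier_hermiteSpace, fourier_hermiteSpace]
  have h3 : (Real.sqrt (2 * Real.pi) : ℂ) ^ d * (Real.sqrt (2 * Real.pi) : ℂ) ^ d =
      (2 * Real.pi : ℂ) ^ d := by
    rw [← mul_pow, ← ofReal_mul, Real.mul_self_sqrt (by positivity)]
    push_cast; rfl
  have h4 : (2 * Real.pi : ℂ) ^ d ≠ 0 := by
    have := Real.pi_ne_zero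
    simp [this]
  have h5 : ∀ m : ℕ, I ^ m * (-I) ^ m = 1 := fun m => by rw [← mul_pow]; simp
  have e2 : I ^ totalDegree a * I ^ totalDegree b * ((2 * Real.pi : ℂ) ^ d)⁻¹ *
      ((Real.sqrt (2 * Real.pi) : ℂ) ^ d * (-I) ^ totalDegree a * hermiteSpace a k *
      ((Real.sqrt (2 * Real.pi) : ℂ) ^ d * (-I) ^ totalDegree b * hermiteSpace b k)) =
      (I ^ totalDegree a * (-I) ^ totalDegree a) * (I ^ totalDegree b * (-I) ^ totalDegree b) *
      (((2 * Real.pi : ℂ) ^ d)⁻¹ * ((Real.sqrt (2 * Real.pi) : ℂ) ^ d *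
        (Real.sqrt (2 * Real.pi) : ℂ) ^ d)) * (hermiteSpace a k * hermiteSpace b k) := by ring
  rw [e2, h5, h5, h3, inv_mul_cancel₀ h4]
  push_cast
  ring

/-- After Fubini the inner integral is the Fourier transform of a complex Gaussian, of modulus at
most (π/|b|)^{d/2}, and the Hermite functions contribute their `L¹` norms, whence 9^d = 3^d · 3^d.
The bound involves |b| and not Re b, so it survives the limit to imaginary b. -/
theorem norm_moment_gauss_le {b : ℂ} (hb : 0 < b.re) (p q : Fin d → ℕ) :
    ‖moment (fun ω => cexp (-(b * ω))) p q‖ ≤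
      ((2 * Real.pi) ^ d)⁻¹ * 9 ^ d * (Real.pi / ‖b‖) ^ ((d : ℝ) / 2) *
        (rateProd p * rateProd q) := by
  have hg : Integrable fun k : Space d => cexp (-(b * (‖k‖ ^ 2 : ℝ))) := by
    have := GaussianFourier.integrable_cexp_neg_mul_sq_norm_add hb 0 (0 : Space d)
    simpa using this
  set A : ℂ := I ^ totalDegree p * I ^ totalDegree q * ((2 * Real.pi : ℂ) ^ d)⁻¹ with hA
  have hF : Integrable (fun z : Space d × (Space d × Space d) =>
      cexp (-(I * (inner ℝ z.1 (z.2.1 + z.2.2) : ℝ))) *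
      (cexp (-(b * (‖z.1‖ ^ 2 : ℝ))) * (hermiteSpace p z.2.1 * hermiteSpace q z.2.2 : ℝ)))
      (volume.prod (volume.prod volume)) := by
    refine Integrable.bdd_mul (c := 1) (hg.mul_prod (((integrable_hermiteSpace p).mul_prod
      (integrable_hermiteSpace q)).ofReal (𝕜 := ℂ))) (Continuous.aestronglyMeasurable (by fun_prop))
      (ae_of_all _ fun z => ?_)
    rw [Complex.norm_exp]
    simp
  have h1 : moment (fun ω => cexp (-(b * ω))) p q = A * ∫ z : Space d × Space d,
      (∫ k : Space d, cexp (-(I * (inner ℝ k (z.1 + z.2) : ℝ))) * cexp (-(b * (‖k‖ ^ 2 : ℝ)))) *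
      (hermiteSpace p z.1 * hermiteSpace q z.2 : ℝ) := by
    have e1 : ∀ k : Space d, cexp (-(b * (‖k‖ ^ 2 : ℝ))) * (hermiteSpace p k * hermiteSpace q k : ℝ)
        = A * ∫ z : Space d × Space d, cexp (-(I * (inner ℝ k (z.1 + z.2) : ℝ))) *
      (cexp (-(b * (‖k‖ ^ 2 : ℝ))) * (hermiteSpace p z.1 * hermiteSpace q z.2 : ℝ)) := fun k => by
      rw [hermiteSpace_mul_eq, ← hA, mul_left_comm, ← integral_const_mul]
      congr 2
      ext1 z
      ring
    rw [moment]
    simp_rw [e1]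
    rw [integral_const_mul]
    congr 1
    refine (integral_integral_swap hF).trans ?_
    refine integral_congr_ae (ae_of_all _ fun z => ?_)
    simp only
    rw [← integral_mul_const]
    simp_rw [mul_assoc]
  have h2 : ∀ x : Space d, ‖∫ k : Space d, cexp (-(I * (inner ℝ k x : ℝ))) *
      cexp (-(b * (‖k‖ ^ 2 : ℝ)))‖ ≤ (Real.pi / ‖b‖) ^ ((d : ℝ) / 2) := fun x => by
    have e : ∀ k : Space d, cexp (-(I * (inner ℝ k x : ℝ))) * cexp (-(b * (‖k‖ ^ 2 : ℝ))) =
        cexp (-b * ‖k‖ ^ 2 + -I * (inner ℝ x k : ℝ)) := fun k => by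
      rw [← Complex.exp_add, real_inner_comm k x]
      push_cast
      ring_nf
    simp_rw [e]
    rw [GaussianFourier.integral_cexp_neg_mul_sq_norm_add hb, norm_mul,
      finrank_euclideanSpace_fin, show ((d : ℂ) / 2) = (((d : ℝ) / 2 : ℝ) : ℂ) by push_cast; rfl,
      Complex.norm_cpow_real, norm_div, norm_real, Real.norm_of_nonneg Real.pi_pos.le]
    refine mul_le_of_le_one_right (by positivity) ?_
    rw [Complex.norm_exp, Real.exp_le_one_iff]
    have e3 : ((-I) ^ 2 * (‖x‖ : ℂ) ^ 2 / (4 * b)) = ((-(‖x‖ ^ 2 / 4) : ℝ) : ℂ) * b⁻¹ := by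
      have : b ≠ 0 := fun h => by simp [h] at hb
      rw [neg_sq, I_sq]
      push_cast
      field_simp
    rw [e3, re_ofReal_mul, Complex.inv_re]
    have := Complex.normSq_nonneg b
    have h4 : 0 ≤ b.re / Complex.normSq b := by positivity
    nlinarith [mul_nonneg (sq_nonneg ‖x‖) h4]
  have hnA : ‖A‖ = ((2 * Real.pi) ^ d)⁻¹ := by
    rw [hA]
    simp [abs_of_pos Real.pi_pos]
  set D := (Real.pi / ‖b‖) ^ ((d : ℝ) / 2) with hD
  have hD0 : 0 ≤ D := by positivity
  rw [h1, norm_mul, hnA]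
  have h5 : ‖∫ z : Space d × Space d,
      (∫ k : Space d, cexp (-(I * (inner ℝ k (z.1 + z.2) : ℝ))) * cexp (-(b * (‖k‖ ^ 2 : ℝ)))) *
      (hermiteSpace p z.1 * hermiteSpace q z.2 : ℝ)‖ ≤
      ∫ z : Space d × Space d, D * (|hermiteSpace p z.1| * |hermiteSpace q z.2|) := by
    refine norm_integral_le_of_norm_le (Integrable.const_mul
      ((integrable_hermiteSpace p).abs.mul_prod (integrable_hermiteSpace q).abs) _)
      (ae_of_all _ fun z => ?_)
    rw [norm_mul, norm_real, Real.norm_eq_abs, abs_mul]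
    exact mul_le_mul_of_nonneg_right (h2 _) (by positivity)
  rw [integral_const_mul, Measure.volume_eq_prod, integral_prod_mul
    (fun x : Space d => |hermiteSpace p x|) (fun x : Space d => |hermiteSpace q x|)] at h5
  have e1 := integral_abs_hermiteSpace_le p
  have e2 := integral_abs_hermiteSpace_le q
  have hp := rateProd_pos p
  have h9 : (9 : ℝ) ^ d = 3 ^ d * 3 ^ d := by rw [← mul_pow]; norm_num
  calc _ ≤ ((2 * Real.pi) ^ d)⁻¹ * (D * ((3 ^ d * rateProd p) * (3 ^ d * rateProd q))) := by
        refine mul_le_mul_of_nonneg_left (h5.trans ?_) (by positivity)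
        gcongr
    _ = _ := by rw [h9]; ring

/-- The dispersive estimate. -/
theorem norm_moment_evolution_le {s : ℝ} (hs : s ≠ 0) (p q : Fin d → ℕ) :
    ‖moment (evolution s) p q‖ ≤
      ((2 * Real.pi) ^ d)⁻¹ * 9 ^ d * (Real.pi / |s|) ^ ((d : ℝ) / 2) *
        (rateProd p * rateProd q) := by
  -- The oscillating exponential is the limit ε ↓ 0 of Gaussians with parameter b = ε + is, and |b|
  -- ≥ |s|.
  have h1 : Tendsto (fun ε : ℝ => moment (fun ω => cexp (-((ε + I * s : ℂ) * ω))) p q) (𝓝[>] 0)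
      (𝓝 (moment (evolution s) p q)) := by
    refine tendsto_integral_filter_of_dominated_convergence
      (fun k => |hermiteSpace p k * hermiteSpace q k|)
      (Eventually.of_forall fun ε => ?_) ?_ (integrable_hermiteSpace_mul p q).abs
      (ae_of_all _ fun k => ?_)
    · have h1 := continuous_hermiteSpace p
      have h2 := continuous_hermiteSpace q
      exact Continuous.aestronglyMeasurable (by fun_prop)
    · filter_upwards [self_mem_nhdsWithin] with ε hε
      refine ae_of_all _ fun k => ?_
      rw [norm_mul, norm_real, Real.norm_eq_abs]
      refine mul_le_of_le_one_left (abs_nonneg _) ?_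
      rw [Complex.norm_exp, Real.exp_le_one_iff]
      have hε : 0 < ε := hε
      have : (-((ε + I * s : ℂ) * ((‖k‖ ^ 2 : ℝ) : ℂ))).re = -(ε * ‖k‖ ^ 2) := by
        rw [Complex.neg_re, mul_comm _ ((‖k‖ ^ 2 : ℝ) : ℂ), re_ofReal_mul]
        simp
        ring
      rw [this]
      have : 0 ≤ ε * ‖k‖ ^ 2 := by positivity
      linarith
    · have hc : Continuous fun ε : ℝ => cexp (-((ε + I * s : ℂ) * ((‖k‖ ^ 2 : ℝ) : ℂ))) *
          (hermiteSpace p k * hermiteSpace q k : ℝ) := by fun_prop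
      have := (hc.tendsto 0).mono_left (nhdsWithin_le_nhds (s := Set.Ioi 0))
      simpa [evolution] using this
  refine le_of_tendsto h1.norm ?_
  filter_upwards [self_mem_nhdsWithin] with ε hε
  have hε : 0 < ε := hε
  have hre : (ε + I * s : ℂ).re = ε := by simp
  refine (norm_moment_gauss_le (by rw [hre]; exact hε) p q).trans ?_
  have h2 : |s| ≤ ‖(ε + I * s : ℂ)‖ := by
    have := Complex.abs_im_le_norm (ε + I * s : ℂ)
    simpa using this
  have := rateProd_pos p
  have := rateProd_pos q
  have : 0 < |s| := abs_pos.2 hs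
  have := Real.pi_pos
  gcongr

namespace IsHermiteSeries

variable {v : Space d → Space d → ℂ} {c : (Fin d → ℕ) × (Fin d → ℕ) → ℂ}

theorem hasSum_of_eq {ι E : Type*} [AddCommMonoid E] [TopologicalSpace E]
    {f g : ι → E} {a : E} (hf : HasSum f a) (h : ∀ i, g i = f i) : HasSum g a := by
  rwa [funext h]

theorem abs_mul_le (q : (Fin d → ℕ) × (Fin d → ℕ)) (x y : Space d) :
    |hermiteSpace q.1 x * hermiteSpace q.2 y| ≤
      4 ^ d * (rateProd q.1 ^ 3 * rateProd q.2 ^ 3) := by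
  have e1 := (abs_hermiteSpace_le q.1 x).trans (mul_le_mul_of_nonneg_left
    (le_self_pow₀ (one_le_rateProd q.1) three_ne_zero) (by positivity))
  have e2 := (abs_hermiteSpace_le q.2 y).trans (mul_le_mul_of_nonneg_left
    (le_self_pow₀ (one_le_rateProd q.2) three_ne_zero) (by positivity))
  have h4 : (4 : ℝ) ^ d = 2 ^ d * 2 ^ d := by rw [← mul_pow]; norm_num
  rw [abs_mul, h4]
  have := rateProd_pos q.1
  calc _ ≤ (2 ^ d * rateProd q.1 ^ 3) * (2 ^ d * rateProd q.2 ^ 3) := by gcongr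
    _ = _ := by ring

theorem norm_term_le (q : (Fin d → ℕ) × (Fin d → ℕ)) (x y : Space d) :
    ‖c q * (hermiteSpace q.1 x * hermiteSpace q.2 y : ℝ)‖ ≤
      4 ^ d * (‖c q‖ * (rateProd q.1 ^ 3 * rateProd q.2 ^ 3)) := by
  rw [norm_mul, norm_real, Real.norm_eq_abs, mul_left_comm]
  exact mul_le_mul_of_nonneg_left (abs_mul_le q x y) (norm_nonneg _)

theorem summable_norm (h : IsHermiteSeries v c) : Summable fun q => ‖c q‖ :=
  h.summable_of_le (C := 1) (fun _ => norm_nonneg _) fun q => by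
    rw [one_mul]
    exact le_mul_of_one_le_right (norm_nonneg _)
      (one_le_mul_of_one_le_of_one_le (one_le_pow₀ (one_le_rateProd _))
        (one_le_pow₀ (one_le_rateProd _)))

theorem continuous (h : IsHermiteSeries v c) :
    Continuous fun p : Space d × Space d => v p.1 p.2 := by
  have e : (fun p : Space d × Space d => v p.1 p.2) = fun p => ∑' q : (Fin d → ℕ) × (Fin d → ℕ),
      c q * (hermiteSpace q.1 p.1 * hermiteSpace q.2 p.2 : ℝ) :=
    funext fun p => (h.hasSum p.1 p.2).tsum_eq.symm
  rw [e]
  refine continuous_tsum (fun q => ?_) (h.summable.mul_left (4 ^ d))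
    fun q p => norm_term_le q p.1 p.2
  have h1 := continuous_hermiteSpace q.1
  have h2 := continuous_hermiteSpace q.2
  fun_prop

theorem exists_norm_le (h : IsHermiteSeries v c) : ∃ M, 0 ≤ M ∧ ∀ x y, ‖v x y‖ ≤ M := by
  refine ⟨∑' q : (Fin d → ℕ) × (Fin d → ℕ), 4 ^ d * (‖c q‖ * (rateProd q.1 ^ 3 * rateProd q.2 ^ 3)),
    tsum_nonneg fun q => ?_, fun x y => ?_⟩
  · have := rateProd_pos q.1
    have := rateProd_pos q.2
    positivity
  · rw [← (h.hasSum x y).tsum_eq]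
    exact tsum_of_norm_bounded (h.summable.mul_left (4 ^ d)).hasSum
      fun q => norm_term_le q x y

theorem integral_abs_term_le (q : (Fin d → ℕ) × (Fin d → ℕ)) :
    ∫ p : Space d × Space d, ‖((hermiteSpace q.1 p.1 * hermiteSpace q.2 p.2 : ℝ) : ℂ)‖
      ∂(volume.prod volume) ≤ 9 ^ d * (rateProd q.1 ^ 3 * rateProd q.2 ^ 3) := by
  have hp : ∫ p : Space d × Space d, |hermiteSpace q.1 p.1| * |hermiteSpace q.2 p.2|
      ∂(volume.prod volume) = (∫ x, |hermiteSpace q.1 x|) * ∫ x, |hermiteSpace q.2 x| :=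
    integral_prod_mul (fun x => |hermiteSpace q.1 x|) (fun x => |hermiteSpace q.2 x|)
  simp only [norm_real, Real.norm_eq_abs, abs_mul]
  rw [hp]
  have e1 := (integral_abs_hermiteSpace_le q.1).trans (mul_le_mul_of_nonneg_left
    (le_self_pow₀ (one_le_rateProd q.1) three_ne_zero) (by positivity))
  have e2 := (integral_abs_hermiteSpace_le q.2).trans (mul_le_mul_of_nonneg_left
    (le_self_pow₀ (one_le_rateProd q.2) three_ne_zero) (by positivity))
  have h9 : (9 : ℝ) ^ d = 3 ^ d * 3 ^ d := by rw [← mul_pow]; norm_num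
  have := rateProd_pos q.1
  calc _ ≤ (3 ^ d * rateProd q.1 ^ 3) * (3 ^ d * rateProd q.2 ^ 3) := by gcongr
    _ = _ := by rw [h9]; ring

theorem integrable (h : IsHermiteSeries v c) :
    Integrable (fun p : Space d × Space d => v p.1 p.2) (volume.prod volume) := by
  refine ⟨h.continuous.aestronglyMeasurable, ?_⟩
  have h1 : ∀ p : Space d × Space d, ‖v p.1 p.2‖ₑ ≤ ∑' q : (Fin d → ℕ) × (Fin d → ℕ),
      ‖c q * (hermiteSpace q.1 p.1 * hermiteSpace q.2 p.2 : ℝ)‖ₑ := fun p => by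
    rw [← (h.hasSum p.1 p.2).tsum_eq]
    exact enorm_tsum_le_tsum_enorm
  refine (lintegral_mono h1).trans_lt ?_
  rw [lintegral_tsum fun q => ?_]
  · have h2 : ∀ q : (Fin d → ℕ) × (Fin d → ℕ), ∫⁻ p : Space d × Space d,
        ‖c q * (hermiteSpace q.1 p.1 * hermiteSpace q.2 p.2 : ℝ)‖ₑ ∂(volume.prod volume) ≤
        ENNReal.ofReal (9 ^ d * (‖c q‖ * (rateProd q.1 ^ 3 * rateProd q.2 ^ 3))) := fun q => by
      rw [← ofReal_integral_norm_eq_lintegral_enorm ((integrable_term q).ofReal.const_mul _)]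
      refine ENNReal.ofReal_le_ofReal ?_
      simp_rw [norm_mul (c q)]
      rw [integral_const_mul, mul_left_comm]
      exact mul_le_mul_of_nonneg_left (integral_abs_term_le q) (norm_nonneg _)
    refine (ENNReal.tsum_le_tsum h2).trans_lt ?_
    exact (h.summable.mul_left (9 ^ d)).tsum_ofReal_lt_top
  · have h1 := continuous_hermiteSpace q.1
    have h2 := continuous_hermiteSpace q.2
    exact (Continuous.measurable (by fun_prop)).enorm.aemeasurable

theorem integrable_sq (h : IsHermiteSeries v c) :
    Integrable (fun p : Space d × Space d => ‖v p.1 p.2‖ ^ 2) (volume.prod volume) := by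
  obtain ⟨M, -, hM⟩ := h.exists_norm_le
  have := h.integrable.norm.bdd_mul (c := M) (f := fun p : Space d × Space d => ‖v p.1 p.2‖)
    h.continuous.norm.aestronglyMeasurable (ae_of_all _ fun p => by simpa using hM p.1 p.2)
  simpa [pow_two] using this

/-- The quadratic form of functions of the energies in the two arguments of a Hermite series. -/
theorem hasSum_quadratic (h : IsHermiteSeries v c) {n₁ n₂ : ℝ → ℂ} {M₁ M₂ : ℝ}
    (hn₁ : Measurable n₁) (hn₂ : Measurable n₂) (hM₁ : ∀ ω, ‖n₁ ω‖ ≤ M₁) (hM₂ : ∀ ω, ‖n₂ ω‖ ≤ M₂) :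
    HasSum (fun z : ((Fin d → ℕ) × (Fin d → ℕ)) × ((Fin d → ℕ) × (Fin d → ℕ)) =>
      starRingEnd ℂ (c z.1) * c z.2 * moment n₁ z.1.1 z.2.1 * moment n₂ z.1.2 z.2.2)
      (∫ p : Space d × Space d, n₁ (‖p.1‖ ^ 2) * n₂ (‖p.2‖ ^ 2) * (‖v p.1 p.2‖ ^ 2 : ℝ)) := by
  have h1M : 0 ≤ M₁ := (norm_nonneg _).trans (hM₁ 0)
  have h2M : 0 ≤ M₂ := (norm_nonneg _).trans (hM₂ 0)
  obtain ⟨M, hM0, hM⟩ := h.exists_norm_le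
  have hs : Summable fun z : ((Fin d → ℕ) × (Fin d → ℕ)) × ((Fin d → ℕ) × (Fin d → ℕ)) =>
      starRingEnd ℂ (c z.1) * c z.2 * moment n₁ z.1.1 z.2.1 * moment n₂ z.1.2 z.2.2 := by
    refine Summable.of_norm_bounded (g := fun z => M₁ * M₂ * (‖c z.1‖ * ‖c z.2‖))
      ((h.summable_norm.mul_of_nonneg h.summable_norm (fun _ => norm_nonneg _)
        fun _ => norm_nonneg _).mul_left _) fun z => ?_
    rw [norm_mul, norm_mul, norm_mul, RCLike.norm_conj]
    have e1 := norm_moment_le hM₁ z.1.1 z.2.1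
    have e2 := norm_moment_le hM₂ z.1.2 z.2.2
    calc _ ≤ ‖c z.1‖ * ‖c z.2‖ * M₁ * M₂ := by gcongr
      _ = _ := by ring
  have hmeas : Measurable fun p : Space d × Space d => n₁ (‖p.1‖ ^ 2) * n₂ (‖p.2‖ ^ 2) := by
    fun_prop
  have hA := h.hasSum_integral_mul
    (f := fun p => n₁ (‖p.1‖ ^ 2) * n₂ (‖p.2‖ ^ 2) * starRingEnd ℂ (v p.1 p.2))
    (M := M₁ * M₂ * M)
    (hmeas.aestronglyMeasurable.mul (continuous_conj.comp h.continuous).aestronglyMeasurable)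
    (fun p => by
      rw [norm_mul, norm_mul, RCLike.norm_conj]
      have e1 := hM₁ (‖p.1‖ ^ 2)
      have e2 := hM₂ (‖p.2‖ ^ 2)
      have e3 := hM p.1 p.2
      gcongr)
  -- The double series is summed one factor at a time. Here the conjugated factor is expanded with q
  -- fixed, and conjugating the whole expansion brings it into the form covered by
  -- `hasSum_integral_mul`; `hA` expands the other factor.
  have hB : ∀ q : (Fin d → ℕ) × (Fin d → ℕ), HasSum (fun p : (Fin d → ℕ) × (Fin d → ℕ) =>
      starRingEnd ℂ (c p) * (moment n₁ p.1 q.1 * moment n₂ p.2 q.2))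
      (∫ p : Space d × Space d, n₁ (‖p.1‖ ^ 2) * n₂ (‖p.2‖ ^ 2) * starRingEnd ℂ (v p.1 p.2) *
        (hermiteSpace q.1 p.1 * hermiteSpace q.2 p.2 : ℝ)) := fun q => by
    have h1 := h.hasSum_integral_mul
      (f := fun p => starRingEnd ℂ (n₁ (‖p.1‖ ^ 2) * n₂ (‖p.2‖ ^ 2) *
        (hermiteSpace q.1 p.1 * hermiteSpace q.2 p.2 : ℝ)))
      (M := M₁ * M₂ * (4 ^ d * (rateProd q.1 ^ 3 * rateProd q.2 ^ 3)))
      (by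
        have h1 := continuous_hermiteSpace q.1
        have h2 := continuous_hermiteSpace q.2
        have h3 : Measurable fun p : Space d × Space d =>
          ((hermiteSpace q.1 p.1 * hermiteSpace q.2 p.2 : ℝ) : ℂ) :=
          Continuous.measurable (by fun_prop)
        exact (continuous_conj.measurable.comp (hmeas.mul h3)).aestronglyMeasurable)
      (fun p => by
        rw [RCLike.norm_conj, norm_mul, norm_mul, norm_real, Real.norm_eq_abs]
        have e1 := hM₁ (‖p.1‖ ^ 2)
        have e2 := hM₂ (‖p.2‖ ^ 2)
        have e3 := abs_mul_le q p.1 p.2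
        gcongr)
    have h2 := h1.map (starRingEnd ℂ) continuous_conj
    rw [← integral_conj] at h2
    have e1 : ∀ p : (Fin d → ℕ) × (Fin d → ℕ), starRingEnd ℂ (∫ z : Space d × Space d,
        starRingEnd ℂ (n₁ (‖z.1‖ ^ 2) * n₂ (‖z.2‖ ^ 2) *
        (hermiteSpace q.1 z.1 * hermiteSpace q.2 z.2 : ℝ)) *
        (hermiteSpace p.1 z.1 * hermiteSpace p.2 z.2 : ℝ)) =
        moment n₁ p.1 q.1 * moment n₂ p.2 q.2 := fun p => by
      rw [← integral_conj, moment, moment, ← integral_prod_mul, ← Measure.volume_eq_prod]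
      refine integral_congr_ae (ae_of_all _ fun z => ?_)
      simp only [map_mul, conj_ofReal, conj_conj]
      push_cast
      ring
    have e2 : (fun p : (Fin d → ℕ) × (Fin d → ℕ) =>
        starRingEnd ℂ (c p) * (moment n₁ p.1 q.1 * moment n₂ p.2 q.2)) =
        (starRingEnd ℂ) ∘ fun p => c p * ∫ z : Space d × Space d,
        starRingEnd ℂ (n₁ (‖z.1‖ ^ 2) * n₂ (‖z.2‖ ^ 2) *
        (hermiteSpace q.1 z.1 * hermiteSpace q.2 z.2 : ℝ)) *
        (hermiteSpace p.1 z.1 * hermiteSpace p.2 z.2 : ℝ) := by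
      ext1 p
      rw [Function.comp_apply, map_mul, e1]
    have e3 : ∫ p : Space d × Space d, n₁ (‖p.1‖ ^ 2) * n₂ (‖p.2‖ ^ 2) * starRingEnd ℂ (v p.1 p.2) *
        (hermiteSpace q.1 p.1 * hermiteSpace q.2 p.2 : ℝ) = ∫ p : Space d × Space d,
        starRingEnd ℂ (starRingEnd ℂ (n₁ (‖p.1‖ ^ 2) * n₂ (‖p.2‖ ^ 2) *
        (hermiteSpace q.1 p.1 * hermiteSpace q.2 p.2 : ℝ)) * v p.1 p.2) := by
      refine integral_congr_ae (ae_of_all _ fun z => ?_)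
      simp only [map_mul, conj_ofReal, conj_conj]
      ring
    rw [e2, e3]
    exact h2
  have hS := hs.hasSum
  have hS' := ((Equiv.prodComm _ _).hasSum_iff.2 hS).prod_fiberwise fun q => by
    refine hasSum_of_eq ((hB q).mul_left (c q)) fun p => ?_
    simp only [Function.comp_apply, Equiv.prodComm_apply, Prod.swap_prod_mk]
    ring
  have e4 := hS'.unique hA
  rw [e4] at hS
  convert! hS using 1
  refine integral_congr_ae (ae_of_all _ fun z => ?_)
  simp only [mul_assoc, Complex.conj_mul']
  push_cast
  rfl

/-- Each moment may cost up to the cubic weights, as these are exactly what the absolutely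
convergent series can pay. -/
theorem norm_quadratic_le (h : IsHermiteSeries v c) {n₁ n₂ : ℝ → ℂ} {B : ℝ}
    (hn₁ : Measurable n₁) (hn₂ : Measurable n₂) (hM₁ : ∀ ω, ‖n₁ ω‖ ≤ 1) (hM₂ : ∀ ω, ‖n₂ ω‖ ≤ 1)
    (hB : ∀ p q : (Fin d → ℕ) × (Fin d → ℕ), ‖moment n₁ p.1 q.1 * moment n₂ p.2 q.2‖ ≤
      B * ((rateProd p.1 ^ 3 * rateProd p.2 ^ 3) * (rateProd q.1 ^ 3 * rateProd q.2 ^ 3))) :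
    ‖∫ p : Space d × Space d, n₁ (‖p.1‖ ^ 2) * n₂ (‖p.2‖ ^ 2) * (‖v p.1 p.2‖ ^ 2 : ℝ)‖ ≤
      B * (∑' q, ‖c q‖ * (rateProd q.1 ^ 3 * rateProd q.2 ^ 3)) ^ 2 := by
  have hw0 : ∀ q : (Fin d → ℕ) × (Fin d → ℕ),
      0 ≤ ‖c q‖ * (rateProd q.1 ^ 3 * rateProd q.2 ^ 3) := fun q => by
    have := rateProd_pos q.1
    have := rateProd_pos q.2
    positivity
  rw [← (h.hasSum_quadratic hn₁ hn₂ hM₁ hM₂).tsum_eq, pow_two]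
  refine tsum_of_norm_bounded ((h.summable.hasSum.mul h.summable.hasSum
    (h.summable.mul_of_nonneg h.summable hw0 hw0)).mul_left B) fun z => ?_
  rw [mul_assoc, norm_mul, norm_mul, RCLike.norm_conj]
  calc _ ≤ ‖c z.1‖ * ‖c z.2‖ * (B * ((rateProd z.1.1 ^ 3 * rateProd z.1.2 ^ 3) *
        (rateProd z.2.1 ^ 3 * rateProd z.2.2 ^ 3))) := by
        gcongr
        exact hB _ _
    _ = _ := by ring

/-- The decay of the quadratic form under the free evolution of one argument. -/
theorem norm_integral_evolution_le (h : IsHermiteSeries v c) : ∃ C : ℝ, 0 ≤ C ∧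
    ∀ (n : ℝ → ℂ) (s : ℝ), s ≠ 0 → Measurable n → (∀ ω, ‖n ω‖ ≤ 1) →
      (‖∫ p : Space d × Space d, n (‖p.1‖ ^ 2) * evolution s (‖p.2‖ ^ 2) *
        (‖v p.1 p.2‖ ^ 2 : ℝ)‖ ≤ C * min 1 (|s| ^ (-((d : ℝ) / 2)))) ∧
      (‖∫ p : Space d × Space d, evolution s (‖p.1‖ ^ 2) * n (‖p.2‖ ^ 2) *
        (‖v p.1 p.2‖ ^ 2 : ℝ)‖ ≤ C * min 1 (|s| ^ (-((d : ℝ) / 2)))) := by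
  set S := ∑' q, ‖c q‖ * (rateProd q.1 ^ 3 * rateProd q.2 ^ 3) with hS
  set D : ℝ := ((2 * Real.pi) ^ d)⁻¹ * 9 ^ d * Real.pi ^ ((d : ℝ) / 2) with hD
  have hD0 : 0 ≤ D := by have := Real.pi_pos; positivity
  refine ⟨(1 + D) * S ^ 2, by positivity, fun n s hs hn hM => ?_⟩
  set x := |s| ^ (-((d : ℝ) / 2)) with hx
  have hs' : 0 < |s| := abs_pos.2 hs
  have hx0 : 0 < x := Real.rpow_pos_of_pos hs' _
  have hDx : ((2 * Real.pi) ^ d)⁻¹ * 9 ^ d * (Real.pi / |s|) ^ ((d : ℝ) / 2) = D * x := by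
    rw [Real.div_rpow Real.pi_pos.le hs'.le, hx, Real.rpow_neg hs'.le, hD]
    ring
  -- Interpolates between the trivial bound 1, used for small |s|, and the dispersive decay, used
  -- for large |s|.
  have hmom : ∀ a b : Fin d → ℕ, ‖moment (evolution s) a b‖ ≤
      (1 + D) * min 1 x * (rateProd a ^ 3 * rateProd b ^ 3) := fun a b => by
    have e1 := norm_moment_le (fun ω => (norm_evolution s ω).le) a b
    have e2 := norm_moment_evolution_le hs a b
    rw [hDx] at e2
    have ha := one_le_rateProd a
    have hb := one_le_rateProd b
    have h3 : rateProd a * rateProd b ≤ rateProd a ^ 3 * rateProd b ^ 3 := by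
      gcongr
      · exact le_self_pow₀ ha three_ne_zero
      · exact le_self_pow₀ hb three_ne_zero
    have h4 : (1 : ℝ) ≤ rateProd a ^ 3 * rateProd b ^ 3 :=
      one_le_mul_of_one_le_of_one_le (one_le_pow₀ ha) (one_le_pow₀ hb)
    rcases le_total 1 x with h1 | h1
    · rw [min_eq_left h1]
      nlinarith
    · rw [min_eq_right h1]
      have : D * x * (rateProd a * rateProd b) ≤ D * x * (rateProd a ^ 3 * rateProd b ^ 3) := by
        gcongr
      nlinarith [mul_pos hx0 (zero_lt_one.trans_le h4)]
  have hone : ∀ a b : Fin d → ℕ, ‖moment n a b‖ ≤ rateProd a ^ 3 * rateProd b ^ 3 := fun a b =>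
    (norm_moment_le hM a b).trans (one_le_mul_of_one_le_of_one_le
      (one_le_pow₀ (one_le_rateProd a)) (one_le_pow₀ (one_le_rateProd b)))
  have hm0 : 0 ≤ (1 + D) * min 1 x := by positivity
  have e : (1 + D) * S ^ 2 * min 1 x = (1 + D) * min 1 x * S ^ 2 := by ring
  rw [e]
  have hr := fun a : Fin d → ℕ => rateProd_pos a
  constructor
  · refine h.norm_quadratic_le hn (measurable_evolution s) hM (fun ω => (norm_evolution s ω).le)
      fun p q => ?_
    rw [norm_mul]
    have := hr p.1
    have := hr q.1
    calc _ ≤ (rateProd p.1 ^ 3 * rateProd q.1 ^ 3) *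
          ((1 + D) * min 1 x * (rateProd p.2 ^ 3 * rateProd q.2 ^ 3)) :=
          mul_le_mul (hone _ _) (hmom _ _) (norm_nonneg _) (by positivity)
      _ = _ := by ring
  · refine h.norm_quadratic_le (measurable_evolution s) hn (fun ω => (norm_evolution s ω).le) hM
      fun p q => ?_
    rw [norm_mul]
    have := hr p.1
    have := hr q.1
    calc _ ≤ ((1 + D) * min 1 x * (rateProd p.1 ^ 3 * rateProd q.1 ^ 3)) *
          (rateProd p.2 ^ 3 * rateProd q.2 ^ 3) :=
          mul_le_mul (hmom _ _) (hone _ _) (norm_nonneg _) (by positivity)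
      _ = _ := by ring

end IsHermiteSeries

/-- Integrability at infinity requires d/2 > 1, which is where d ≥ 3 enters; the minimum with 1
takes care of s near 0. -/
theorem integrable_min_rpow (hd : 3 ≤ d) :
    Integrable fun s : ℝ => min 1 (|s| ^ (-((d : ℝ) / 2))) := by
  have hd' : (3 : ℝ) ≤ d := by exact_mod_cast hd
  have h1 : IntegrableOn (fun s : ℝ => min 1 (|s| ^ (-((d : ℝ) / 2)))) (Set.Ioi 0) := by
    rw [← Set.Ioc_union_Ioi_eq_Ioi zero_le_one]
    refine IntegrableOn.union ?_ ?_
    · refine Measure.integrableOn_of_bounded (M := 1) (by simp)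
        (Measurable.aestronglyMeasurable (by fun_prop)) (ae_of_all _ fun s => ?_)
      rw [Real.norm_of_nonneg (by positivity)]
      exact min_le_left _ _
    · refine (integrableOn_Ioi_rpow_of_lt (a := -((d : ℝ) / 2)) (by linarith) zero_lt_one).mono'
        (Measurable.aestronglyMeasurable (by fun_prop)) ?_
      filter_upwards [ae_restrict_mem measurableSet_Ioi] with s hs
      rw [Real.norm_of_nonneg (by positivity), abs_of_pos (zero_lt_one.trans hs)]
      exact min_le_right _ _
  have h2 := h1.comp_neg
  rw [← integrableOn_univ, ← Set.Iic_union_Ioi (a := (0 : ℝ))]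
  refine IntegrableOn.union ?_ h1
  rw [integrableOn_Iic_iff_integrableOn_Iio]
  simpa using h2

end Junction
end


noncomputable section

namespace Junction

variable {d : ℕ}

/-! ### The one-body interaction as a series of operators -/

/-- The Hermite coefficients of a one-body kernel. -/
def coeff (w : Kernel d 1) (z : Label d × Label d) : ℂ :=
  hermiteCoeff w (fun _ => z.1) (fun _ => z.2)

theorem isHermiteSeries_coeff {w : Kernel d 1} (hw : WeightedSobolev w) (r r' : Reservoir) :
    IsHermiteSeries (block w r r') fun q => coeff w ((q.1, r), (q.2, r')) := by
  obtain ⟨c, hc⟩ := exists_isHermiteSeries hw r r'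
  have : (fun q : (Fin d → ℕ) × (Fin d → ℕ) => coeff w ((q.1, r), (q.2, r'))) = c :=
    funext fun q => hermiteCoeff_eq hc q.1 q.2
  rwa [this]

theorem coeff_swap {w : Kernel d 1} (hw : HermitianKernel w) (z : Label d × Label d) :
    coeff w z.swap = starRingEnd ℂ (coeff w z) := by
  rw [coeff, coeff, hermiteCoeff, hermiteCoeff, ← integral_conj, Measure.volume_eq_prod,
    ← integral_prod_swap]
  refine integral_congr_ae (ae_of_all _ fun p => ?_)
  simp only [map_mul, conj_ofReal, Prod.fst_swap, Prod.snd_swap]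
  rw [hw (fun j => (p.1 j, z.1.2)) (fun j => (p.2 j, z.2.2)), mul_comm (hermiteMulti _ p.2)]

/-- Pairs of labels, as pairs of reservoirs and pairs of quantum numbers. -/
def labelEquiv : (Reservoir × Reservoir) × ((Fin d → ℕ) × (Fin d → ℕ)) ≃ Label d × Label d :=
  (Equiv.prodComm _ _).trans (Equiv.prodProdProdComm _ _ _ _)

@[simp] theorem labelEquiv_apply (r : Reservoir × Reservoir) (q : (Fin d → ℕ) × (Fin d → ℕ)) :
    labelEquiv (r, q) = ((q.1, r.1), (q.2, r.2)) := rfl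

theorem summable_norm_coeff {w : Kernel d 1} (hw : WeightedSobolev w) :
    Summable fun z => ‖coeff w z‖ := by
  rw [← labelEquiv.summable_iff]
  refine (summable_prod_of_nonneg fun _ => norm_nonneg _).2 ?_
  exact ⟨fun r => (isHermiteSeries_coeff hw r.1 r.2).summable_norm, Summable.of_finite⟩

variable (β μ : Reservoir → ℝ)

/-- The quadratic operators of the one-body interaction. -/
def quadOp (U : Reservoir → OneParticle d → OneParticle d) (z : Label d × Label d) :
    FockOp (Doubled d) :=
  fieldStar β μ z.1.2 (U z.1.2 (hermiteState z.1.1)) *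
    field β μ z.2.2 (U z.2.2 (hermiteState z.2.1))

theorem norm_quadOp_le {U : Reservoir → OneParticle d → OneParticle d}
    (hU : ∀ r f, ‖U r f‖ ≤ ‖f‖) (z : Label d × Label d) : ‖quadOp β μ U z‖ ≤ 4 := by
  have h : ∀ z : Label d, ‖U z.2 (hermiteState z.1)‖ ≤ 1 := fun z =>
    (hU _ _).trans (norm_hermiteState _).le
  refine (norm_mul_le _ _).trans ?_
  have e1 := norm_fieldStar_le β μ z.1.2 (U z.1.2 (hermiteState z.1.1))
  have e2 := norm_field_le β μ z.2.2 (U z.2.2 (hermiteState z.2.1))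
  calc _ ≤ (2 * 1 : ℝ) * (2 * 1) := by
        gcongr
        · exact e1.trans (by linarith [h z.1])
        · exact e2.trans (by linarith [h z.2])
    _ = 4 := by norm_num

theorem interaction_eq (w : Kernel d 1) (U : Reservoir → OneParticle d → OneParticle d) :
    interaction β μ w U = ∑' z, coeff w z • quadOp β μ U z := by
  rw [interaction, ← ((Equiv.prodCongr (Equiv.funUnique (Fin 1) (Label d))
    (Equiv.funUnique (Fin 1) (Label d))).symm).tsum_eq]
  refine tsum_congr fun z => ?_
  simp only [List.ofFn_succ, List.ofFn_zero, List.prod_cons, List.prod_nil, mul_one]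
  rfl

theorem summable_norm_term {w : Kernel d 1} (hw : WeightedSobolev w)
    {U : Reservoir → OneParticle d → OneParticle d} (hU : ∀ r f, ‖U r f‖ ≤ ‖f‖) :
    Summable fun z => ‖coeff w z • quadOp β μ U z‖ := by
  refine ((summable_norm_coeff hw).mul_left 4).of_nonneg_of_le (fun _ => norm_nonneg _) fun z => ?_
  rw [norm_smul, mul_comm]
  exact mul_le_mul_of_nonneg_right (norm_quadOp_le β μ hU z) (norm_nonneg _)

/-- The charge of a quadratic operator under the gauge transformations of the reservoir `I`. -/
def charge (z : Label d × Label d) : ℝ :=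
  Reservoir.pick 1 0 z.1.2 - Reservoir.pick 1 0 z.2.2

theorem abs_charge_le (z : Label d × Label d) : |charge z| ≤ 1 := by
  obtain ⟨⟨a, r⟩, ⟨b, r'⟩⟩ := z
  cases r <;> cases r' <;> simp [charge, Reservoir.pick]

/-- A gauge transformation acts on a quadratic operator by a phase given by its charge.
Differentiating the phase turns the current into the interaction weighted by -i times the charge,
which removes all terms that do not transfer particles. -/
theorem quadOp_gauge (s : ℝ) (z : Label d × Label d) :
    quadOp β μ (Reservoir.pick (fun f => cexp (I * s) • f) id) z =
      cexp (I * charge z * s) • quadOp β μ (fun _ => id) z := by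
  obtain ⟨⟨a, r⟩, ⟨b, r'⟩⟩ := z
  have h : starRingEnd ℂ (cexp (I * s)) = cexp (-(I * s)) := by
    rw [← Complex.exp_conj]; simp
  cases r <;> cases r' <;>
    simp only [quadOp, Reservoir.pick, charge, id, field_smul, fieldStar_smul, h, smul_mul_assoc,
      mul_smul_comm, smul_smul, ← Complex.exp_add] <;> norm_num

theorem currentOperator_eq {w : Kernel d 1} (hw : WeightedSobolev w) :
    currentOperator β μ w =
      ∑' z, (-(I * charge z) * coeff w z) • quadOp β μ (fun _ => id) z := by
  have hS := summable_norm_term β μ hw (U := fun _ => id) fun _ _ => le_rfl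
  have h1 : HasDerivAt (gaugedInteraction β μ w)
      (∑' z, (I * charge z * cexp (I * charge z * (0 : ℝ))) •
        (coeff w z • quadOp β μ (fun _ => id) z)) 0 := by
    have e : gaugedInteraction β μ w = fun s : ℝ => ∑' z, cexp (I * charge z * s) •
        (coeff w z • quadOp β μ (fun _ => id) z) := by
      ext1 s
      rw [gaugedInteraction, interaction_eq]
      refine tsum_congr fun z => ?_
      rw [quadOp_gauge, smul_comm]
    rw [e]
    -- Unimodular phases and charges of modulus at most 1: the terms of the differentiated series
    -- are dominated, uniformly in s, by those of the interaction.
    have hn : ∀ (z : Label d × Label d) (s : ℝ), ‖cexp (I * charge z * s)‖ = 1 := fun z s => by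
      rw [Complex.norm_exp]; simp
    refine hasDerivAt_tsum (y₀ := 0) (g' := fun z (s : ℝ) =>
      (I * charge z * cexp (I * charge z * s)) • (coeff w z • quadOp β μ (fun _ => id) z))
      hS (fun z s => ?_) (fun z s => ?_) ?_ 0
    · have := ((((hasDerivAt_id s).ofReal_comp).const_mul (I * charge z : ℂ))).cexp
      refine HasDerivAt.smul_const (c := fun s : ℝ => cexp (I * charge z * s)) ?_
        (coeff w z • quadOp β μ (fun _ => id) z)
      simpa [mul_comm] using this
    · rw [norm_smul, norm_mul, hn, mul_one, norm_mul, norm_I, one_mul, norm_real, Real.norm_eq_abs]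
      exact mul_le_of_le_one_left (norm_nonneg _) (abs_charge_le z)
    · simpa using hS.of_norm
  rw [currentOperator, h1.deriv, ← tsum_neg]
  refine tsum_congr fun z => ?_
  rw [smul_smul, ← neg_smul]
  simp

theorem freeInteraction_eq (w : Kernel d 1) (s : ℝ) :
    freeInteraction β μ w s = ∑' z, coeff w z • quadOp β μ (fun _ => evolve s) z :=
  interaction_eq β μ w _

theorem continuous_freeInteraction {w : Kernel d 1} (hw : WeightedSobolev w) :
    Continuous (freeInteraction β μ w) := by
  rw [funext (freeInteraction_eq β μ w)]
  refine continuous_tsum (fun z => ?_) ((summable_norm_coeff hw).mul_left 4) fun z s => ?_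
  · have h : Continuous fun s => quadOp β μ (fun _ => evolve s) z :=
      ((continuous_fieldStar β μ _).comp (continuous_evolve _)).mul
        ((continuous_field β μ _).comp (continuous_evolve _))
    exact h.const_smul (coeff w z)
  · rw [norm_smul, mul_comm]
    exact mul_le_mul_of_nonneg_right (norm_quadOp_le β μ (fun _ f => norm_evolve_le s f) z)
      (norm_nonneg _)

theorem hasSum_commutator {ι R : Type*} [NormedRing R] [CompleteSpace R] {f g : ι → R}
    (hf : Summable fun x => ‖f x‖) (hg : Summable fun x => ‖g x‖) :
    HasSum (fun z : ι × ι => ⁅f z.1, g z.2⁆) ⁅∑' x, f x, ∑' x, g x⁆ := by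
  simp only [Ring.lie_def]
  have h1 := hf.of_norm.hasSum.mul hg.of_norm.hasSum (summable_mul_of_summable_norm hf hg)
  have h2 := hg.of_norm.hasSum.mul hf.of_norm.hasSum (summable_mul_of_summable_norm hg hf)
  exact h1.sub ((Equiv.prodComm ι ι).hasSum_iff.2 h2)

theorem hasSum_expect_commutator {w : Kernel d 1} (hw : WeightedSobolev w) (s : ℝ) :
    HasSum (fun z : (Label d × Label d) × (Label d × Label d) =>
      coeff w z.1 * (-(I * charge z.2) * coeff w z.2) *
        expect ⁅quadOp β μ (fun _ => evolve s) z.1, quadOp β μ (fun _ => id) z.2⁆)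
      (expect ⁅freeInteraction β μ w s, currentOperator β μ w⁆) := by
  rw [freeInteraction_eq, currentOperator_eq β μ hw]
  have h1 := hasSum_commutator
    (summable_norm_term β μ hw (U := fun _ => evolve s) fun _ f => norm_evolve_le s f)
    (f := fun z => coeff w z • quadOp β μ (fun _ => evolve s) z)
    (g := fun z => (-(I * charge z) * coeff w z) • quadOp β μ (fun _ => id) z) (by
      refine (summable_norm_term β μ hw (U := fun _ => id) fun _ _ => le_rfl).of_nonneg_of_le
        (fun _ => norm_nonneg _) fun z => ?_
      rw [mul_smul, norm_smul, norm_neg, norm_mul, norm_I, one_mul, norm_real, Real.norm_eq_abs]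
      exact mul_le_of_le_one_left (norm_nonneg _) (abs_charge_le z))
  have h2 := h1.mapL expectCLM
  refine IsHermiteSeries.hasSum_of_eq h2 fun z => ?_
  rw [← expectCLM_apply, ← smul_eq_mul, ← map_smul]
  congr 1
  simp only [Ring.lie_def, smul_mul_smul_comm, smul_sub]
  rw [mul_comm (coeff w z.1)]

/-- The Fourier transform of the kernel that couples the reservoirs, as a function of the incoming
and the outgoing momentum. -/
def transmission (w : Kernel d 1) (k l : Space d) : ℂ := kernelFourier w .II .I (-k) l

/-- Reflection of the first momentum changes phases only, by parity, so `transmission` inherits the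
summability of the kernel. All estimates for Hermite series can therefore be applied directly in
momentum space. -/
theorem isHermiteSeries_transmission {w : Kernel d 1} (hw : WeightedSobolev w) :
    IsHermiteSeries (transmission w) fun q => coeff w ((q.1, .II), (q.2, .I)) *
      (I ^ totalDegree q.1 * (-I) ^ totalDegree q.2) := by
  have h := isHermiteSeries_coeff hw .II .I
  refine ⟨?_, fun k l => ?_⟩
  · simpa [norm_mul] using h.summable
  · refine IsHermiteSeries.hasSum_of_eq (hasSum_kernelFourier h (-k) l) fun q => ?_
    have h5 : ∀ m : ℕ, (-I) ^ m * (-1) ^ m = I ^ m := fun m => by rw [← mul_pow]; simp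
    rw [hermiteSpace_neg, ← h5]
    push_cast
    ring

/-- The time correlation of the tunnelling current. -/
def correlation (w : Kernel d 1) (s : ℝ) : ℂ :=
  ∫ p : Space d × Space d, evolution s (‖p.1‖ ^ 2) * evolution (-s) (‖p.2‖ ^ 2) *
    (fermi (β .II) (μ .II) (‖p.1‖ ^ 2) - fermi (β .I) (μ .I) (‖p.2‖ ^ 2) : ℝ) *
      (‖transmission w p.1 p.2‖ ^ 2 : ℝ)

theorem moment_comm (n : ℝ → ℂ) (a b : Fin d → ℕ) : moment n a b = moment n b a := by
  simp only [moment, mul_comm (hermiteSpace a _)]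

theorem measurable_fermi_mul_evolution (β μ s : ℝ) :
    Measurable fun ω => fermi β μ ω * evolution s ω :=
  ((continuous_fermi β μ).measurable.complex_ofReal).mul (measurable_evolution s)

theorem norm_fermi_mul_evolution_le (β μ s ω : ℝ) : ‖fermi β μ ω * evolution s ω‖ ≤ 1 := by
  rw [norm_mul, norm_evolution, mul_one, norm_real, Real.norm_of_nonneg (fermi_pos _ _ _).le]
  exact fermi_le_one _ _ _

theorem integrable_quadratic {w : Kernel d 1} (hw : WeightedSobolev w) {n₁ n₂ : ℝ → ℂ}
    (hn₁ : Measurable n₁) (hn₂ : Measurable n₂) (hM₁ : ∀ ω, ‖n₁ ω‖ ≤ 1) (hM₂ : ∀ ω, ‖n₂ ω‖ ≤ 1) :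
    Integrable fun p : Space d × Space d => n₁ (‖p.1‖ ^ 2) * n₂ (‖p.2‖ ^ 2) *
      (‖transmission w p.1 p.2‖ ^ 2 : ℝ) := by
  refine (isHermiteSeries_transmission hw).integrable_sq.ofReal.bdd_mul (c := 1)
    (Measurable.aestronglyMeasurable (by fun_prop)) (ae_of_all _ fun p => ?_)
  rw [norm_mul]
  exact mul_le_one₀ (hM₁ _) (norm_nonneg _) (hM₂ _)

/-- Each of the two terms has a Fermi function in only one of the momenta; the pure evolution of the
other one is what produces the decay in time. -/
theorem correlation_eq {w : Kernel d 1} (hw : WeightedSobolev w) (s : ℝ) :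
    correlation β μ w s =
      (∫ p : Space d × Space d, (fermi (β .II) (μ .II) (‖p.1‖ ^ 2) * evolution s (‖p.1‖ ^ 2)) *
        evolution (-s) (‖p.2‖ ^ 2) * (‖transmission w p.1 p.2‖ ^ 2 : ℝ)) -
      ∫ p : Space d × Space d, evolution s (‖p.1‖ ^ 2) *
        (fermi (β .I) (μ .I) (‖p.2‖ ^ 2) * evolution (-s) (‖p.2‖ ^ 2)) *
          (‖transmission w p.1 p.2‖ ^ 2 : ℝ) := by
  rw [← integral_sub
    (integrable_quadratic hw (measurable_fermi_mul_evolution (β .II) (μ .II) s)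
      (measurable_evolution (-s)) (norm_fermi_mul_evolution_le _ _ _)
      fun ω => (norm_evolution _ ω).le)
    (integrable_quadratic hw (measurable_evolution s)
      (measurable_fermi_mul_evolution (β .I) (μ .I) (-s)) (fun ω => (norm_evolution _ ω).le)
      (norm_fermi_mul_evolution_le _ _ _))]
  refine integral_congr_ae (ae_of_all _ fun p => ?_)
  simp only
  push_cast
  ring

/-- The condition on the reservoirs says that the contractions close: what the first operator moves
between the reservoirs, the second moves back. -/
theorem expect_quadOp_commutator (s : ℝ) (z z' : Label d × Label d) :
    expect ⁅quadOp β μ (fun _ => evolve s) z, quadOp β μ (fun _ => id) z'⁆ =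
      if z.2.2 = z'.1.2 ∧ z.1.2 = z'.2.2 then
        phase z.2.1 z'.1.1 * phase z'.2.1 z.1.1 *
        (moment (evolution (-s)) z.2.1 z'.1.1 *
          moment (fun ω => fermi (β z.1.2) (μ z.1.2) ω * evolution s ω) z'.2.1 z.1.1 -
        moment (evolution s) z'.2.1 z.1.1 *
          moment (fun ω => fermi (β z.2.2) (μ z.2.2) ω * evolution (-s) ω) z.2.1 z'.1.1)
      else 0 := by
  rw [quadOp, quadOp, expect_commutator]
  split_ifs with h
  · rw [id, id, inner_evolve_left, inner_evolve_right, densityForm_evolve_left,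
      densityForm_evolve_right, ← h.1]
    ring
  · rfl

/-- The second-order current correlation. -/
theorem expect_commutator_current {w : Kernel d 1} (hw : WeightedSobolev w)
    (hw' : HermitianKernel w) (s : ℝ) :
    expect ⁅freeInteraction β μ w s, currentOperator β μ w⁆ =
      -I * (correlation β μ w s + correlation β μ w (-s)) := by
  have hT := isHermiteSeries_transmission hw
  have hcr : ∀ a b, coeff w ((a, .I), (b, .II)) = starRingEnd ℂ (coeff w ((b, .II), (a, .I))) :=
    fun a b => coeff_swap hw' ((b, .II), (a, .I))
  let e : ((Reservoir × Reservoir) × (Reservoir × Reservoir)) ×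
      (((Fin d → ℕ) × (Fin d → ℕ)) × ((Fin d → ℕ) × (Fin d → ℕ))) ≃
      (Label d × Label d) × (Label d × Label d) :=
    (Equiv.prodProdProdComm _ _ _ _).trans (Equiv.prodCongr labelEquiv labelEquiv)
  -- The sum is grouped by reservoir labels. Nonzero charge and matching contractions leave only the
  -- two patterns in which one operator moves a particle from I to II and the other back; exchanging
  -- them reverses the sign of s.
  let V : (Reservoir × Reservoir) × (Reservoir × Reservoir) → ℂ := fun r =>
    if r = ((.II, .I), (.I, .II)) then -I * correlation β μ w s else
    if r = ((.I, .II), (.II, .I)) then -I * correlation β μ w (-s) else 0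
  have hV := (e.hasSum_iff.2 (hasSum_expect_commutator β μ hw s)).prod_fiberwise (g := V)
    fun r => by
    obtain ⟨⟨r₁, r₁'⟩, ⟨r₂, r₂'⟩⟩ := r
    by_cases h1 : ((r₁, r₁'), (r₂, r₂')) = ((Reservoir.II, Reservoir.I), (Reservoir.I, Reservoir.II))
    · simp only [Prod.mk.injEq] at h1
      obtain ⟨⟨rfl, rfl⟩, rfl, rfl⟩ := h1
      simp only [V, if_true]
      rw [correlation_eq β μ hw]
      have q1 := hT.hasSum_quadratic (measurable_fermi_mul_evolution (β .II) (μ .II) s)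
        (measurable_evolution (-s)) (norm_fermi_mul_evolution_le _ _ _)
        (fun ω => (norm_evolution _ ω).le)
      have q2 := hT.hasSum_quadratic (measurable_evolution s)
        (measurable_fermi_mul_evolution (β .I) (μ .I) (-s)) (fun ω => (norm_evolution _ ω).le)
        (norm_fermi_mul_evolution_le _ _ _)
      have q3 := ((Equiv.prodComm _ _).trans (Equiv.prodCongr (Equiv.prodComm _ _)
        (Equiv.refl _))).hasSum_iff.2 ((q1.sub q2).mul_left (-I))
      refine IsHermiteSeries.hasSum_of_eq q3 fun x => ?_
      obtain ⟨⟨a, b⟩, ⟨a', b'⟩⟩ := x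
      simp only [Function.comp_apply, e, Equiv.trans_apply, Equiv.prodProdProdComm_apply,
        Equiv.prodCongr_apply, Prod.map_apply, labelEquiv_apply, expect_quadOp_commutator,
        Equiv.prodComm_apply, Prod.swap_prod_mk, Equiv.refl_apply, and_self, if_true, hcr,
        phase, map_mul, map_pow, map_neg, conj_I, neg_neg, charge, Reservoir.pick,
        moment_comm _ b a']
      push_cast
      ring
    by_cases h2 : ((r₁, r₁'), (r₂, r₂')) = ((Reservoir.I, Reservoir.II), (Reservoir.II, Reservoir.I))
    · simp only [Prod.mk.injEq] at h2
      obtain ⟨⟨rfl, rfl⟩, rfl, rfl⟩ := h2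
      simp only [V, h1, if_true, if_false]
      rw [correlation_eq β μ hw, neg_neg]
      have q1 := hT.hasSum_quadratic (measurable_fermi_mul_evolution (β .II) (μ .II) (-s))
        (measurable_evolution s) (norm_fermi_mul_evolution_le _ _ _)
        (fun ω => (norm_evolution _ ω).le)
      have q2 := hT.hasSum_quadratic (measurable_evolution (-s))
        (measurable_fermi_mul_evolution (β .I) (μ .I) s) (fun ω => (norm_evolution _ ω).le)
        (norm_fermi_mul_evolution_le _ _ _)
      have q3 := (Equiv.prodCongr (Equiv.prodComm _ _)
        (Equiv.refl _)).hasSum_iff.2 ((q1.sub q2).mul_left (-I))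
      refine IsHermiteSeries.hasSum_of_eq q3 fun x => ?_
      obtain ⟨⟨a, b⟩, ⟨a', b'⟩⟩ := x
      simp only [Function.comp_apply, e, Equiv.trans_apply, Equiv.prodProdProdComm_apply,
        Equiv.prodCongr_apply, Prod.map_apply, labelEquiv_apply, expect_quadOp_commutator,
        Equiv.prodComm_apply, Prod.swap_prod_mk, Equiv.refl_apply, and_self, if_true, hcr,
        phase, map_mul, map_pow, map_neg, conj_I, neg_neg, charge, Reservoir.pick,
        moment_comm _ b' a]
      push_cast
      ring
    · simp only [V, h1, h2, if_false]
      refine IsHermiteSeries.hasSum_of_eq hasSum_zero fun x => ?_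
      simp only [Function.comp_apply, e, Equiv.trans_apply, Equiv.prodProdProdComm_apply,
        Equiv.prodCongr_apply, Prod.map_apply, labelEquiv_apply, expect_quadOp_commutator]
      cases r₁ <;> cases r₁' <;> cases r₂ <;> cases r₂' <;>
        simp [charge, Reservoir.pick] at h1 h2 ⊢
  have h2 := hV.unique (hasSum_fintype V)
  rw [h2]
  rw [Fintype.sum_prod_type, Fintype.sum_prod_type]
  have hR : ∀ f : Reservoir → ℂ, ∑ r, f r = f .I + f .II := fun f => by
    simp [Finset.univ, Fintype.elems]
  simp only [Fintype.sum_prod_type, hR, V]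
  simp
  ring

theorem expect_dysonCurrent {w : (N : ℕ) → Kernel d N} (hw : WeightedSobolev (w 1))
    (hw' : HermitianKernel (w 1)) (t : ℝ) :
    expect (dysonCurrent β μ w 2 2 t) =
      ∫ s in (0 : ℝ)..t, (correlation β μ (w 1) s + correlation β μ (w 1) (-s)) := by
  have e1 : dysonCurrent β μ w 2 2 t = I • ∫ s in (0 : ℝ)..t,
      ⁅freeInteraction β μ (w 1) s, currentOperator β μ (w 1)⁆ := by
    simp [dysonCurrent]
  have hc : Continuous fun s =>
      ⁅freeInteraction β μ (w 1) s, currentOperator β μ (w 1)⁆ := by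
    simp only [Ring.lie_def]
    have := continuous_freeInteraction β μ hw
    fun_prop
  rw [e1, ← expectCLM_apply, map_smul,
    ← ContinuousLinearMap.intervalIntegral_comp_comm _ (hc.intervalIntegrable 0 t)]
  simp only [expectCLM_apply, expect_commutator_current β μ hw hw']
  rw [intervalIntegral.integral_const_mul, smul_eq_mul, ← mul_assoc]
  simp

/-- The order of the quantifiers matters: the constant is the same for all β and μ, since only 0 < ρ
≤ 1 is used. `integrable_transmission_sq` depends on this. -/
theorem exists_norm_correlation_le {w : Kernel d 1} (hw : WeightedSobolev w) :
    ∃ C : ℝ, 0 ≤ C ∧ ∀ (β μ : Reservoir → ℝ) (s : ℝ), s ≠ 0 →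
      ‖correlation β μ w s‖ ≤ C * min 1 (|s| ^ (-((d : ℝ) / 2))) := by
  obtain ⟨C, hC, h⟩ := (isHermiteSeries_transmission hw).norm_integral_evolution_le
  refine ⟨2 * C, by positivity, fun β μ s hs => ?_⟩
  rw [correlation_eq β μ hw]
  have h1 := (h _ (-s) (neg_ne_zero.2 hs) (measurable_fermi_mul_evolution (β .II) (μ .II) s)
    (norm_fermi_mul_evolution_le _ _ _)).1
  have h2 := (h _ s hs (measurable_fermi_mul_evolution (β .I) (μ .I) (-s))
    (norm_fermi_mul_evolution_le _ _ _)).2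
  rw [abs_neg] at h1
  refine (norm_sub_le _ _).trans ?_
  linarith

theorem continuous_correlation {w : Kernel d 1} (hw : WeightedSobolev w) :
    Continuous (correlation β μ w) := by
  have hT := isHermiteSeries_transmission hw
  have hf := fun r => continuous_fermi (β r) (μ r)
  have hc := hT.continuous
  refine continuous_of_dominated (bound := fun p => ‖transmission w p.1 p.2‖ ^ 2) (fun s => ?_)
    (fun s => ae_of_all _ fun p => ?_) hT.integrable_sq (ae_of_all _ fun p => ?_)
  · have h1 := hf .I
    have h2 := hf .II
    unfold evolution
    exact Continuous.aestronglyMeasurable (by fun_prop)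
  · rw [norm_mul, norm_mul, norm_mul, norm_evolution, norm_evolution, one_mul, one_mul, norm_real,
      norm_real, Real.norm_of_nonneg (sq_nonneg ‖transmission w p.1 p.2‖), Real.norm_eq_abs]
    refine mul_le_of_le_one_left (by positivity) ?_
    rw [abs_le]
    constructor <;> linarith [fermi_pos (β .I) (μ .I) (‖p.2‖ ^ 2),
      fermi_pos (β .II) (μ .II) (‖p.1‖ ^ 2), fermi_le_one (β .I) (μ .I) (‖p.2‖ ^ 2),
      fermi_le_one (β .II) (μ .II) (‖p.1‖ ^ 2)]
  · unfold evolution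
    fun_prop

theorem integrable_correlation (hd : 3 ≤ d) {w : Kernel d 1} (hw : WeightedSobolev w) :
    Integrable (correlation β μ w) := by
  obtain ⟨C, -, hC⟩ := exists_norm_correlation_le hw
  refine ((integrable_min_rpow hd).const_mul C).mono'
    (continuous_correlation β μ hw).aestronglyMeasurable ?_
  filter_upwards [compl_mem_ae_iff.2 (measure_singleton (0 : ℝ))] with s hs
  exact hC β μ s hs

/-- Folding at 0: the integrals over (0, t) of the symmetrized function exhaust the integral over
the whole line. -/
theorem tendsto_integral_add_comp_neg {f : ℝ → ℂ} (hf : Integrable f) :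
    Tendsto (fun t : ℝ => ∫ s in (0 : ℝ)..t, (f s + f (-s))) atTop (𝓝 (∫ s, f s)) := by
  have h1 : Integrable fun s => f s + f (-s) := hf.add hf.comp_neg
  have h2 := intervalIntegral_tendsto_integral_Ioi 0 h1.integrableOn tendsto_id
  convert! h2 using 2
  rw [integral_add hf.integrableOn hf.comp_neg.integrableOn, integral_comp_neg_Ioi, neg_zero,
    add_comm, ← intervalIntegral.integral_Iic_add_Ioi hf.integrableOn hf.integrableOn]

/-- The second-order current is the zero frequency component of the correlation function. -/
theorem tendsto_expect_dysonCurrent (hd : 3 ≤ d) {w : (N : ℕ) → Kernel d N}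
    (hw : WeightedSobolev (w 1)) (hw' : HermitianKernel (w 1)) :
    Tendsto (fun t : ℝ => expect (dysonCurrent β μ w 2 2 t)) atTop
      (𝓝 (∫ s, correlation β μ (w 1) s)) := by
  simp only [expect_dysonCurrent β μ hw hw']
  exact tendsto_integral_add_comp_neg (integrable_correlation β μ hd hw)

end Junction
end


noncomputable section

namespace Junction

variable {d : ℕ}

/-! ### Integration over energy shells -/

/-- The unit sphere. -/
abbrev UnitSphere (d : ℕ) : Type := Metric.sphere (0 : Space d) 1

/-- The surface measure of the unit sphere. -/
abbrev sphereMeasure (d : ℕ) : Measure (UnitSphere d) := (volume : Measure (Space d)).toSphere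

theorem lintegral_polar (hd : 3 ≤ d) {f : Space d → ℝ≥0∞} (hf : Measurable f) :
    ∫⁻ x, f x = ∫⁻ r in Set.Ioi (0 : ℝ), ENNReal.ofReal (r ^ (d - 1)) *
      ∫⁻ θ : UnitSphere d, f (r • (θ : Space d)) ∂sphereMeasure d := by
  have : Nonempty (Fin d) := ⟨⟨0, by omega⟩⟩
  have hmp := (volume : Measure (Space d)).measurePreserving_homeomorphUnitSphereProd
  rw [finrank_euclideanSpace_fin] at hmp
  have hg : Measurable fun z : UnitSphere d × Set.Ioi (0 : ℝ) => f ((z.2 : ℝ) • (z.1 : Space d)) :=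
    hf.comp (by fun_prop)
  have h1 := hmp.lintegral_comp hg
  have h2 : ∫⁻ x, f x = ∫⁻ x in ({0}ᶜ : Set (Space d)), f x := by
    rw [restrict_compl_singleton]
  rw [h2, ← lintegral_subtype_comap (measurableSet_singleton _).compl]
  have e : ∀ x : ({0}ᶜ : Set (Space d)), f x =
      f (((homeomorphUnitSphereProd (Space d) x).2 : ℝ) •
        ((homeomorphUnitSphereProd (Space d) x).1 : Space d)) := fun x => by
    have hx : ‖(x : Space d)‖ ≠ 0 := norm_ne_zero_iff.2 x.2
    simp [smul_smul, hx]
  simp_rw [e]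
  rw [h1, lintegral_prod_symm _ hg.aemeasurable, Measure.volumeIoiPow,
    lintegral_withDensity_eq_lintegral_mul _ (by fun_prop) hg.lintegral_prod_left']
  rw [← lintegral_subtype_comap measurableSet_Ioi]
  rfl

/-- The substitution ω = r² in polar coordinates turns r^{d-1} dr into ω^{(d-2)/2} dω / 2. As `√ω =
0` for ω ≤ 0 and d > 2, the density vanishes there, and ω may range over all of ℝ; translations in ω
are then free. -/
theorem lintegral_energy_polar (hd : 3 ≤ d) {f : Space d → ℝ≥0∞} (hf : Measurable f) :
    ∫⁻ x, f x = ∫⁻ ω : ℝ, ENNReal.ofReal (√ω ^ (d - 2) / 2) *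
      ∫⁻ θ : UnitSphere d, f (√ω • (θ : Space d)) ∂sphereMeasure d := by
  rw [lintegral_polar hd hf]
  have h1 : ∫⁻ ω : ℝ, ENNReal.ofReal (√ω ^ (d - 2) / 2) *
      ∫⁻ θ : UnitSphere d, f (√ω • (θ : Space d)) ∂sphereMeasure d =
      ∫⁻ ω in Set.Ioi (0 : ℝ), ENNReal.ofReal (√ω ^ (d - 2) / 2) *
      ∫⁻ θ : UnitSphere d, f (√ω • (θ : Space d)) ∂sphereMeasure d := by
    rw [← lintegral_indicator measurableSet_Ioi]
    refine lintegral_congr fun ω => ?_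
    by_cases hω : 0 < ω
    · rw [Set.indicator_of_mem (Set.mem_Ioi.2 hω)]
    · rw [Set.indicator_of_notMem (by simpa using hω), Real.sqrt_eq_zero_of_nonpos (not_lt.1 hω),
        zero_pow (by omega)]
      simp
  have h2 : (fun r : ℝ => r ^ 2) '' Set.Ioi 0 = Set.Ioi 0 := by
    ext y
    constructor
    · rintro ⟨x, hx, rfl⟩
      have : (0 : ℝ) < x := hx
      exact Set.mem_Ioi.2 (by positivity)
    · exact fun hy => ⟨√y, Real.sqrt_pos.2 hy, Real.sq_sqrt (Set.mem_Ioi.1 hy).le⟩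
  rw [h1]
  conv_rhs => rw [← h2]
  rw [lintegral_image_eq_lintegral_abs_deriv_mul measurableSet_Ioi
    (f' := fun r => 2 * r)
    (fun x _ => by simpa using (hasDerivAt_pow 2 x).hasDerivWithinAt)
    (fun x hx y hy h => (sq_eq_sq₀ (le_of_lt hx) (le_of_lt hy)).1 h)]
  refine setLIntegral_congr_fun measurableSet_Ioi fun r hr => ?_
  have hr : 0 < r := hr
  rw [Real.sqrt_sq hr.le, ← mul_assoc, ← ENNReal.ofReal_mul (abs_nonneg _),
    abs_of_pos (by positivity)]
  congr 2
  rw [show d - 1 = d - 2 + 1 by omega, pow_succ]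
  ring

/-- Points of the energy shell `|l|² - |k|² = δ`. -/
def shellPoint (z : ℝ × (Space d × UnitSphere d)) : Space d × Space d :=
  (z.2.1, √(‖z.2.1‖ ^ 2 + z.1) • (z.2.2 : Space d))

/-- The density of the energy shells `|l|² - |k|² = δ`. -/
def shellDensity (z : ℝ × (Space d × UnitSphere d)) : ℝ :=
  √(‖z.2.1‖ ^ 2 + z.1) ^ (d - 2) / 2

theorem continuous_shellPoint : Continuous (shellPoint (d := d)) := by
  unfold shellPoint
  fun_prop

theorem continuous_shellDensity : Continuous (shellDensity (d := d)) := by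
  unfold shellDensity
  fun_prop

theorem shellDensity_nonneg (z : ℝ × (Space d × UnitSphere d)) : 0 ≤ shellDensity z := by
  unfold shellDensity
  positivity

instance : SFinite (sphereMeasure d) := by
  unfold sphereMeasure
  infer_instance

instance : SFinite ((volume : Measure (Space d)).prod (sphereMeasure d)) :=
  Measure.prod.instSFinite

/-- The measure on the space of all parameters of points of energy shells. -/
abbrev shellParameter (d : ℕ) : Measure (ℝ × (Space d × UnitSphere d)) :=
  (volume : Measure ℝ).prod ((volume : Measure (Space d)).prod (sphereMeasure d))

/-- Disintegration of dk dl over the energy transfer δ: for fixed k, the energy of l is |k|² + δ, so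
translation invariance in the energy replaces it by δ as variable. -/
theorem map_shellPoint (hd : 3 ≤ d) :
    Measure.map shellPoint ((shellParameter d).withDensity
      fun z => ENNReal.ofReal (shellDensity z)) =
      (volume : Measure (Space d)).prod (volume : Measure (Space d)) := by
  have hP := continuous_shellPoint (d := d).measurable
  have hD : Measurable fun z : ℝ × (Space d × UnitSphere d) => ENNReal.ofReal (shellDensity z) :=
    continuous_shellDensity.measurable.ennreal_ofReal
  refine Measure.ext_of_lintegral _ fun f hf => ?_
  have hF : Measurable fun z : ℝ × (Space d × UnitSphere d) =>
      ENNReal.ofReal (shellDensity z) * f (shellPoint z) := hD.mul (hf.comp hP)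
  have hw := lintegral_withDensity_eq_lintegral_mul (shellParameter d) hD (hf.comp hP)
  simp only [Pi.mul_apply, Function.comp_apply] at hw
  rw [lintegral_map hf hP, hw, lintegral_prod _ hf.aemeasurable]
  rw [lintegral_prod _ hF.aemeasurable]
  have h1 : ∀ δ : ℝ, ∫⁻ y : Space d × UnitSphere d, ENNReal.ofReal (shellDensity (δ, y)) *
      f (shellPoint (δ, y)) ∂((volume : Measure (Space d)).prod (sphereMeasure d)) =
      ∫⁻ k : Space d, ∫⁻ θ : UnitSphere d, ENNReal.ofReal (shellDensity (δ, (k, θ))) *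
        f (shellPoint (δ, (k, θ))) ∂(sphereMeasure d) := fun δ =>
    lintegral_prod _ (hF.comp (by fun_prop)).aemeasurable
  simp only [h1]
  rw [lintegral_lintegral_swap]
  · refine lintegral_congr fun k => ?_
    have h2 : Measurable fun l => f (k, l) := hf.comp (by fun_prop)
    -- For fixed k, polar coordinates in l and a shift of the energy by |k|².
    rw [lintegral_energy_polar hd h2, ← lintegral_add_left_eq_self
      (fun ω : ℝ => ENNReal.ofReal (√ω ^ (d - 2) / 2) *
        ∫⁻ θ : UnitSphere d, f (k, √ω • (θ : Space d)) ∂sphereMeasure d) (‖k‖ ^ 2)]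
    refine lintegral_congr fun δ => ?_
    have h3 : Measurable fun θ : UnitSphere d => f (k, √(‖k‖ ^ 2 + δ) • (θ : Space d)) :=
      h2.comp (g := fun l => f (k, l)) (by fun_prop)
    rw [← lintegral_const_mul _ h3]
    rfl
  · refine Measurable.aemeasurable ?_
    exact Measurable.lintegral_prod_right' (f := fun z : (ℝ × Space d) × UnitSphere d =>
      ENNReal.ofReal (shellDensity (z.1.1, (z.1.2, z.2))) * f (shellPoint (z.1.1, (z.1.2, z.2))))
      (hF.comp (by fun_prop))

theorem integrable_shell (hd : 3 ≤ d) {F : Space d × Space d → ℂ}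
    (hF : Integrable F (volume.prod volume)) :
    Integrable (fun z => (shellDensity z : ℂ) * F (shellPoint z)) (shellParameter d) := by
  have hP := continuous_shellPoint (d := d).measurable
  rw [← map_shellPoint hd] at hF
  have h1 := (integrable_map_measure hF.aestronglyMeasurable hP.aemeasurable).1 hF
  rw [integrable_withDensity_iff_integrable_smul'
    continuous_shellDensity.measurable.ennreal_ofReal (ae_of_all _ fun _ => by simp)] at h1
  refine h1.congr (ae_of_all _ fun z => ?_)
  simp only [ENNReal.toReal_ofReal (shellDensity_nonneg z), Complex.real_smul, Function.comp_apply]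

theorem integral_shell (hd : 3 ≤ d) {F : Space d × Space d → ℂ}
    (hF : Integrable F (volume.prod volume)) :
    ∫ z, (shellDensity z : ℂ) * F (shellPoint z) ∂(shellParameter d) =
      ∫ p, F p ∂(volume.prod volume) := by
  have hP := continuous_shellPoint (d := d).measurable
  rw [← map_shellPoint hd] at hF ⊢
  rw [integral_map hP.aemeasurable hF.aestronglyMeasurable,
    integral_withDensity_eq_integral_toReal_smul
    continuous_shellDensity.measurable.ennreal_ofReal (ae_of_all _ fun _ => by simp)]
  refine integral_congr_ae (ae_of_all _ fun z => ?_)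
  simp only [ENNReal.toReal_ofReal (shellDensity_nonneg z), Complex.real_smul]

theorem energyShell_eq : energyShell d = Measure.map (fun y => shellPoint (0, y))
    (((volume : Measure (Space d)).prod (sphereMeasure d)).withDensity
      fun y => ENNReal.ofReal (shellDensity (0, y))) := by
  rw [energyShell, prod_withDensity_left (by fun_prop)]
  simp [shellPoint, shellDensity]

theorem measurable_shellDensity_zero :
    Measurable fun y : Space d × UnitSphere d => ENNReal.ofReal (shellDensity (0, y)) :=
  (continuous_shellDensity.measurable.comp (by fun_prop)).ennreal_ofReal

theorem continuous_shellPoint_zero : Continuous fun y : Space d × UnitSphere d =>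
    shellPoint (0, y) := continuous_shellPoint.comp (by fun_prop)

theorem integrable_energyShell_iff {E : Type*} [NormedAddCommGroup E] [NormedSpace ℝ E]
    {F : Space d × Space d → E} (hF : AEStronglyMeasurable F (energyShell d)) :
    Integrable F (energyShell d) ↔
      Integrable (fun y => shellDensity (0, y) • F (shellPoint (0, y)))
        ((volume : Measure (Space d)).prod (sphereMeasure d)) := by
  rw [energyShell_eq] at hF ⊢
  rw [integrable_map_measure hF continuous_shellPoint_zero.measurable.aemeasurable,
    integrable_withDensity_iff_integrable_smul' measurable_shellDensity_zero
    (ae_of_all _ fun _ => by simp)]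
  refine integrable_congr (ae_of_all _ fun z => ?_)
  simp only [ENNReal.toReal_ofReal (shellDensity_nonneg _), Function.comp_apply]

theorem integral_energyShell {E : Type*} [NormedAddCommGroup E] [NormedSpace ℝ E]
    {F : Space d × Space d → E} (hF : AEStronglyMeasurable F (energyShell d)) :
    ∫ p, F p ∂(energyShell d) =
      ∫ y, shellDensity (0, y) • F (shellPoint (0, y))
        ∂((volume : Measure (Space d)).prod (sphereMeasure d)) := by
  rw [energyShell_eq] at hF ⊢
  rw [integral_map continuous_shellPoint_zero.measurable.aemeasurable hF,
    integral_withDensity_eq_integral_toReal_smul measurable_shellDensity_zero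
    (ae_of_all _ fun _ => by simp)]
  refine integral_congr_ae (ae_of_all _ fun z => ?_)
  simp only [ENNReal.toReal_ofReal (shellDensity_nonneg _)]

/-- A function is bounded near the energy shell by an integrable function of the first momentum. -/
def ShellDominated (G : Space d × Space d → ℂ) (b : Space d → ℝ) : Prop :=
  Integrable b ∧ (∀ k, 0 ≤ b k) ∧
    ∀ k l, |‖l‖ ^ 2 - ‖k‖ ^ 2| ≤ 1 → ‖l‖ ^ (d - 2) * ‖G (k, l)‖ ≤ b k

theorem ShellDominated.norm_le {G : Space d × Space d → ℂ} {b : Space d → ℝ}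
    (hb : ShellDominated G b) {δ : ℝ} (hδ : |δ| ≤ 1) (y : Space d × UnitSphere d) :
    ‖(shellDensity (δ, y) : ℂ) * G (shellPoint (δ, y))‖ ≤ b y.1 := by
  have hn : ‖√(‖y.1‖ ^ 2 + δ) • (y.2 : Space d)‖ = √(‖y.1‖ ^ 2 + δ) := by
    rw [norm_smul, Real.norm_of_nonneg (Real.sqrt_nonneg _)]
    simp
  have h1 := hb.2.2 y.1 (√(‖y.1‖ ^ 2 + δ) • (y.2 : Space d)) (by
    rw [hn]
    rcases le_total 0 (‖y.1‖ ^ 2 + δ) with h | h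
    · rw [Real.sq_sqrt h]; simpa using hδ
    · rw [abs_le] at hδ ⊢
      rw [Real.sqrt_eq_zero_of_nonpos h]
      constructor <;> nlinarith [sq_nonneg ‖y.1‖])
  rw [hn] at h1
  rw [norm_mul, norm_real, Real.norm_of_nonneg (shellDensity_nonneg _)]
  have h0 := hb.2.1 y.1
  have : shellDensity (δ, y) * ‖G (shellPoint (δ, y))‖ =
    (√(‖y.1‖ ^ 2 + δ) ^ (d - 2) * ‖G (y.1, √(‖y.1‖ ^ 2 + δ) • (y.2 : Space d))‖) / 2 := by
    simp only [shellDensity, shellPoint]; ring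
  rw [this]
  linarith

theorem ShellDominated.integrable_bound {G : Space d × Space d → ℂ} {b : Space d → ℝ}
    (hb : ShellDominated G b) : Integrable (fun y : Space d × UnitSphere d => b y.1)
      ((volume : Measure (Space d)).prod (sphereMeasure d)) := by
  simpa using hb.1.mul_prod (integrable_const (μ := sphereMeasure d) (1 : ℝ))

theorem ShellDominated.integrable {G : Space d × Space d → ℂ} {b : Space d → ℝ}
    (hb : ShellDominated G b) (hG : Continuous G) : Integrable G (energyShell d) := by
  rw [integrable_energyShell_iff hG.aestronglyMeasurable]
  have h1 := continuous_shellDensity.comp (Continuous.prodMk_right (0 : ℝ) :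
    Continuous fun y : Space d × UnitSphere d => ((0 : ℝ), y))
  refine hb.integrable_bound.mono'
    (h1.smul (hG.comp continuous_shellPoint_zero)).aestronglyMeasurable (ae_of_all _ fun y => ?_)
  rw [Complex.real_smul]
  exact hb.norm_le (by simp) y

/-- Integration of the correlation function over all times restricts to the energy shell. -/
theorem integral_evolution_eq_energyShell (hd : 3 ≤ d) {G : Space d × Space d → ℂ}
    {b : Space d → ℝ} (hG : Continuous G) (hGi : Integrable G (volume.prod volume))
    (hb : ShellDominated G b)
    (hE : Integrable fun s : ℝ => ∫ p : Space d × Space d,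
      evolution s (‖p.1‖ ^ 2) * evolution (-s) (‖p.2‖ ^ 2) * G p) :
    ∫ s : ℝ, ∫ p : Space d × Space d,
      evolution s (‖p.1‖ ^ 2) * evolution (-s) (‖p.2‖ ^ 2) * G p =
      2 * Real.pi * ∫ p, G p ∂(energyShell d) := by
  set E : ℝ → ℂ := fun s => ∫ p : Space d × Space d,
      evolution s (‖p.1‖ ^ 2) * evolution (-s) (‖p.2‖ ^ 2) * G p with hEdef
  -- `h δ` is the integral of G over the shell of energy transfer δ. The aim is 2π `h 0` = ∫ E.
  set h : ℝ → ℂ := fun δ => ∫ y, (shellDensity (δ, y) : ℂ) * G (shellPoint (δ, y))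
    ∂((volume : Measure (Space d)).prod (sphereMeasure d)) with hh
  have hint : Integrable h := (integrable_shell hd hGi).integral_prod_left
  -- On the shell the two evolution factors combine to e^{isδ}, so E is the Fourier transform of
  -- `h`, with s = -2πτ in the normalization of `𝓕`.
  have hF : 𝓕 h = fun τ => E (-2 * Real.pi * τ) := by
    ext τ
    have hGe : Integrable (fun p : Space d × Space d => evolution (-2 * Real.pi * τ) (‖p.1‖ ^ 2) *
        evolution (-(-2 * Real.pi * τ)) (‖p.2‖ ^ 2) * G p) (volume.prod volume) := by
      refine hGi.bdd_mul (c := 1) ?_ (ae_of_all _ fun p => ?_)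
      · unfold evolution
        exact Continuous.aestronglyMeasurable (by fun_prop)
      · rw [norm_mul, norm_evolution, norm_evolution, one_mul]
    have h2 := integral_shell hd hGe
    rw [integral_prod _ (integrable_shell hd hGe)] at h2
    rw [hEdef, Measure.volume_eq_prod]
    simp only
    rw [← h2, Real.fourier_real_eq_integral_exp_smul]
    refine integral_congr_ae (ae_of_all _ fun δ => ?_)
    simp only
    rw [hh, smul_eq_mul, ← integral_const_mul]
    refine integral_congr_ae (ae_of_all _ fun y => ?_)
    simp only
    rcases le_total 0 (‖y.1‖ ^ 2 + δ) with h0 | h0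
    · have hn : ‖√(‖y.1‖ ^ 2 + δ) • (y.2 : Space d)‖ ^ 2 = ‖y.1‖ ^ 2 + δ := by
        rw [norm_smul, Real.norm_of_nonneg (Real.sqrt_nonneg _)]
        simp [Real.sq_sqrt h0]
      simp only [shellPoint]
      rw [hn, evolution, evolution, ← Complex.exp_add, mul_left_comm]
      congr 3
      push_cast
      ring
    -- Here `shellPoint` does not have energy transfer δ, but such points carry no weight.
    · have : shellDensity (δ, y) = 0 := by
        simp only [shellDensity]
        rw [Real.sqrt_eq_zero_of_nonpos h0, zero_pow (by omega), zero_div]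
      simp [this]
  -- Inversion at the single point 0 needs continuity there. Domination is required only for |δ| ≤
  -- 1, which is why `ShellDominated` is stated near the shell.
  have hc : ContinuousAt h 0 := by
    refine continuousAt_of_dominated (bound := fun y => b y.1) (Eventually.of_forall fun δ => ?_)
      ?_ hb.integrable_bound (ae_of_all _ fun y => ?_)
    · have h1 := continuous_shellDensity.comp (Continuous.prodMk_right δ :
        Continuous fun y : Space d × UnitSphere d => (δ, y))
      have h2 := hG.comp (continuous_shellPoint.comp (Continuous.prodMk_right δ :
        Continuous fun y : Space d × UnitSphere d => (δ, y)))
      exact ((continuous_ofReal.comp h1).mul h2).aestronglyMeasurable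
    · filter_upwards [Metric.closedBall_mem_nhds (0 : ℝ) one_pos] with δ hδ
      exact ae_of_all _ fun y => hb.norm_le (by simpa using hδ) y
    · have h1 := continuous_shellDensity.comp (Continuous.prodMk_left y :
        Continuous fun δ : ℝ => (δ, y))
      have h2 := hG.comp (continuous_shellPoint.comp (Continuous.prodMk_left y :
        Continuous fun δ : ℝ => (δ, y)))
      exact ((continuous_ofReal.comp h1).mul h2).continuousAt
  have hFi : Integrable (𝓕 h) := by
    rw [hF]
    exact hE.comp_mul_left' (by have := Real.pi_ne_zero; simp [this])
  -- At frequency 0 the inverse transform is the plain integral of `𝓕 h`; rescaling time gives the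
  -- factor 2π.
  have hinv := hint.fourierInv_fourier_eq hFi hc
  rw [hF, Real.fourierInv_eq'] at hinv
  simp only [inner_zero_right, mul_zero, ofReal_zero, zero_mul, Complex.exp_zero, one_smul] at hinv
  rw [Measure.integral_comp_mul_left] at hinv
  have h0 : h 0 = ∫ p, G p ∂(energyShell d) := by
    rw [integral_energyShell hG.aestronglyMeasurable, hh]
    simp only [Complex.real_smul]
  rw [← h0, ← hinv, abs_inv, Complex.real_smul]
  have : |(-2 * Real.pi)| = 2 * Real.pi := by
    rw [abs_mul, abs_of_pos Real.pi_pos]; norm_num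
  rw [this]
  have := Real.pi_ne_zero
  push_cast
  field_simp

end Junction
end


noncomputable section

namespace Junction

variable {d : ℕ}

/-! ### The current and the resistance as integrals over the energy shell -/

theorem ae_energyShell_norm_eq : ∀ᵐ p ∂(energyShell d), ‖p.2‖ = ‖p.1‖ := by
  rw [energyShell_eq, ae_map_iff continuous_shellPoint_zero.measurable.aemeasurable
    (measurableSet_eq_fun (by fun_prop) (by fun_prop))]
  refine ae_of_all _ fun y => ?_
  simp [shellPoint, norm_smul]

theorem fermi_le_exp (β μ ω : ℝ) : fermi β μ ω ≤ Real.exp (β * μ) * Real.exp (-(β * ω)) := by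
  rw [fermi, ← Real.exp_add, show β * μ + -(β * ω) = -(β * (ω - μ)) by ring, Real.exp_neg]
  exact inv_anti₀ (Real.exp_pos _) (by linarith)

theorem pow_mul_exp_le {β x : ℝ} (hβ : 0 < β) (hx : 0 ≤ x) (n : ℕ) :
    (x + 2) ^ n * Real.exp (-(β * x)) ≤
      n.factorial * (2 / β) ^ n * Real.exp β * Real.exp (-(β / 2 * x)) := by
  have h := Real.pow_div_factorial_le_exp (β / 2 * (x + 2)) (by positivity) n
  rw [div_le_iff₀ (by positivity), mul_pow] at h
  have h1 : (x + 2) ^ n ≤ n.factorial * (2 / β) ^ n * Real.exp (β / 2 * (x + 2)) := by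
    have e : (2 / β) ^ n * (β / 2) ^ n = 1 := by
      rw [← mul_pow]; field_simp; simp
    calc (x + 2) ^ n = (2 / β) ^ n * ((β / 2) ^ n * (x + 2) ^ n) := by rw [← mul_assoc, e, one_mul]
      _ ≤ (2 / β) ^ n * (Real.exp (β / 2 * (x + 2)) * n.factorial) := by gcongr
      _ = _ := by ring
  calc _ ≤ n.factorial * (2 / β) ^ n * Real.exp (β / 2 * (x + 2)) * Real.exp (-(β * x)) := by gcongr
    _ = _ := by
      rw [mul_assoc _ (Real.exp _) (Real.exp _), mul_assoc _ (Real.exp _) (Real.exp _),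
        ← Real.exp_add, ← Real.exp_add]
      ring_nf

theorem integrable_exp_neg_norm_sq {b : ℝ} (hb : 0 < b) :
    Integrable fun k : Space d => Real.exp (-(b * ‖k‖ ^ 2)) := by
  have h := (GaussianFourier.integrable_cexp_neg_mul_sq_norm_add (b := (b : ℂ))
    (by simpa using hb) 0 (0 : Space d)).norm
  refine h.congr (ae_of_all _ fun k => ?_)
  simp only [Complex.norm_exp]
  congr 1
  rw [zero_mul, add_zero, neg_mul, Complex.neg_re, ← ofReal_pow, ← ofReal_mul, ofReal_re]

/-- The integrand of the stationary current. -/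
def currentIntegrand (w : Kernel d 1) (β μ₁ μ₂ : ℝ) (p : Space d × Space d) : ℂ :=
  ((fermi β μ₂ (‖p.1‖ ^ 2) - fermi β μ₁ (‖p.2‖ ^ 2) : ℝ) : ℂ) *
    (‖transmission w p.1 p.2‖ ^ 2 : ℝ)

/-- Exponential decay of the Fermi functions beats the polynomial growth of the shell density.
Moving from |l|² to |k|² within the unit neighbourhood of the shell costs the factor e^β. -/
theorem exists_shellDominated {w : Kernel d 1} (hw : WeightedSobolev w) {β : ℝ} (hβ : 0 < β)
    (μ₁ μ₂ : ℝ) : ∃ b, ShellDominated (currentIntegrand w β μ₁ μ₂) b := by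
  obtain ⟨M, hM0, hM⟩ := (isHermiteSeries_transmission hw).exists_norm_le
  set D := d.factorial * (2 / β) ^ d * Real.exp β with hD
  set A := Real.exp (β * μ₂) + Real.exp (β * μ₁) * Real.exp β with hA
  have hD0 : 0 ≤ D := by positivity
  have hA0 : 0 ≤ A := by positivity
  refine ⟨fun k => A * M ^ 2 * D * Real.exp (-(β / 2 * ‖k‖ ^ 2)),
    (integrable_exp_neg_norm_sq (by positivity)).const_mul _, fun k => by positivity,
    fun k l hkl => ?_⟩
  rw [abs_le] at hkl
  have h1 : ‖l‖ ^ (d - 2) ≤ (‖k‖ ^ 2 + 2) ^ d := by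
    have e1 : ‖l‖ ≤ ‖k‖ ^ 2 + 2 := by nlinarith [sq_nonneg (‖l‖ - 1)]
    calc ‖l‖ ^ (d - 2) ≤ (‖k‖ ^ 2 + 2) ^ (d - 2) := by gcongr
      _ ≤ _ := pow_le_pow_right₀ (by nlinarith [sq_nonneg ‖k‖]) (by omega)
  have h2 : ‖currentIntegrand w β μ₁ μ₂ (k, l)‖ ≤ A * Real.exp (-(β * ‖k‖ ^ 2)) * M ^ 2 := by
    rw [currentIntegrand, norm_mul, norm_real, norm_real, Real.norm_of_nonneg
      (sq_nonneg ‖transmission w _ _‖), Real.norm_eq_abs]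
    have e1 : |fermi β μ₂ (‖k‖ ^ 2) - fermi β μ₁ (‖l‖ ^ 2)| ≤
        fermi β μ₂ (‖k‖ ^ 2) + fermi β μ₁ (‖l‖ ^ 2) := by
      rw [abs_le]
      constructor <;> linarith [fermi_pos β μ₂ (‖k‖ ^ 2), fermi_pos β μ₁ (‖l‖ ^ 2)]
    have e2 := fermi_le_exp β μ₂ (‖k‖ ^ 2)
    have e3 := fermi_le_exp β μ₁ (‖l‖ ^ 2)
    have e4 : Real.exp (-(β * ‖l‖ ^ 2)) ≤ Real.exp β * Real.exp (-(β * ‖k‖ ^ 2)) := by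
      rw [← Real.exp_add, Real.exp_le_exp]
      nlinarith
    have e5 := mul_le_mul_of_nonneg_left e4 (Real.exp_pos (β * μ₁)).le
    have e6 := hM k l
    refine mul_le_mul ?_ (by gcongr) (by positivity) (by positivity)
    rw [hA]
    simp only
    linarith
  calc _ ≤ (‖k‖ ^ 2 + 2) ^ d * (A * Real.exp (-(β * ‖k‖ ^ 2)) * M ^ 2) := by gcongr
    _ = A * M ^ 2 * ((‖k‖ ^ 2 + 2) ^ d * Real.exp (-(β * ‖k‖ ^ 2))) := by ring
    _ ≤ A * M ^ 2 * (D * Real.exp (-(β / 2 * ‖k‖ ^ 2))) :=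
        mul_le_mul_of_nonneg_left (pow_mul_exp_le hβ (by positivity) d) (by positivity)
    _ = _ := by ring

theorem continuous_transmission {w : Kernel d 1} (hw : WeightedSobolev w) :
    Continuous fun p : Space d × Space d => transmission w p.1 p.2 :=
  (isHermiteSeries_transmission hw).continuous

theorem continuous_currentIntegrand {w : Kernel d 1} (hw : WeightedSobolev w) (β μ₁ μ₂ : ℝ) :
    Continuous (currentIntegrand w β μ₁ μ₂) := by
  have h1 := continuous_transmission hw
  have h2 := continuous_fermi β μ₁
  have h3 := continuous_fermi β μ₂
  unfold currentIntegrand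
  fun_prop

theorem norm_currentIntegrand_le (w : Kernel d 1) (β μ₁ μ₂ : ℝ) (p : Space d × Space d) :
    ‖currentIntegrand w β μ₁ μ₂ p‖ ≤ ‖transmission w p.1 p.2‖ ^ 2 := by
  rw [currentIntegrand, norm_mul, norm_real, norm_real,
    Real.norm_of_nonneg (sq_nonneg ‖transmission w p.1 p.2‖), Real.norm_eq_abs]
  refine mul_le_of_le_one_left (by positivity) ?_
  rw [abs_le]
  constructor <;> linarith [fermi_pos β μ₁ (‖p.2‖ ^ 2), fermi_pos β μ₂ (‖p.1‖ ^ 2),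
    fermi_le_one β μ₁ (‖p.2‖ ^ 2), fermi_le_one β μ₂ (‖p.1‖ ^ 2)]

theorem correlation_eq_integral (w : Kernel d 1) (β μ₁ μ₂ s : ℝ) :
    correlation (fun _ => β) (Reservoir.pick μ₁ μ₂) w s = ∫ p : Space d × Space d,
      evolution s (‖p.1‖ ^ 2) * evolution (-s) (‖p.2‖ ^ 2) * currentIntegrand w β μ₁ μ₂ p := by
  rw [correlation]
  refine integral_congr_ae (ae_of_all _ fun p => ?_)
  simp only [Reservoir.pick, currentIntegrand]
  ring

/-- The current in the energy representation. -/
theorem integral_correlation (hd : 3 ≤ d) {w : Kernel d 1} (hw : WeightedSobolev w) {β : ℝ}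
    (hβ : 0 < β) (μ₁ μ₂ : ℝ) :
    ∫ s, correlation (fun _ => β) (Reservoir.pick μ₁ μ₂) w s =
      ((2 * Real.pi * ∫ p, (fermi β μ₂ (‖p.1‖ ^ 2) - fermi β μ₁ (‖p.1‖ ^ 2)) *
        ‖transmission w p.1 p.2‖ ^ 2 ∂(energyShell d) : ℝ) : ℂ) := by
  obtain ⟨b, hb⟩ := exists_shellDominated hw hβ μ₁ μ₂
  have hG := continuous_currentIntegrand hw β μ₁ μ₂
  have hc := integrable_correlation (fun _ => β) (Reservoir.pick μ₁ μ₂) hd hw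
  simp only [funext (correlation_eq_integral w β μ₁ μ₂)] at hc ⊢
  rw [integral_evolution_eq_energyShell hd hG ((isHermiteSeries_transmission hw).integrable_sq.mono'
    hG.aestronglyMeasurable (ae_of_all _ (norm_currentIntegrand_le w β μ₁ μ₂))) hb hc]
  push_cast
  rw [← integral_complex_ofReal]
  congr 1
  refine integral_congr_ae ?_
  filter_upwards [ae_energyShell_norm_eq] with p hp
  rw [currentIntegrand, hp]
  push_cast
  rfl

/-- The square of the transmission amplitude is integrable over the energy shell. -/
theorem integrable_transmission_sq (hd : 3 ≤ d) {w : Kernel d 1} (hw : WeightedSobolev w) :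
    Integrable (fun p => ‖transmission w p.1 p.2‖ ^ 2) (energyShell d) := by
  have hT := continuous_transmission hw
  obtain ⟨C, hC0, hC⟩ := exists_norm_correlation_le hw
  set B : ℝ := C * ∫ s : ℝ, min 1 (|s| ^ (-((d : ℝ) / 2))) with hB
  -- Reservoirs at β = 1 with chemical potentials -n and n. The current they drive has a nonnegative
  -- integrand on the energy shell.
  have hint : ∀ n : ℕ, Integrable (fun p => (fermi 1 n (‖p.1‖ ^ 2) - fermi 1 (-n) (‖p.1‖ ^ 2)) *
      ‖transmission w p.1 p.2‖ ^ 2) (energyShell d) := fun n => by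
    obtain ⟨b, hb⟩ := exists_shellDominated hw one_pos (-n) n
    have h1 := hb.integrable (continuous_currentIntegrand hw 1 (-n) n)
    have h2 := h1.re
    refine h2.congr ?_
    filter_upwards [ae_energyShell_norm_eq] with p hp
    rw [currentIntegrand, hp, ← ofReal_mul]
    rfl
  have hnn : ∀ (n : ℕ) (p : Space d × Space d),
      0 ≤ (fermi 1 n (‖p.1‖ ^ 2) - fermi 1 (-n) (‖p.1‖ ^ 2)) * ‖transmission w p.1 p.2‖ ^ 2 :=
    fun n p => by
    refine mul_nonneg (sub_nonneg.2 ?_) (by positivity)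
    unfold fermi
    gcongr
    linarith [(Nat.cast_nonneg n : (0 : ℝ) ≤ n)]
  -- The shell integral, times 2π, is the time integral of a correlation, which
  -- `exists_norm_correlation_le` bounds by `B` for every n; the factor 2π is simply dropped.
  have hbound : ∀ n : ℕ, ∫⁻ p, ‖(fermi 1 n (‖p.1‖ ^ 2) - fermi 1 (-n) (‖p.1‖ ^ 2)) *
      ‖transmission w p.1 p.2‖ ^ 2‖ₑ ∂(energyShell d) ≤ ENNReal.ofReal B := fun n => by
    rw [← ofReal_integral_norm_eq_lintegral_enorm (hint n)]
    refine ENNReal.ofReal_le_ofReal ?_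
    have e1 : ∫ p, ‖(fermi 1 n (‖p.1‖ ^ 2) - fermi 1 (-n) (‖p.1‖ ^ 2)) *
        ‖transmission w p.1 p.2‖ ^ 2‖ ∂(energyShell d) =
        ∫ p, (fermi 1 n (‖p.1‖ ^ 2) - fermi 1 (-n) (‖p.1‖ ^ 2)) *
        ‖transmission w p.1 p.2‖ ^ 2 ∂(energyShell d) :=
      integral_congr_ae (ae_of_all _ fun p => Real.norm_of_nonneg (hnn n p))
    rw [e1]
    set X := ∫ p, (fermi 1 n (‖p.1‖ ^ 2) - fermi 1 (-n) (‖p.1‖ ^ 2)) *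
        ‖transmission w p.1 p.2‖ ^ 2 ∂(energyShell d) with hX
    have hX0 : 0 ≤ X := integral_nonneg (hnn n)
    have h2 := integral_correlation hd hw one_pos (-n) n
    rw [← hX] at h2
    have h3 : ‖∫ s, correlation (fun _ => 1) (Reservoir.pick (-n : ℝ) n) w s‖ ≤ B := by
      rw [hB, ← integral_const_mul]
      refine norm_integral_le_of_norm_le ((integrable_min_rpow hd).const_mul C) ?_
      filter_upwards [compl_mem_ae_iff.2 (measure_singleton (0 : ℝ))] with s hs
      exact hC _ _ s hs
    rw [h2, norm_real, Real.norm_of_nonneg (by have := Real.pi_pos; positivity)] at h3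
    nlinarith [Real.pi_gt_three]
  have hlim : ∀ p : Space d × Space d, Tendsto (fun n : ℕ =>
      (fermi 1 n (‖p.1‖ ^ 2) - fermi 1 (-n) (‖p.1‖ ^ 2)) * ‖transmission w p.1 p.2‖ ^ 2) atTop
      (𝓝 (‖transmission w p.1 p.2‖ ^ 2)) := fun p => by
    have hn : Tendsto (fun n : ℕ => (n : ℝ)) atTop atTop := tendsto_natCast_atTop_atTop
    have e1 : Tendsto (fun n : ℕ => fermi 1 n (‖p.1‖ ^ 2)) atTop (𝓝 1) := by
      have h1 : Tendsto (fun n : ℕ => Real.exp (1 * (‖p.1‖ ^ 2 - n))) atTop (𝓝 0) := by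
        refine Real.tendsto_exp_atBot.comp ?_
        simp only [one_mul]
        exact tendsto_const_nhds.add_atBot (tendsto_neg_atTop_atBot.comp hn)
      have h2 := (h1.add_const 1).inv₀ (by norm_num)
      simpa [fermi] using h2
    have e2 : Tendsto (fun n : ℕ => fermi 1 (-n) (‖p.1‖ ^ 2)) atTop (𝓝 0) := by
      refine Tendsto.inv_tendsto_atTop ?_
      refine tendsto_atTop_add_const_right _ _ (Real.tendsto_exp_atTop.comp ?_)
      simp only [one_mul, sub_neg_eq_add]
      exact tendsto_atTop_add_const_left _ _ hn
    simpa using (e1.sub e2).mul_const (‖transmission w p.1 p.2‖ ^ 2)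
  refine ⟨(hT.norm.pow 2).aestronglyMeasurable, ?_⟩
  -- Fatou's lemma: the difference of the Fermi functions tends to 1 pointwise, and the bound `B`
  -- passes to the limit.
  have h1 : ∫⁻ p, ‖‖transmission w p.1 p.2‖ ^ 2‖ₑ ∂(energyShell d) ≤ ENNReal.ofReal B := by
    calc _ = ∫⁻ p, liminf (fun n : ℕ => ‖(fermi 1 n (‖p.1‖ ^ 2) - fermi 1 (-n) (‖p.1‖ ^ 2)) *
          ‖transmission w p.1 p.2‖ ^ 2‖ₑ) atTop ∂(energyShell d) :=
          lintegral_congr fun p => (hlim p).enorm.liminf_eq.symm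
      _ ≤ liminf (fun n : ℕ => ∫⁻ p, ‖(fermi 1 n (‖p.1‖ ^ 2) - fermi 1 (-n) (‖p.1‖ ^ 2)) *
          ‖transmission w p.1 p.2‖ ^ 2‖ₑ ∂(energyShell d)) atTop :=
          lintegral_liminf_le' fun n => (hint n).aestronglyMeasurable.enorm
      _ ≤ liminf (fun _ : ℕ => ENNReal.ofReal B) atTop :=
          liminf_le_liminf (Eventually.of_forall hbound)
      _ = _ := liminf_const _
  exact h1.trans_lt ENNReal.ofReal_lt_top

/-- The thermal broadening function, the negative of the derivative of the Fermi function. -/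
def thermal (x : ℝ) : ℝ := Real.exp x / (Real.exp x + 1) ^ 2

theorem thermal_pos (x : ℝ) : 0 < thermal x := by unfold thermal; positivity

theorem thermal_le (x : ℝ) : thermal x ≤ 1 / 4 := by
  rw [thermal, div_le_div_iff₀ (by positivity) (by norm_num)]
  nlinarith [sq_nonneg (Real.exp x - 1)]

theorem continuous_thermal : Continuous thermal := by
  unfold thermal
  exact Continuous.div₀ (by fun_prop) (by fun_prop) fun x => by positivity

theorem resistanceIntegrand_eq (w : Kernel d 1) (μ β : ℝ) (p : Space d × Space d) :
    resistanceIntegrand w μ β p =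
      thermal (β * (‖p.1‖ ^ 2 - μ)) * ‖transmission w p.1 p.2‖ ^ 2 := by
  rw [resistanceIntegrand, thermal, transmission]
  ring

theorem continuous_resistanceIntegrand {w : Kernel d 1} (hw : WeightedSobolev w) (μ β : ℝ) :
    Continuous (resistanceIntegrand w μ β) := by
  rw [funext (resistanceIntegrand_eq w μ β)]
  have h1 := continuous_transmission hw
  have h2 := continuous_thermal
  fun_prop

theorem integrable_resistanceIntegrand (hd : 3 ≤ d) {w : Kernel d 1} (hw : WeightedSobolev w)
    (μ β : ℝ) : Integrable (resistanceIntegrand w μ β) (energyShell d) := by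
  refine (integrable_transmission_sq hd hw).mono'
    (continuous_resistanceIntegrand hw μ β).aestronglyMeasurable (ae_of_all _ fun p => ?_)
  rw [resistanceIntegrand_eq, Real.norm_of_nonneg
    (mul_nonneg (thermal_pos _).le (by positivity))]
  exact mul_le_of_le_one_left (by positivity) ((thermal_le _).trans (by norm_num))

end Junction
end


noncomputable section

namespace Junction

variable {d : ℕ}

/-! ### Ohm's law and the limit of high temperature -/

theorem hasDerivAt_inv_exp_add_one (x : ℝ) :
    HasDerivAt (fun x : ℝ => (Real.exp x + 1)⁻¹) (-thermal x) x := by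
  have h := ((Real.hasDerivAt_exp x).add_const 1).fun_inv (by positivity)
  convert! h using 1
  rw [thermal]
  ring

theorem hasDerivAt_thermal (x : ℝ) :
    HasDerivAt thermal (Real.exp x * (1 - Real.exp x) / (Real.exp x + 1) ^ 3) x := by
  have h := (Real.hasDerivAt_exp x).fun_div (((Real.hasDerivAt_exp x).add_const 1).fun_pow 2)
    (by positivity)
  convert! h using 1
  field_simp
  ring

theorem abs_deriv_thermal_le (x : ℝ) :
    |Real.exp x * (1 - Real.exp x) / (Real.exp x + 1) ^ 3| ≤ 1 := by
  have h := Real.exp_pos x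
  rw [abs_div, abs_of_pos (by positivity : 0 < (Real.exp x + 1) ^ 3), div_le_one (by positivity),
    abs_le]
  constructor <;> nlinarith [mul_pos h h, mul_pos (mul_pos h h) h]

/-- The Lipschitz bound makes the Taylor remainder of the Fermi function quadratic uniformly in the
energy, so it can be integrated against |τ|² alone. -/
theorem abs_thermal_sub_le (x y : ℝ) : |thermal x - thermal y| ≤ |x - y| := by
  have h := Convex.norm_image_sub_le_of_norm_hasDerivWithin_le (f := thermal) (s := Set.univ)
    (C := 1) (fun x _ => (hasDerivAt_thermal x).hasDerivWithinAt)
    (fun x _ => by rw [Real.norm_eq_abs]; exact abs_deriv_thermal_le x) convex_univ (Set.mem_univ y)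
    (Set.mem_univ x)
  simpa using h

/-- The Taylor formula of first order for the Fermi function. -/
theorem abs_inv_exp_add_one_taylor (y h : ℝ) :
    |(Real.exp (y - h) + 1)⁻¹ - (Real.exp y + 1)⁻¹ - h * thermal y| ≤ h ^ 2 := by
  have hd : ∀ t : ℝ, HasDerivAt
      (fun t : ℝ => (Real.exp (y - t) + 1)⁻¹ - (Real.exp y + 1)⁻¹ - t * thermal y)
      (thermal (y - t) - thermal y) t := fun t => by
    have h1 := (hasDerivAt_inv_exp_add_one (y - t)).comp t ((hasDerivAt_id t).const_sub y)
    have h2 := (h1.sub_const ((Real.exp y + 1)⁻¹)).fun_sub ((hasDerivAt_id t).mul_const (thermal y))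
    convert! h2 using 1
    simp
  have h := Convex.norm_image_sub_le_of_norm_hasDerivWithin_le (s := Set.Icc (-|h|) |h|)
    (C := |h|) (fun x _ => (hd x).hasDerivWithinAt) (fun x hx => by
      rw [Real.norm_eq_abs]
      refine (abs_thermal_sub_le _ _).trans ?_
      rw [abs_le]
      constructor <;> linarith [hx.1, hx.2]) (convex_Icc _ _)
    (show (0 : ℝ) ∈ Set.Icc (-|h|) |h| by simp)
    (show h ∈ Set.Icc (-|h|) |h| from ⟨neg_abs_le h, le_abs_self h⟩)
  simpa [← pow_two] using h

theorem abs_fermi_taylor (β μ Δ ω : ℝ) :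
    |fermi β (μ + Δ) ω - fermi β μ ω - Δ * β * thermal (β * (ω - μ))| ≤ β ^ 2 * Δ ^ 2 := by
  have h := abs_inv_exp_add_one_taylor (β * (ω - μ)) (Δ * β)
  rw [show β * (ω - μ) - Δ * β = β * (ω - (μ + Δ)) by ring] at h
  refine h.trans (le_of_eq ?_)
  ring

/-- The stationary current of second order. -/
def stationaryCurrent (w : Kernel d 1) (β μ Δ : ℝ) : ℝ :=
  2 * Real.pi * ∫ p, (fermi β (μ + Δ) (‖p.1‖ ^ 2) - fermi β μ (‖p.1‖ ^ 2)) *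
    ‖transmission w p.1 p.2‖ ^ 2 ∂(energyShell d)

theorem isCurrentTerm_stationaryCurrent (hd : 3 ≤ d) {w : (N : ℕ) → Kernel d N}
    (hw : WeightedSobolev (w 1)) (hw' : HermitianKernel (w 1)) {β : ℝ} (hβ : 0 < β) (μ Δ : ℝ) :
    IsCurrentTerm (fun _ => β) (Reservoir.pick μ (μ + Δ)) w 2 2
      (stationaryCurrent (w 1) β μ Δ) := by
  have h := tendsto_expect_dysonCurrent (fun _ => β) (Reservoir.pick μ (μ + Δ)) hd hw hw'
  rwa [integral_correlation hd hw hβ] at h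

theorem integrable_fermi_sub_mul (hd : 3 ≤ d) {w : Kernel d 1} (hw : WeightedSobolev w)
    (β μ₁ μ₂ : ℝ) : Integrable (fun p => (fermi β μ₂ (‖p.1‖ ^ 2) - fermi β μ₁ (‖p.1‖ ^ 2)) *
      ‖transmission w p.1 p.2‖ ^ 2) (energyShell d) := by
  have h1 := continuous_fermi β μ₁
  have h2 := continuous_fermi β μ₂
  refine (integrable_transmission_sq hd hw).bdd_mul (c := 1)
    (Continuous.aestronglyMeasurable (by fun_prop)) (ae_of_all _ fun p => ?_)
  rw [Real.norm_eq_abs, abs_le]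
  constructor <;> linarith [fermi_pos β μ₁ (‖p.1‖ ^ 2), fermi_pos β μ₂ (‖p.1‖ ^ 2),
    fermi_le_one β μ₁ (‖p.1‖ ^ 2), fermi_le_one β μ₂ (‖p.1‖ ^ 2)]

/-- The term linear in Δ is exactly Δ divided by the resistance. The remainder is at most β²Δ²
pointwise, and |τ|² is integrable on the shell, so the estimate holds for all Δ and not only near 0.
-/
theorem ohm (hd : 3 ≤ d) {w : Kernel d 1} (hw : WeightedSobolev w) (β μ : ℝ) :
    (fun Δ : ℝ => stationaryCurrent w β μ Δ - Δ / resistance w μ β) =O[𝓝 0]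
      fun Δ : ℝ => Δ ^ 2 := by
  refine Asymptotics.IsBigO.of_bound
    (2 * Real.pi * (β ^ 2 * ∫ p, ‖transmission w p.1 p.2‖ ^ 2 ∂(energyShell d)))
    (Eventually.of_forall fun Δ => ?_)
  have e : stationaryCurrent w β μ Δ - Δ / resistance w μ β = 2 * Real.pi *
      ∫ p, (fermi β (μ + Δ) (‖p.1‖ ^ 2) - fermi β μ (‖p.1‖ ^ 2) -
        Δ * β * thermal (β * (‖p.1‖ ^ 2 - μ))) * ‖transmission w p.1 p.2‖ ^ 2 ∂(energyShell d) := by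
    have h1 : ∀ p : Space d × Space d, (fermi β (μ + Δ) (‖p.1‖ ^ 2) - fermi β μ (‖p.1‖ ^ 2) -
        Δ * β * thermal (β * (‖p.1‖ ^ 2 - μ))) * ‖transmission w p.1 p.2‖ ^ 2 =
        (fermi β (μ + Δ) (‖p.1‖ ^ 2) - fermi β μ (‖p.1‖ ^ 2)) * ‖transmission w p.1 p.2‖ ^ 2 -
        Δ * β * resistanceIntegrand w μ β p := fun p => by
      rw [resistanceIntegrand_eq]; ring
    simp_rw [h1]
    rw [integral_sub (integrable_fermi_sub_mul hd hw β μ (μ + Δ))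
      ((integrable_resistanceIntegrand hd hw μ β).const_mul _), integral_const_mul,
      stationaryCurrent, resistance, div_inv_eq_mul]
    ring
  rw [e, norm_mul, Real.norm_of_nonneg (by have := Real.pi_pos; positivity : 0 ≤ 2 * Real.pi),
    mul_assoc (2 * Real.pi), Real.norm_of_nonneg (sq_nonneg Δ), mul_right_comm (β ^ 2)]
  refine mul_le_mul_of_nonneg_left ?_ (by have := Real.pi_pos; positivity)
  rw [← integral_const_mul]
  refine norm_integral_le_of_norm_le ((integrable_transmission_sq hd hw).const_mul _)
    (ae_of_all _ fun p => ?_)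
  rw [norm_mul, Real.norm_of_nonneg (sq_nonneg ‖transmission w p.1 p.2‖), Real.norm_eq_abs]
  exact mul_le_mul_of_nonneg_right (abs_fermi_taylor β μ Δ _) (by positivity)

theorem integral_energyShell_pos (hd : 3 ≤ d) {F : Space d × Space d → ℝ} (hF : Continuous F)
    (hF0 : ∀ p, 0 ≤ F p) (hFi : Integrable F (energyShell d)) {k l : Space d}
    (hkl : ‖k‖ = ‖l‖) (hp : F (k, l) ≠ 0) : 0 < ∫ p, F p ∂(energyShell d) := by
  have : Nonempty (Fin d) := ⟨⟨0, by omega⟩⟩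
  have hi := (integrable_energyShell_iff hF.aestronglyMeasurable).1 hFi
  rw [integral_energyShell hF.aestronglyMeasurable, integral_pos_iff_support_of_nonneg
    (fun y => smul_nonneg (shellDensity_nonneg _) (hF0 _)) hi]
  set U : Set (Space d × UnitSphere d) := {y | F (shellPoint (0, y)) ≠ 0} with hU
  have hUo : IsOpen U := isOpen_ne_fun (hF.comp continuous_shellPoint_zero) continuous_const
  have hUn : U.Nonempty := by
    -- At k = 0 there is no direction l/|k|, but l = 0 as well, and any point of the sphere will do.
    by_cases hk : k = 0
    · have hl : l = 0 := by rw [hk, norm_zero] at hkl; exact norm_eq_zero.1 hkl.symm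
      obtain ⟨θ, hθ⟩ := (NormedSpace.sphere_nonempty (E := Space d) (x := 0) (r := 1)).2 zero_le_one
      refine ⟨(k, ⟨θ, hθ⟩), ?_⟩
      have : shellPoint (0, ((k, ⟨θ, hθ⟩) : Space d × UnitSphere d)) = (k, l) := by
        simp [shellPoint, hk, hl]
      rw [hU, Set.mem_ofPred_eq, this]
      exact hp
    · have hk' : ‖k‖ ≠ 0 := norm_ne_zero_iff.2 hk
      refine ⟨(k, ⟨‖k‖⁻¹ • l, ?_⟩), ?_⟩
      · rw [mem_sphere_zero_iff_norm, norm_smul, norm_inv, norm_norm, ← hkl,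
          inv_mul_cancel₀ hk']
      · have : shellPoint (0, ((k, ⟨‖k‖⁻¹ • l, by
            rw [mem_sphere_zero_iff_norm, norm_smul, norm_inv, norm_norm, ← hkl,
              inv_mul_cancel₀ hk']⟩) : Space d × UnitSphere d)) = (k, l) := by
          simp [shellPoint, smul_smul, hk']
        rw [hU, Set.mem_ofPred_eq, this]
        exact hp
  -- The shell density vanishes at k = 0. This set is null, and removing it from a nonempty open set
  -- leaves positive measure.
  have hN : ((volume : Measure (Space d)).prod (sphereMeasure d)) ({0} ×ˢ Set.univ) = 0 := by
    rw [Measure.prod_prod]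
    simp
  have h1 : U \ ({0} ×ˢ Set.univ) ⊆ Function.support fun y : Space d × UnitSphere d =>
      shellDensity (0, y) • F (shellPoint (0, y)) := fun y hy => by
    have hy0 : y.1 ≠ 0 := fun h => hy.2 (by simp [h])
    refine smul_ne_zero ?_ hy.1
    have : 0 < ‖y.1‖ := norm_pos_iff.2 hy0
    simp only [shellDensity, add_zero, Real.sqrt_sq (norm_nonneg _)]
    positivity
  refine lt_of_lt_of_le ?_ (measure_mono h1)
  rw [measure_sdiff_null hN]
  exact hUo.measure_pos _ hUn

theorem resistance_pos (hd : 3 ≤ d) {w : Kernel d 1} (hw : WeightedSobolev w)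
    (hne : ∃ k l : Space d, ‖k‖ = ‖l‖ ∧ kernelFourier w .II .I k l ≠ 0) (μ : ℝ) {β : ℝ}
    (hβ : 0 < β) : 0 < resistance w μ β := by
  obtain ⟨k, l, hkl, h⟩ := hne
  have hi : 0 < ∫ p, resistanceIntegrand w μ β p ∂(energyShell d) := by
    refine integral_energyShell_pos hd (continuous_resistanceIntegrand hw μ β) (fun p => ?_)
      (integrable_resistanceIntegrand hd hw μ β) (k := -k) (l := l) (by rw [norm_neg, hkl]) ?_
    · rw [resistanceIntegrand_eq]
      have := thermal_pos (β * (‖p.1‖ ^ 2 - μ))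
      positivity
    · rw [resistanceIntegrand_eq]
      refine mul_ne_zero (thermal_pos _).ne' (pow_ne_zero _ (norm_ne_zero_iff.2 ?_))
      simpa [transmission] using h
  rw [resistance]
  have := Real.pi_pos
  positivity

/-- As β → 0 the thermal factor tends to its value 1/4 at the origin, dominated by |τ|². The
prefactor β = 1/T accounts for the linear growth. -/
theorem tendsto_resistance_div (hd : 3 ≤ d) {w : Kernel d 1} (hw : WeightedSobolev w)
    (hne : ∃ k l : Space d, ‖k‖ = ‖l‖ ∧ kernelFourier w .II .I k l ≠ 0) (μ : ℝ) :
    ∃ C : ℝ, 0 < C ∧ Tendsto (fun T : ℝ => resistance w μ (1 / T) / T) atTop (𝓝 C) := by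
  obtain ⟨k, l, hkl, h⟩ := hne
  have hT := continuous_transmission hw
  have hi : 0 < ∫ p, ‖transmission w p.1 p.2‖ ^ 2 ∂(energyShell d) := by
    refine integral_energyShell_pos hd (hT.norm.pow 2) (fun p => by positivity)
      (integrable_transmission_sq hd hw) (k := -k) (l := l) (by rw [norm_neg, hkl]) ?_
    refine pow_ne_zero _ (norm_ne_zero_iff.2 ?_)
    simpa [transmission] using h
  have h1 : Tendsto (fun T : ℝ => ∫ p, resistanceIntegrand w μ (1 / T) p ∂(energyShell d)) atTop
      (𝓝 (∫ p, 1 / 4 * ‖transmission w p.1 p.2‖ ^ 2 ∂(energyShell d))) := by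
    refine tendsto_integral_filter_of_dominated_convergence
      (fun p => ‖transmission w p.1 p.2‖ ^ 2)
      (Eventually.of_forall fun T =>
        (continuous_resistanceIntegrand hw μ (1 / T)).aestronglyMeasurable)
      (Eventually.of_forall fun T => ae_of_all _ fun p => ?_) (integrable_transmission_sq hd hw)
      (ae_of_all _ fun p => ?_)
    · rw [resistanceIntegrand_eq, Real.norm_of_nonneg
        (mul_nonneg (thermal_pos _).le (by positivity))]
      exact mul_le_of_le_one_left (by positivity) ((thermal_le _).trans (by norm_num))
    · simp only [resistanceIntegrand_eq]
      refine Tendsto.mul_const _ ?_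
      have h2 : Tendsto (fun T : ℝ => 1 / T * (‖p.1‖ ^ 2 - μ)) atTop (𝓝 0) := by
        simpa using tendsto_inv_atTop_zero.mul_const (‖p.1‖ ^ 2 - μ)
      have h3 := (continuous_thermal.tendsto 0).comp h2
      have h4 : thermal 0 = 1 / 4 := by norm_num [thermal]
      rwa [h4] at h3
  rw [integral_const_mul] at h1
  generalize ∫ p, ‖transmission w p.1 p.2‖ ^ 2 ∂(energyShell d) = X at h1 hi
  have hpi := Real.pi_pos
  refine ⟨(2 * Real.pi * (1 / 4 * X))⁻¹, by positivity, ?_⟩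
  refine ((h1.const_mul (2 * Real.pi)).inv₀ (by positivity)).congr' ?_
  filter_upwards [eventually_gt_atTop 0] with T hT
  rw [resistance]
  generalize ∫ p, resistanceIntegrand w μ (1 / T) p ∂(energyShell d) = Y
  rw [div_eq_mul_inv _ T, ← mul_inv]
  congr 1
  field_simp

end Junction
end


noncomputable section

namespace Junction

/-! ### The Sommerfeld expansion -/

/-- Continuous functions that decay at least like `x⁻⁴`. -/
structure QuarticDecay (κ : ℝ → ℝ) (C : ℝ) : Prop where
  continuous : Continuous κ
  bound : ∀ x, |κ x| * (1 + x ^ 2) ^ 2 ≤ C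

namespace QuarticDecay

variable {κ : ℝ → ℝ} {C : ℝ}

theorem nonneg (h : QuarticDecay κ C) : 0 ≤ C :=
  (by positivity : 0 ≤ |κ 0| * (1 + (0 : ℝ) ^ 2) ^ 2).trans (h.bound 0)

theorem abs_mul_le (h : QuarticDecay κ C) {y : ℝ} (x : ℝ) (hy : |y| ≤ 1 + x ^ 2) :
    |y * κ x| ≤ C * (1 + x ^ 2)⁻¹ := by
  rw [← div_eq_mul_inv, le_div_iff₀ (by positivity), abs_mul]
  refine le_trans ?_ (h.bound x)
  calc _ ≤ (1 + x ^ 2) * |κ x| * (1 + x ^ 2) := by gcongr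
    _ = _ := by ring

theorem abs_pow_le {j : ℕ} (hj : j ≤ 2) (x : ℝ) : |x ^ j| ≤ 1 + x ^ 2 := by
  have h0 := abs_nonneg x
  have h1 := sq_abs x
  interval_cases j
  · simp; positivity
  · rw [pow_one]; nlinarith [sq_nonneg (|x| - 1)]
  · rw [abs_pow, h1]; linarith

theorem integrable_pow_mul (h : QuarticDecay κ C) {j : ℕ} (hj : j ≤ 2) :
    Integrable fun x => x ^ j * κ x := by
  have := h.continuous
  exact (integrable_inv_one_add_sq.const_mul C).mono' (Continuous.aestronglyMeasurable (by fun_prop))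
    (ae_of_all _ fun x => h.abs_mul_le x (abs_pow_le hj x))

theorem integrable_comp_mul (h : QuarticDecay κ C) {F : ℝ → ℝ} (hF : Integrable F) (μ : ℝ) {T : ℝ}
    (hT : 0 < T) : Integrable fun x => F (μ + T * x) * κ x := by
  have h1 : Integrable fun x => F (μ + T * x) := (hF.comp_add_left μ).comp_mul_left' hT.ne'
  refine h1.mul_bdd (c := C) h.continuous.aestronglyMeasurable (ae_of_all _ fun x => ?_)
  rw [Real.norm_eq_abs]
  have h2 := h.bound x
  have h3 : (1 : ℝ) ≤ (1 + x ^ 2) ^ 2 := one_le_pow₀ (by nlinarith [sq_nonneg x])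
  nlinarith [abs_nonneg (κ x)]

/-- The contribution of the complement of a neighbourhood of `μ`. -/
theorem abs_integral_tail_le (h : QuarticDecay κ C) {F : ℝ → ℝ} (hF : Integrable F) (μ : ℝ)
    {δ T : ℝ} (hδ : 0 < δ) (hT : 0 < T) :
    |∫ x, (if |T * x| < δ then 0 else F (μ + T * x) * κ x)| ≤
      T ^ 3 * (C / δ ^ 4 * ∫ x, |F x|) := by
  have h1 : Integrable fun x => F (μ + T * x) := (hF.comp_add_left μ).comp_mul_left' hT.ne'
  have h2 : ∫ x, |F (μ + T * x)| = T⁻¹ * ∫ x, |F x| := by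
    rw [Measure.integral_comp_mul_left (fun y => |F (μ + y)|) T,
      integral_add_left_eq_self (fun y => |F y|) μ, abs_of_pos (by positivity), smul_eq_mul]
  -- Outside the neighbourhood |x| ≥ δ/T, so κ is at most C T⁴/δ⁴. The change of variables gives
  -- back one T, and T³ is still o(T²). Nothing but integrability of F is used.
  have h3 : |∫ x, (if |T * x| < δ then 0 else F (μ + T * x) * κ x)| ≤
      ∫ x, (C * T ^ 4 / δ ^ 4) * |F (μ + T * x)| := by
    rw [← Real.norm_eq_abs]
    refine norm_integral_le_of_norm_le (h1.abs.const_mul _) (ae_of_all _ fun x => ?_)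
    have hC := h.nonneg
    split_ifs with hx
    · rw [norm_zero]; positivity
    · rw [Real.norm_eq_abs, abs_mul, mul_comm]
      refine mul_le_mul_of_nonneg_right ?_ (abs_nonneg _)
      rw [le_div_iff₀ (by positivity)]
      have h4 : δ ^ 4 ≤ T ^ 4 * (1 + x ^ 2) ^ 2 := by
        rw [not_lt, abs_mul, abs_of_pos hT] at hx
        calc δ ^ 4 ≤ (T * |x|) ^ 4 := by gcongr
          _ = T ^ 4 * (x ^ 2) ^ 2 := by rw [mul_pow, ← sq_abs x]; ring
          _ ≤ _ := by gcongr; linarith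
      calc |κ x| * δ ^ 4 ≤ |κ x| * (T ^ 4 * (1 + x ^ 2) ^ 2) := by gcongr
        _ = |κ x| * (1 + x ^ 2) ^ 2 * T ^ 4 := by ring
        _ ≤ _ := by gcongr; exact h.bound x
  refine h3.trans (le_of_eq ?_)
  rw [integral_const_mul, h2]
  field_simp

/-- The asymptotic expansion of the averages of a function over small scales. -/
theorem isLittleO_integral (h : QuarticDecay κ C) {F : ℝ → ℝ} (hF : Integrable F) {μ a₀ a₁ a₂ : ℝ}
    (hT : (fun t => F (μ + t) - (a₀ + a₁ * t + a₂ * t ^ 2)) =o[𝓝 0] fun t => t ^ 2) :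
    (fun T : ℝ => (∫ x, F (μ + T * x) * κ x) - (a₀ * (∫ x, κ x) + a₁ * (∫ x, x * κ x) * T +
      a₂ * (∫ x, x ^ 2 * κ x) * T ^ 2)) =o[𝓝[>] 0] fun T => T ^ 2 := by
  obtain ⟨δ, hδ, hr⟩ : ∃ δ > 0, ∀ t : ℝ, |t| < δ →
      |F (μ + t) - (a₀ + a₁ * t + a₂ * t ^ 2)| ≤ t ^ 2 := by
    have := hT.def one_pos
    rw [Metric.eventually_nhds_iff] at this
    obtain ⟨δ, hδ, h⟩ := this
    refine ⟨δ, hδ, fun t ht => ?_⟩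
    have := h (y := t) (by simpa using ht)
    simpa using this
  -- Only F is cut off, the Taylor polynomial is not. Its integral then gives the exact moments of
  -- κ, and far from 0 the polynomial alone is bounded by a multiple of t².
  set r : ℝ → ℝ := fun t => (if |t| < δ then F (μ + t) else 0) - (a₀ + a₁ * t + a₂ * t ^ 2) with hr_def
  set D : ℝ := 1 + |a₀| / δ ^ 2 + |a₁| / δ + |a₂| with hD
  have hD0 : 0 ≤ D := by positivity
  have hrb : ∀ t, |r t| ≤ D * t ^ 2 := fun t => by
    by_cases ht : |t| < δ
    · simp only [hr_def, if_pos ht]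
      refine (hr t ht).trans (le_mul_of_one_le_left (sq_nonneg t) ?_)
      rw [hD]
      have : 0 ≤ |a₀| / δ ^ 2 + |a₁| / δ + |a₂| := by positivity
      linarith
    · simp only [hr_def, if_neg ht]
      rw [not_lt] at ht
      have e1 : |a₀| ≤ |a₀| / δ ^ 2 * t ^ 2 := by
        rw [div_mul_eq_mul_div, le_div_iff₀ (by positivity), ← sq_abs t]
        gcongr
      have e2 : |a₁| * |t| ≤ |a₁| / δ * t ^ 2 := by
        rw [div_mul_eq_mul_div, le_div_iff₀ (by positivity), ← sq_abs t, mul_assoc, pow_two]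
        gcongr
      have e3 : |0 - (a₀ + a₁ * t + a₂ * t ^ 2)| ≤ |a₀| + |a₁| * |t| + |a₂| * t ^ 2 := by
        rw [zero_sub, abs_neg]
        refine (abs_add_three _ _ _).trans ?_
        rw [abs_mul, abs_mul, abs_of_nonneg (sq_nonneg t)]
      refine e3.trans ?_
      rw [hD]
      nlinarith [sq_nonneg t]
  have hr0 : Tendsto (fun t => r t / t ^ 2) (𝓝[≠] 0) (𝓝 0) := by
    have h1 := (hT.mono (nhdsWithin_le_nhds (s := {0}ᶜ))).tendsto_div_nhds_zero
    refine h1.congr' ?_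
    have h2 : ∀ᶠ t : ℝ in 𝓝[≠] 0, |t| < δ := by
      refine nhdsWithin_le_nhds ?_
      filter_upwards [Metric.ball_mem_nhds (0 : ℝ) hδ] with t ht
      simpa using ht
    filter_upwards [h2] with t ht
    simp only [hr_def, if_pos ht]
  have hrm : ∀ T > 0, AEStronglyMeasurable (fun x => r (T * x)) volume := fun T hT0 => by
    have h1 : AEStronglyMeasurable (fun x => F (μ + T * x)) volume :=
      ((hF.comp_add_left μ).comp_mul_left' hT0.ne').aestronglyMeasurable
    have h2 : MeasurableSet {x : ℝ | |T * x| < δ} := measurableSet_lt (by fun_prop) (by fun_prop)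
    have h3 : (fun x => r (T * x)) = fun x => {x : ℝ | |T * x| < δ}.indicator
        (fun x => F (μ + T * x)) x - (a₀ + a₁ * (T * x) + a₂ * (T * x) ^ 2) := by
      ext x
      simp [hr_def, Set.indicator_apply]
    rw [h3]
    exact (h1.indicator h2).sub (Continuous.aestronglyMeasurable (by fun_prop))
  -- Dominated convergence: `r (T * x) / T ^ 2` is at most D x² and tends to 0 for each x, while x²κ
  -- is integrable.
  have hmain : Tendsto (fun T : ℝ => ∫ x, r (T * x) / T ^ 2 * κ x) (𝓝[>] 0) (𝓝 0) := by
    have e0 : ∫ _ : ℝ, (0 : ℝ) = 0 := by simp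
    refine Eq.subst (motive := fun a => Tendsto (fun T : ℝ => ∫ x, r (T * x) / T ^ 2 * κ x)
      (𝓝[>] 0) (𝓝 a)) e0 ?_
    refine tendsto_integral_filter_of_dominated_convergence (fun x => D * |x ^ 2 * κ x|) ?_ ?_
      ((h.integrable_pow_mul le_rfl).abs.const_mul D) (ae_of_all _ fun x => ?_)
    · filter_upwards [self_mem_nhdsWithin] with T hT0
      simp only [div_eq_mul_inv]
      exact ((hrm T hT0).mul_const _).mul h.continuous.aestronglyMeasurable
    · filter_upwards [self_mem_nhdsWithin] with T hT0
      have hT0 : 0 < T := hT0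
      refine ae_of_all _ fun x => ?_
      rw [Real.norm_eq_abs, abs_mul, abs_mul, abs_div, abs_of_nonneg (sq_nonneg T),
        abs_of_nonneg (sq_nonneg x), ← mul_assoc]
      refine mul_le_mul_of_nonneg_right ?_ (abs_nonneg _)
      rw [div_le_iff₀ (by positivity)]
      refine (hrb _).trans (le_of_eq ?_)
      ring
    · by_cases hx : x = 0
      · subst hx
        refine tendsto_const_nhds.congr' ?_
        filter_upwards [self_mem_nhdsWithin] with T hT0
        have := hrb 0
        simp only [ne_eq, OfNat.ofNat_ne_zero, not_false_eq_true, zero_pow, mul_zero,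
          abs_nonpos_iff] at this
        simp [this]
      · have h1 : Tendsto (fun T : ℝ => T * x) (𝓝[>] 0) (𝓝[≠] 0) := by
          refine tendsto_nhdsWithin_iff.2 ⟨?_, ?_⟩
          · have : Tendsto (fun T : ℝ => T * x) (𝓝 0) (𝓝 (0 * x)) :=
              (continuous_id.mul continuous_const).tendsto 0
            rw [zero_mul] at this
            exact this.mono_left nhdsWithin_le_nhds
          · filter_upwards [self_mem_nhdsWithin] with T hT0
            exact mul_ne_zero (ne_of_gt hT0) hx
        have h2 := ((hr0.comp h1).mul_const (x ^ 2 * κ x))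
        rw [zero_mul] at h2
        refine h2.congr' ?_
        filter_upwards [self_mem_nhdsWithin] with T hT0
        have hT0 : T ≠ 0 := ne_of_gt hT0
        simp only [Function.comp_apply]
        field_simp
  have htail : (fun T : ℝ => ∫ x, (if |T * x| < δ then 0 else F (μ + T * x) * κ x))
      =o[𝓝[>] 0] fun T : ℝ => T ^ 2 := by
    have h1 : (fun T : ℝ => ∫ x, (if |T * x| < δ then 0 else F (μ + T * x) * κ x))
        =O[𝓝[>] 0] fun T : ℝ => T ^ 3 := by
      refine Asymptotics.IsBigO.of_bound (C / δ ^ 4 * ∫ x, |F x|) ?_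
      filter_upwards [self_mem_nhdsWithin] with T hT0
      have hT0 : 0 < T := hT0
      rw [Real.norm_eq_abs, Real.norm_of_nonneg (by positivity), mul_comm]
      exact h.abs_integral_tail_le hF μ hδ hT0
    exact h1.trans_isLittleO
      ((Asymptotics.isLittleO_pow_pow (by norm_num : 2 < 3)).mono nhdsWithin_le_nhds)
  have hnear : (fun T : ℝ => ∫ x, r (T * x) * κ x) =o[𝓝[>] 0] fun T : ℝ => T ^ 2 := by
    refine (Asymptotics.isLittleO_iff_tendsto' ?_).2 (hmain.congr' ?_)
    · filter_upwards [self_mem_nhdsWithin] with T hT0 h0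
      exact absurd h0 (pow_ne_zero 2 (ne_of_gt hT0))
    · filter_upwards [self_mem_nhdsWithin] with T hT0
      rw [← integral_div]
      congr 1
      ext x
      ring
  refine (hnear.add htail).congr' ?_ EventuallyEq.rfl
  filter_upwards [self_mem_nhdsWithin] with T hT0
  have hT0 : 0 < T := hT0
  have i0 : Integrable κ := by simpa using h.integrable_pow_mul (j := 0) (by norm_num)
  have i1 : Integrable fun x => x * κ x := by simpa using h.integrable_pow_mul (j := 1) (by norm_num)
  have i2 := h.integrable_pow_mul (j := 2) le_rfl
  have ir : Integrable fun x => r (T * x) * κ x := by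
    refine ((i2.abs.const_mul (D * T ^ 2))).mono' ((hrm T hT0).mul
      h.continuous.aestronglyMeasurable) (ae_of_all _ fun x => ?_)
    rw [Real.norm_eq_abs, abs_mul, abs_mul, abs_of_nonneg (sq_nonneg x), ← mul_assoc]
    refine mul_le_mul_of_nonneg_right ((hrb _).trans (le_of_eq ?_)) (abs_nonneg _)
    ring
  have iF := h.integrable_comp_mul hF μ hT0
  have it : Integrable fun x => if |T * x| < δ then 0 else F (μ + T * x) * κ x := by
    have h2 : MeasurableSet {x : ℝ | |T * x| < δ} := measurableSet_lt (by fun_prop) (by fun_prop)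
    refine (iF.indicator h2.compl).congr (ae_of_all _ fun x => ?_)
    simp only [Set.indicator_apply, Set.mem_compl_iff, Set.mem_ofPred_eq]
    split_ifs <;> rfl
  have e1 : ∫ x, F (μ + T * x) * κ x = ∫ x, ((r (T * x) * κ x +
      (if |T * x| < δ then 0 else F (μ + T * x) * κ x)) +
      (a₀ * κ x + a₁ * T * (x * κ x) + a₂ * T ^ 2 * (x ^ 2 * κ x))) := by
    refine integral_congr_ae (ae_of_all _ fun x => ?_)
    simp only [hr_def]
    split_ifs <;> ring
  have ip : Integrable fun x => a₀ * κ x + a₁ * T * (x * κ x) + a₂ * T ^ 2 * (x ^ 2 * κ x) :=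
    ((i0.const_mul _).add (i1.const_mul _)).add (i2.const_mul _)
  have ip1 : Integrable fun x => a₀ * κ x + a₁ * T * (x * κ x) :=
    (i0.const_mul _).add (i1.const_mul _)
  have irt : Integrable fun x => r (T * x) * κ x +
      (if |T * x| < δ then 0 else F (μ + T * x) * κ x) := ir.add it
  rw [e1, integral_add irt ip, integral_add ir it, integral_add ip1 (i2.const_mul _),
    integral_add (i0.const_mul _) (i1.const_mul _), integral_const_mul, integral_const_mul,
    integral_const_mul]
  ring

end QuarticDecay

end Junction
end


noncomputable section

namespace Junction

/-! ### Moments of the thermal broadening function -/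

/-- The derivative of `thermal`. -/
def thermalDeriv (x : ℝ) : ℝ := Real.exp x * (1 - Real.exp x) / (Real.exp x + 1) ^ 3

/-- The derivative of `x * thermal x`. -/
def broadening (x : ℝ) : ℝ := thermal x + x * thermalDeriv x

theorem continuous_thermalDeriv : Continuous thermalDeriv := by
  unfold thermalDeriv
  exact Continuous.div₀ (by fun_prop) (by fun_prop) fun x => by positivity

theorem abs_thermalDeriv_le (x : ℝ) : |thermalDeriv x| ≤ thermal x := by
  have h := Real.exp_pos x
  rw [thermalDeriv, thermal, abs_div, abs_of_pos (by positivity : 0 < (Real.exp x + 1) ^ 3),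
    div_le_div_iff₀ (by positivity) (by positivity), abs_mul, abs_of_pos h]
  have h1 : |1 - Real.exp x| ≤ Real.exp x + 1 := by rw [abs_le]; constructor <;> linarith
  calc _ ≤ Real.exp x * (Real.exp x + 1) * (Real.exp x + 1) ^ 2 := by gcongr
    _ = _ := by ring

theorem thermal_neg (x : ℝ) : thermal (-x) = thermal x := by
  rw [thermal, thermal, Real.exp_neg]
  have h := Real.exp_pos x
  field_simp
  ring

theorem thermal_le_exp (x : ℝ) : thermal x ≤ Real.exp (-|x|) := by
  have h : ∀ x : ℝ, thermal x ≤ Real.exp (-x) := fun x => by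
    have h := Real.exp_pos x
    rw [thermal, Real.exp_neg, div_le_iff₀ (by positivity), inv_mul_eq_div, le_div_iff₀ h]
    nlinarith
  rcases abs_choice x with h1 | h1 <;> rw [h1]
  · exact h x
  · rw [← thermal_neg]; exact h (-x)

/-- Exponential decay against a polynomial of degree 5 in 1 + |x|, from the term of order 5 of the
exponential series; 120 = 5!. The factor 1 + |x| covers `broadening` as well as `thermal`. -/
theorem one_add_abs_mul_thermal_le (x : ℝ) :
    (1 + |x|) * thermal x * (1 + x ^ 2) ^ 2 ≤ 120 * Real.exp 1 := by
  have h0 := abs_nonneg x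
  have h1 := Real.pow_div_factorial_le_exp (1 + |x|) (by positivity) 5
  have h2 : ((5).factorial : ℝ) = 120 := by norm_num [Nat.factorial]
  rw [h2, div_le_iff₀ (by norm_num)] at h1
  have h3 : 1 + x ^ 2 ≤ (1 + |x|) ^ 2 := by rw [← sq_abs x]; nlinarith
  calc _ ≤ (1 + |x|) * Real.exp (-|x|) * ((1 + |x|) ^ 2) ^ 2 := by
        have := thermal_le_exp x
        gcongr
    _ = (1 + |x|) ^ 5 * Real.exp (-|x|) := by ring
    _ ≤ Real.exp (1 + |x|) * 120 * Real.exp (-|x|) := by gcongr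
    _ = 120 * (Real.exp (1 + |x|) * Real.exp (-|x|)) := by ring
    _ = _ := by rw [← Real.exp_add]; ring_nf

theorem quarticDecay_thermal : QuarticDecay thermal (120 * Real.exp 1) := by
  refine ⟨continuous_thermal, fun x => le_trans ?_ (one_add_abs_mul_thermal_le x)⟩
  have h := thermal_pos x
  rw [abs_of_pos h]
  gcongr
  exact le_mul_of_one_le_left h.le (by linarith [abs_nonneg x])

theorem quarticDecay_broadening : QuarticDecay broadening (120 * Real.exp 1) := by
  refine ⟨continuous_thermal.add (continuous_id.mul continuous_thermalDeriv),
    fun x => le_trans ?_ (one_add_abs_mul_thermal_le x)⟩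
  gcongr
  rw [broadening]
  refine (abs_add_le _ _).trans ?_
  rw [abs_mul, abs_of_pos (thermal_pos x), add_mul, one_mul]
  gcongr
  exact abs_thermalDeriv_le x

theorem integral_thermal : ∫ x, thermal x = 1 := by
  have hd : ∀ x, HasDerivAt (fun x : ℝ => -(Real.exp x + 1)⁻¹) (thermal x) x := fun x => by
    simpa using (hasDerivAt_inv_exp_add_one x).fun_neg
  have hi : Integrable thermal := by
    simpa using quarticDecay_thermal.integrable_pow_mul (j := 0) (by norm_num)
  have h1 : Tendsto (fun x : ℝ => -(Real.exp x + 1)⁻¹) atBot (𝓝 (-1)) := by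
    have := ((Real.tendsto_exp_atBot.add_const 1).inv₀ (by norm_num)).neg
    simpa using this
  have h2 : Tendsto (fun x : ℝ => -(Real.exp x + 1)⁻¹) atTop (𝓝 0) := by
    have := (tendsto_inv_atTop_zero.comp
      (tendsto_atTop_add_const_right _ (1 : ℝ) Real.tendsto_exp_atTop)).neg
    simpa using this
  rw [integral_of_hasDerivAt_of_tendsto hd hi h1 h2]
  norm_num

theorem integral_id_mul_thermal : ∫ x, x * thermal x = 0 := by
  have h := integral_neg_eq_self (fun x => x * thermal x) volume
  simp only [thermal_neg, neg_mul, integral_neg] at h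
  linarith

/-- The even terms of ζ(2) = π²/6 sum to π²/24, so the odd ones sum to π²/8. The term n = 0
contributes nothing, since 1/0 = 0. -/
theorem hasSum_alternating_inv_sq :
    HasSum (fun n : ℕ => (-1 : ℝ) ^ n * (1 / (n : ℝ) ^ 2)) (-(Real.pi ^ 2 / 12)) := by
  have hz := hasSum_zeta_two
  have he : HasSum (fun n : ℕ => (1 : ℝ) / ((2 * n : ℕ) : ℝ) ^ 2) (Real.pi ^ 2 / 24) := by
    have := hz.mul_left (1 / 4)
    convert! this using 1
    · ext n
      push_cast
      ring
    · ring
  have ho : Summable fun n : ℕ => (1 : ℝ) / ((2 * n + 1 : ℕ) : ℝ) ^ 2 :=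
    hz.summable.comp_injective (i := fun n : ℕ => 2 * n + 1) fun a b h => by simpa using h
  have h1 := (he.even_add_odd (f := fun n : ℕ => (1 : ℝ) / (n : ℝ) ^ 2) ho.hasSum).unique hz
  have h2 : HasSum (fun n : ℕ => (-1 : ℝ) ^ (2 * n) * (1 / ((2 * n : ℕ) : ℝ) ^ 2))
      (Real.pi ^ 2 / 24) := by simpa using he
  have h3 : HasSum (fun n : ℕ => (-1 : ℝ) ^ (2 * n + 1) * (1 / ((2 * n + 1 : ℕ) : ℝ) ^ 2))
      (-∑' n : ℕ, (1 : ℝ) / ((2 * n + 1 : ℕ) : ℝ) ^ 2) := by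
    have := ho.hasSum.neg
    simpa [pow_succ] using this
  have h4 := h2.even_add_odd (f := fun n : ℕ => (-1 : ℝ) ^ n * (1 / (n : ℝ) ^ 2)) h3
  convert! h4 using 1
  linarith

theorem integral_sq_mul_exp_Ioi {n : ℕ} (hn : n ≠ 0) :
    ∫ x in Set.Ioi (0 : ℝ), x ^ 2 * Real.exp (-(n * x)) = 2 / (n : ℝ) ^ 3 := by
  have hn' : (0 : ℝ) < n := by exact_mod_cast Nat.pos_of_ne_zero hn
  have h := Real.integral_rpow_mul_exp_neg_mul_Ioi (a := 3) (r := n) (by norm_num) hn'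
  have h3 : Real.Gamma 3 = 2 := by
    rw [show (3 : ℝ) = (2 : ℕ) + 1 by norm_num, Real.Gamma_nat_eq_factorial]
    norm_num [Nat.factorial]
  rw [h3] at h
  norm_num at h
  rw [h]
  field_simp

/-- With y = e^{-x} the function is y/(1+y)² = -Σ n (-y)ⁿ, the differentiated geometric series. -/
theorem hasSum_thermal {x : ℝ} (hx : 0 < x) :
    HasSum (fun n : ℕ => -((-1) ^ n * n * Real.exp (-(n * x)))) (thermal x) := by
  have h1 : ‖-Real.exp (-x)‖ < 1 := by
    rw [norm_neg, Real.norm_of_nonneg (Real.exp_pos _).le, Real.exp_lt_one_iff]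
    linarith
  have h := (hasSum_coe_mul_geometric_of_norm_lt_one h1).neg
  convert! h using 1
  · ext n
    rw [neg_pow (Real.exp (-x)), ← Real.exp_nat_mul, mul_neg]
    ring
  · rw [← thermal_neg, thermal]
    ring

/-- Termwise integration of the exponential series leaves Gamma integrals and the alternating sum of
inverse squares; the integrals of the absolute values are summable, being 2/n². -/
theorem integral_Ioi_sq_mul_thermal :
    ∫ x in Set.Ioi (0 : ℝ), x ^ 2 * thermal x = Real.pi ^ 2 / 6 := by
  set F : ℕ → ℝ → ℝ := fun n x => -((-1) ^ n * n * (x ^ 2 * Real.exp (-(n * x)))) with hF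
  have hFi : ∀ n, IntegrableOn (F n) (Set.Ioi 0) := fun n => by
    by_cases hn : n = 0
    · simp only [hF, hn]
      simp
    · have hn' : (0 : ℝ) < n := by exact_mod_cast Nat.pos_of_ne_zero hn
      have h : IntegrableOn (fun x : ℝ => x ^ 2 * Real.exp (-(n * x))) (Set.Ioi 0) := by
        -- A function that is not integrable has integral 0 by convention, but the value of this
        -- integral is positive.
        by_contra hc
        have := integral_undef hc
        rw [integral_sq_mul_exp_Ioi hn] at this
        have : (0 : ℝ) < 2 / (n : ℝ) ^ 3 := by positivity
        linarith
      exact (h.const_mul _).neg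
  have hn2 : ∀ n : ℕ, ∫ x in Set.Ioi (0 : ℝ), ‖F n x‖ = 2 * (1 / (n : ℝ) ^ 2) := fun n => by
    by_cases hn : n = 0
    · simp [hF, hn]
    · have e : ∀ x : ℝ, ‖F n x‖ = n * (x ^ 2 * Real.exp (-(n * x))) := fun x => by
        simp [hF]
      simp_rw [e]
      rw [integral_const_mul, integral_sq_mul_exp_Ioi hn]
      have hn' : (n : ℝ) ≠ 0 := by exact_mod_cast hn
      field_simp
  have hs := hasSum_integral_of_summable_integral_norm (μ := volume.restrict (Set.Ioi (0 : ℝ))) hFi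
    (by simp_rw [hn2]; exact hasSum_zeta_two.summable.mul_left 2)
  have h1 : ∀ n : ℕ, ∫ x in Set.Ioi (0 : ℝ), F n x = -2 * ((-1) ^ n * (1 / (n : ℝ) ^ 2)) :=
    fun n => by
    by_cases hn : n = 0
    · simp [hF, hn]
    · simp only [hF]
      rw [integral_neg, integral_const_mul, integral_sq_mul_exp_Ioi hn]
      have hn' : (n : ℝ) ≠ 0 := by exact_mod_cast hn
      field_simp
  have h2 : ∫ x in Set.Ioi (0 : ℝ), ∑' n, F n x = ∫ x in Set.Ioi (0 : ℝ), x ^ 2 * thermal x := by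
    refine setIntegral_congr_fun measurableSet_Ioi fun x hx => ?_
    rw [← (hasSum_thermal hx).tsum_eq, ← tsum_mul_left]
    exact tsum_congr fun n => by simp only [hF]; ring
  rw [h2] at hs
  simp_rw [h1] at hs
  rw [hs.unique (hasSum_alternating_inv_sq.mul_left (-2))]
  ring

theorem integral_sq_mul_thermal : ∫ x, x ^ 2 * thermal x = Real.pi ^ 2 / 3 := by
  have hi := quarticDecay_thermal.integrable_pow_mul (j := 2) le_rfl
  rw [← intervalIntegral.integral_Iic_add_Ioi hi.integrableOn hi.integrableOn (b := 0)]
  have h : ∫ x in Set.Iic (0 : ℝ), x ^ 2 * thermal x =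
      ∫ x in Set.Ioi (0 : ℝ), x ^ 2 * thermal x := by
    have := integral_comp_neg_Ioi (0 : ℝ) (fun x => x ^ 2 * thermal x)
    simp only [thermal_neg, neg_sq, neg_zero] at this
    exact this.symm
  rw [h, integral_Ioi_sq_mul_thermal]
  ring

theorem tendsto_pow_succ_mul_thermal {j : ℕ} (hj : j ≤ 2) {l : Filter ℝ}
    (hl : Tendsto (fun x : ℝ => |x|) l atTop) :
    Tendsto (fun x => x ^ j * (x * thermal x)) l (𝓝 0) := by
  have h1 : Tendsto (fun x : ℝ => 120 * Real.exp 1 * |x|⁻¹) l (𝓝 0) := by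
    simpa using (tendsto_inv_atTop_zero.comp hl).const_mul (120 * Real.exp 1)
  refine squeeze_zero_norm' ?_ h1
  filter_upwards [hl.eventually_gt_atTop 0] with x hx
  rw [← div_eq_mul_inv, le_div_iff₀ hx, Real.norm_eq_abs, abs_mul, abs_mul,
    abs_of_pos (thermal_pos x)]
  refine le_trans ?_ (quarticDecay_thermal.bound x)
  rw [abs_of_pos (thermal_pos x)]
  have h2 := QuarticDecay.abs_pow_le hj x
  have h3 := (thermal_pos x).le
  have h4 : |x| * |x| ≤ 1 + x ^ 2 := by rw [← pow_two, sq_abs]; linarith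
  calc |x ^ j| * (|x| * thermal x) * |x| = thermal x * (|x ^ j| * (|x| * |x|)) := by ring
    _ ≤ thermal x * ((1 + x ^ 2) * (1 + x ^ 2)) := by gcongr
    _ = _ := by ring

/-- Integration by parts, as `broadening` is the derivative of `x * thermal x`. Its moments of order
0 and 1 vanish, so the T-derivative of the average begins at order T. -/
theorem integral_pow_mul_broadening {j : ℕ} (hj : j ≤ 2) :
    ∫ x, x ^ j * broadening x = -(j * ∫ x, x ^ j * thermal x) := by
  have i1 := quarticDecay_broadening.integrable_pow_mul hj
  have i2 := (quarticDecay_thermal.integrable_pow_mul hj).const_mul (j : ℝ)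
  have hd : ∀ x, HasDerivAt (fun x => x ^ j * (x * thermal x))
      (x ^ j * broadening x + j * (x ^ j * thermal x)) x := fun x => by
    have h := (hasDerivAt_pow j x).fun_mul ((hasDerivAt_id x).fun_mul (hasDerivAt_thermal x))
    convert! h using 1
    rw [broadening, thermalDeriv]
    rcases j with _ | j
    · simp
    · simp [pow_succ]
      ring
  have h := integral_of_hasDerivAt_of_tendsto hd (i1.add i2)
    (tendsto_pow_succ_mul_thermal hj tendsto_abs_atBot_atTop)
    (tendsto_pow_succ_mul_thermal hj tendsto_abs_atTop_atTop)
  rw [integral_add i1 i2, integral_const_mul] at h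
  linarith

end Junction
end


noncomputable section

namespace Junction

/-! ### Low temperature asymptotics -/

/-- The thermal average of a function of the energy. -/
def thermalAverage (F : ℝ → ℝ) (μ T : ℝ) : ℝ := ∫ x, F (μ + T * x) * thermal x

/-- Moves the temperature from F into the kernel, so that differentiating in T requires no
regularity of F. -/
theorem integral_scale {F κ : ℝ → ℝ} (μ : ℝ) {T : ℝ} (hT : 0 < T) :
    ∫ x, F (μ + T * x) * κ x = T⁻¹ * ∫ ω, F ω * κ ((ω - μ) / T) := by
  have h := Measure.integral_comp_mul_left (fun y => F (μ + y) * κ (y / T)) T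
  rw [abs_of_pos (by positivity), smul_eq_mul] at h
  have h2 := integral_add_left_eq_self (μ := volume) (fun ω => F ω * κ ((ω - μ) / T)) μ
  simp only [add_sub_cancel_left] at h2
  rw [← h2, ← h]
  congr 1
  ext x
  rw [mul_div_cancel_left₀ _ hT.ne']

theorem hasDerivAt_thermalAverage {F : ℝ → ℝ} (hF : Integrable F) (μ : ℝ) {T : ℝ} (hT : 0 < T) :
    HasDerivAt (thermalAverage F μ) (-(T⁻¹ * ∫ x, F (μ + T * x) * broadening x)) T := by
  obtain ⟨C, hC⟩ : ∃ C, QuarticDecay broadening C := ⟨_, quarticDecay_broadening⟩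
  have hC0 := hC.nonneg
  have hCb : ∀ x, |broadening x| ≤ C := fun x => by
    have h3 : (1 : ℝ) ≤ (1 + x ^ 2) ^ 2 := one_le_pow₀ (by nlinarith [sq_nonneg x])
    nlinarith [hC.bound x, abs_nonneg (broadening x)]
  -- The derivative of t⁻¹ `thermal`((ω-μ)/t) in t is again a rescaled kernel, namely -t⁻²
  -- `broadening`((ω-μ)/t).
  have hd : ∀ ω : ℝ, ∀ t : ℝ, 0 < t → HasDerivAt (fun t => F ω * (t⁻¹ * thermal ((ω - μ) / t)))
      (F ω * (-(t ^ 2)⁻¹ * broadening ((ω - μ) / t))) t := fun ω t ht => by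
    have h1 : HasDerivAt (fun t : ℝ => (ω - μ) / t) (-(ω - μ) / t ^ 2) t := by
      have := (hasDerivAt_inv ht.ne').const_mul (ω - μ)
      convert! this using 1
      field_simp
    have h2 := (((hasDerivAt_inv ht.ne').fun_mul
      ((hasDerivAt_thermal ((ω - μ) / t)).comp t h1))).const_mul (F ω)
    convert! h2 using 1
    rw [broadening, thermalDeriv]
    simp only [Function.comp_apply]
    field_simp
    ring
  have hm := hF.aestronglyMeasurable
  have key := hasDerivAt_integral_of_dominated_loc_of_deriv_le (μ := volume)
    (F := fun t ω => F ω * (t⁻¹ * thermal ((ω - μ) / t)))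
    (F' := fun t ω => F ω * (-(t ^ 2)⁻¹ * broadening ((ω - μ) / t))) (x₀ := T)
    (s := Set.Ioi (T / 2)) (bound := fun ω => |F ω| * ((T / 2) ^ 2)⁻¹ * C)
    (Ioi_mem_nhds (by linarith))
    (Eventually.of_forall fun t => hm.mul (by
      have := continuous_thermal
      exact Continuous.aestronglyMeasurable (by fun_prop)))
    ?_ (hm.mul (by
      have := hC.continuous
      exact Continuous.aestronglyMeasurable (by fun_prop))) (ae_of_all _ fun ω t ht => ?_)
    ((hF.abs.mul_const _).mul_const _)
    (ae_of_all _ fun ω t ht => hd ω t (lt_trans (by linarith) (Set.mem_Ioi.1 ht)))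
  · have h := key.2
    have e2 : ∫ ω, F ω * (-(T ^ 2)⁻¹ * broadening ((ω - μ) / T)) =
        -(T⁻¹ * ∫ x, F (μ + T * x) * broadening x) := by
      rw [integral_scale μ hT, ← integral_const_mul, ← integral_const_mul, ← integral_neg]
      congr 1
      ext ω
      field_simp
    rw [e2] at h
    refine h.congr_of_eventuallyEq ?_
    filter_upwards [Ioi_mem_nhds hT] with t ht
    rw [thermalAverage, integral_scale μ ht, ← integral_const_mul]
    congr 1
    ext ω
    ring
  · refine hF.mul_bdd (c := T⁻¹ * 1) ?_ (ae_of_all _ fun ω => ?_)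
    · have := continuous_thermal
      exact Continuous.aestronglyMeasurable (by fun_prop)
    · rw [norm_mul, Real.norm_of_nonneg (by positivity), Real.norm_of_nonneg (thermal_pos _).le]
      gcongr
      exact (thermal_le _).trans (by norm_num)
  · have ht : T / 2 < t := ht
    have ht0 : 0 < t := by linarith
    rw [norm_mul, norm_mul, norm_neg, Real.norm_eq_abs,
      Real.norm_of_nonneg (by positivity : 0 ≤ (t ^ 2)⁻¹), Real.norm_eq_abs, mul_assoc]
    have h4 := hCb ((ω - μ) / t)
    gcongr

/-- Taylor's formula of second order, for the extension by zero of a function on `(0, ∞)`. -/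
theorem isLittleO_taylor_two {f : ℝ → ℝ} (hf : ContDiffOn ℝ 2 f (Set.Ioi 0)) {μ : ℝ} (hμ : 0 < μ) :
    (fun t => (Set.Ioi 0).indicator f (μ + t) -
      (f μ + deriv f μ * t + iteratedDeriv 2 f μ / 2 * t ^ 2)) =o[𝓝 0] fun t => t ^ 2 := by
  have hμ' : μ ∈ Set.Ioi (0 : ℝ) := hμ
  have h := taylor_isLittleO (n := 2) (convex_Ioi 0) hμ' hf
  rw [isOpen_Ioi.nhdsWithin_eq hμ'] at h
  have h1 : Tendsto (fun t : ℝ => μ + t) (𝓝 0) (𝓝 μ) := by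
    have : Tendsto (fun t : ℝ => μ + t) (𝓝 0) (𝓝 (μ + 0)) :=
      (continuous_const.add continuous_id).tendsto 0
    rwa [add_zero] at this
  have h2 := h.comp_tendsto h1
  refine h2.congr' ?_ (Eventually.of_forall fun t => by simp)
  filter_upwards [h1.eventually (Ioi_mem_nhds hμ)] with t ht
  have e : ∀ k, iteratedDerivWithin k f (Set.Ioi 0) μ = iteratedDeriv k f μ := fun k =>
    iteratedDerivWithin_of_isOpen isOpen_Ioi hμ'
  rw [Set.indicator_of_mem (Set.mem_Ioi.2 ht)]
  simp only [Function.comp_apply, taylorWithinEval_succ, taylor_within_zero_eval, e,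
    add_sub_cancel_left, smul_eq_mul]
  norm_num
  ring

theorem isLittleO_thermalAverage {f : ℝ → ℝ} (hf : ContDiffOn ℝ 2 f (Set.Ioi 0))
    (hi : IntegrableOn f (Set.Ioi 0)) {μ : ℝ} (hμ : 0 < μ) :
    (fun T : ℝ => thermalAverage ((Set.Ioi 0).indicator f) μ T -
      (f μ + Real.pi ^ 2 * T ^ 2 * iteratedDeriv 2 f μ / 6)) =o[𝓝[>] 0] fun T => T ^ 2 := by
  have h := quarticDecay_thermal.isLittleO_integral (hi.integrable_indicator measurableSet_Ioi)
    (isLittleO_taylor_two hf hμ)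
  rw [integral_thermal, integral_id_mul_thermal, integral_sq_mul_thermal] at h
  refine h.congr_left fun T => ?_
  rw [thermalAverage]
  ring

/-- Applying the expansion to the kernel `broadening`, with moments 0, 0, -2π²/3, determines the
sign of the T-derivative near 0. The expansion of the average itself would not imply monotonicity.
-/
theorem tendsto_deriv_thermalAverage {f : ℝ → ℝ} (hf : ContDiffOn ℝ 2 f (Set.Ioi 0))
    (hi : IntegrableOn f (Set.Ioi 0)) {μ : ℝ} (hμ : 0 < μ) :
    Tendsto (fun T : ℝ => -(T⁻¹ * ∫ x, (Set.Ioi 0).indicator f (μ + T * x) * broadening x) / T)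
      (𝓝[>] 0) (𝓝 (Real.pi ^ 2 / 3 * iteratedDeriv 2 f μ)) := by
  have h := quarticDecay_broadening.isLittleO_integral (hi.integrable_indicator measurableSet_Ioi)
    (isLittleO_taylor_two hf hμ)
  have m0 := integral_pow_mul_broadening (j := 0) (by norm_num)
  have m1 := integral_pow_mul_broadening (j := 1) (by norm_num)
  have m2 := integral_pow_mul_broadening (j := 2) le_rfl
  simp only [pow_zero, one_mul, Nat.cast_zero, zero_mul, neg_zero] at m0
  simp only [pow_one, integral_id_mul_thermal, mul_zero, neg_zero] at m1
  rw [integral_sq_mul_thermal] at m2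
  rw [m0, m1, m2] at h
  have h1 := (h.tendsto_div_nhds_zero.neg).add_const (Real.pi ^ 2 / 3 * iteratedDeriv 2 f μ)
  rw [neg_zero, zero_add] at h1
  refine h1.congr' ?_
  filter_upwards [self_mem_nhdsWithin] with T hT
  have hT : T ≠ 0 := ne_of_gt hT
  push_cast
  field_simp
  ring

theorem tendsto_thermalAverage {f : ℝ → ℝ} (hf : ContDiffOn ℝ 2 f (Set.Ioi 0))
    (hi : IntegrableOn f (Set.Ioi 0)) {μ : ℝ} (hμ : 0 < μ) :
    Tendsto (fun T : ℝ => thermalAverage ((Set.Ioi 0).indicator f) μ T) (𝓝[>] 0) (𝓝 (f μ)) := by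
  have h2 : Tendsto (fun T : ℝ => T ^ 2) (𝓝[>] 0) (𝓝 0) := by
    have : Tendsto (fun T : ℝ => T ^ 2) (𝓝 0) (𝓝 (0 ^ 2)) := (continuous_pow 2).tendsto 0
    rw [zero_pow two_ne_zero] at this
    exact this.mono_left nhdsWithin_le_nhds
  have h1 := (isLittleO_thermalAverage hf hi hμ).trans_tendsto h2
  have h3 : Tendsto (fun T : ℝ => f μ + Real.pi ^ 2 * T ^ 2 * iteratedDeriv 2 f μ / 6) (𝓝[>] 0)
      (𝓝 (f μ)) := by
    have := (((h2.const_mul (Real.pi ^ 2)).mul_const (iteratedDeriv 2 f μ)).div_const 6).const_add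
      (f μ)
    simpa using this
  simpa using h1.add h3

/-- The asymptotics of the inverse of a thermal average. -/
theorem low_temperature_asymptotics {f R : ℝ → ℝ} (hf : ContDiffOn ℝ 2 f (Set.Ioi 0))
    (hi : IntegrableOn f (Set.Ioi 0)) (hf0 : ∀ r, 0 < r → 0 ≤ f r) {μ : ℝ} (hμ : 0 < μ)
    (hR : ∀ T, 0 < T → (R (1 / T))⁻¹ = thermalAverage ((Set.Ioi 0).indicator f) μ T) :
    (fun T : ℝ => (R (1 / T))⁻¹ - (f μ + Real.pi ^ 2 * T ^ 2 * iteratedDeriv 2 f μ / 6)) =o[𝓝[>] 0]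
      (fun T : ℝ => T ^ 2) ∧
    (f μ ≠ 0 →
      (fun T : ℝ => R (1 / T) - 1 / (f μ + Real.pi ^ 2 * T ^ 2 * iteratedDeriv 2 f μ / 6)) =o[𝓝[>] 0]
        (fun T : ℝ => T ^ 2) ∧
      Tendsto R atTop (𝓝 (f μ)⁻¹) ∧
      (iteratedDeriv 2 f μ < 0 → ∃ T₀ : ℝ, 0 < T₀ ∧
        StrictMonoOn (fun T : ℝ => R (1 / T)) (Set.Ioo 0 T₀)) ∧
      (0 < iteratedDeriv 2 f μ → ∃ T₀ : ℝ, 0 < T₀ ∧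
        StrictAntiOn (fun T : ℝ => R (1 / T)) (Set.Ioo 0 T₀))) := by
  set A := thermalAverage ((Set.Ioi 0).indicator f) μ with hA
  have hRA : ∀ T, 0 < T → R (1 / T) = (A T)⁻¹ := fun T hT => by rw [← hR T hT, inv_inv]
  have hexp := isLittleO_thermalAverage hf hi hμ
  have hlim := tendsto_thermalAverage hf hi hμ
  rw [← hA] at hexp hlim
  have hFi : Integrable ((Set.Ioi 0).indicator f) := hi.integrable_indicator measurableSet_Ioi
  have hder := fun T (hT : 0 < T) => hasDerivAt_thermalAverage hFi μ hT
  rw [← hA] at hder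
  have hsign := tendsto_deriv_thermalAverage hf hi hμ
  set A' : ℝ → ℝ := fun T => -(T⁻¹ * ∫ x, (Set.Ioi 0).indicator f (μ + T * x) * broadening x)
    with hA'
  refine ⟨hexp.congr' ?_ EventuallyEq.rfl, fun hμ0 => ?_⟩
  · filter_upwards [self_mem_nhdsWithin] with T hT
    rw [hR T hT]
  have hfpos : 0 < f μ := lt_of_le_of_ne (hf0 μ hμ) (Ne.symm hμ0)
  have hApos : ∀ᶠ T in 𝓝[>] 0, 0 < A T := hlim.eventually_const_lt hfpos
  -- Turns statements for all small T > 0 into statements on an interval, as needed for the mean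
  -- value argument.
  have hint : ∀ {p : ℝ → Prop}, (∀ᶠ T in 𝓝[>] (0 : ℝ), p T) →
      ∃ T₀ : ℝ, 0 < T₀ ∧ ∀ T ∈ Set.Ioo 0 T₀, p T := fun {p} hp => by
    obtain ⟨T₀, hT₀, h⟩ := mem_nhdsGT_iff_exists_Ioo_subset.1 hp
    exact ⟨T₀, hT₀, fun T hT => h hT⟩
  refine ⟨?_, ?_, fun hneg => ?_, fun hpos => ?_⟩
  · set P : ℝ → ℝ := fun T => f μ + Real.pi ^ 2 * T ^ 2 * iteratedDeriv 2 f μ / 6 with hP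
    have hPlim : Tendsto P (𝓝[>] 0) (𝓝 (f μ)) := by
      have hc : Continuous P := by rw [hP]; fun_prop
      have := hc.tendsto 0
      simp only [hP] at this
      norm_num at this
      exact this.mono_left nhdsWithin_le_nhds
    have h1 : Tendsto (fun T => (A T * P T)⁻¹) (𝓝[>] 0) (𝓝 (f μ * f μ)⁻¹) :=
      (hlim.mul hPlim).inv₀ (mul_ne_zero hμ0 hμ0)
    -- The difference of reciprocals is (P - A)/(A P), and 1/(A P) is bounded near 0 because both
    -- factors tend to f(μ) ≠ 0.
    have h2 := hexp.neg_left.mul_isBigO (h1.isBigO_one ℝ)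
    simp only [mul_one] at h2
    refine h2.congr' ?_ EventuallyEq.rfl
    filter_upwards [self_mem_nhdsWithin, hApos, hPlim.eventually_const_lt hfpos] with T hT h3 h4
    rw [hRA T hT]
    have h3 := h3.ne'
    have h4 : P T ≠ 0 := h4.ne'
    change -(A T - P T) * (A T * P T)⁻¹ = (A T)⁻¹ - 1 / P T
    field_simp
    ring
  · have h1 : Tendsto (fun β : ℝ => 1 / β) atTop (𝓝[>] 0) := by
      simpa using tendsto_inv_atTop_nhdsGT_zero (𝕜 := ℝ)
    refine ((hlim.comp h1).inv₀ hμ0).congr' ?_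
    filter_upwards [eventually_gt_atTop 0] with β hβ
    rw [Function.comp_apply, ← hRA _ (by positivity), one_div_one_div]
  · have h1 : Real.pi ^ 2 / 3 * iteratedDeriv 2 f μ < 0 :=
      mul_neg_of_pos_of_neg (by positivity) hneg
    obtain ⟨T₀, hT₀, h⟩ := hint (hApos.and (hsign.eventually_lt_const h1))
    refine ⟨T₀, hT₀, fun a ha b hb hab => ?_⟩
    have hanti : StrictAntiOn A (Set.Ioo 0 T₀) := by
      refine strictAntiOn_of_deriv_neg (convex_Ioo 0 T₀)
        (fun T hT => (hder T hT.1).continuousAt.continuousWithinAt) fun T hT => ?_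
      rw [interior_Ioo] at hT
      rw [(hder T hT.1).deriv]
      have := (h T hT).2
      rwa [div_lt_iff₀ hT.1, zero_mul] at this
    simp only
    rw [hRA a ha.1, hRA b hb.1]
    exact inv_strictAnti₀ (h b hb).1 (hanti ha hb hab)
  · have h1 : 0 < Real.pi ^ 2 / 3 * iteratedDeriv 2 f μ := by positivity
    obtain ⟨T₀, hT₀, h⟩ := hint (hApos.and (hsign.eventually_const_lt h1))
    refine ⟨T₀, hT₀, fun a ha b hb hab => ?_⟩
    have hmono : StrictMonoOn A (Set.Ioo 0 T₀) := by
      refine strictMonoOn_of_deriv_pos (convex_Ioo 0 T₀)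
        (fun T hT => (hder T hT.1).continuousAt.continuousWithinAt) fun T hT => ?_
      rw [interior_Ioo] at hT
      rw [(hder T hT.1).deriv]
      have := (h T hT).2
      rwa [lt_div_iff₀ hT.1, zero_mul] at this
    simp only
    rw [hRA a ha.1, hRA b hb.1]
    exact inv_strictAnti₀ (h a ha).1 (hmono ha hb hab)

end Junction
end


noncomputable section

namespace Junction

/-! ### Smoothness of the transmission amplitude along the energy shell -/

/-- Twice termwise differentiable series. -/
theorem contDiff_two_tsum {ι : Type*} {u u' u'' : ι → ℝ → ℂ} {b : ι → ℝ} {B : ℝ → ℝ}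
    (hb : Summable b) (hb0 : ∀ i, 0 ≤ b i) (hB : ∀ x y, 0 ≤ x → x ≤ y → B x ≤ B y)
    (hu : ∀ i x, HasDerivAt (u i) (u' i x) x) (hu' : ∀ i x, HasDerivAt (u' i) (u'' i x) x)
    (hc : ∀ i, Continuous (u'' i)) (h0 : ∀ i x, ‖u i x‖ ≤ b i * B |x|)
    (h1 : ∀ i x, ‖u' i x‖ ≤ b i * B |x|) (h2 : ∀ i x, ‖u'' i x‖ ≤ b i * B |x|) :
    ContDiff ℝ 2 fun x => ∑' i, u i x := by
  -- The bounds grow with |x|, so termwise differentiation is done on bounded intervals, where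
  -- monotonicity of `B` gives a uniform majorant.
  have hball : ∀ {v : ι → ℝ → ℂ}, (∀ i x, ‖v i x‖ ≤ b i * B |x|) → ∀ (ρ : ℝ) (i : ι) (x : ℝ),
      x ∈ Set.Ioo (-ρ) ρ → ‖v i x‖ ≤ b i * B ρ := fun hv ρ i x hx =>
    (hv i x).trans (mul_le_mul_of_nonneg_left
      (hB _ _ (abs_nonneg x) (abs_le.2 ⟨hx.1.le, hx.2.le⟩)) (hb0 i))
  have hmem : ∀ x : ℝ, x ∈ Set.Ioo (-(|x| + 1)) (|x| + 1) := fun x =>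
    ⟨by linarith [neg_abs_le x], by linarith [le_abs_self x]⟩
  have hsum : ∀ {v : ι → ℝ → ℂ}, (∀ i x, ‖v i x‖ ≤ b i * B |x|) → ∀ x, Summable fun i => v i x :=
    fun hv x => Summable.of_norm_bounded (hb.mul_right (B |x|)) fun i => hv i x
  have d1 : ∀ x, HasDerivAt (fun x => ∑' i, u i x) (∑' i, u' i x) x := fun x =>
    hasDerivAt_tsum_of_isPreconnected (hb.mul_right (B (|x| + 1))) isOpen_Ioo
      isPreconnected_Ioo (fun i y _ => hu i y) (fun i y hy => hball h1 _ i y hy) (hmem x)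
      (hsum h0 x) (hmem x)
  have d2 : ∀ x, HasDerivAt (fun x => ∑' i, u' i x) (∑' i, u'' i x) x := fun x =>
    hasDerivAt_tsum_of_isPreconnected (hb.mul_right (B (|x| + 1))) isOpen_Ioo
      isPreconnected_Ioo (fun i y _ => hu' i y) (fun i y hy => hball h2 _ i y hy) (hmem x)
      (hsum h1 x) (hmem x)
  have d3 : Continuous fun x => ∑' i, u'' i x := continuous_iff_continuousAt.2 fun x =>
    (continuousOn_tsum (s := Set.Ioo (-(|x| + 1)) (|x| + 1)) (fun i => (hc i).continuousOn)
      (hb.mul_right (B (|x| + 1))) fun i y hy => hball h2 _ i y hy).continuousAt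
      (isOpen_Ioo.mem_nhds (hmem x))
  have e1 : deriv (fun x => ∑' i, u i x) = fun x => ∑' i, u' i x := funext fun x => (d1 x).deriv
  have e2 : deriv (fun x => ∑' i, u' i x) = fun x => ∑' i, u'' i x := funext fun x => (d2 x).deriv
  rw [show (2 : WithTop ℕ∞) = 1 + 1 by norm_num, contDiff_succ_iff_deriv, e1]
  refine ⟨fun x => (d1 x).differentiableAt, by simp, contDiff_one_iff_deriv.2 ⟨fun x =>
    (d2 x).differentiableAt, ?_⟩⟩
  rw [e2]
  exact d3

variable {d : ℕ}

/-- The derivative of a Hermite function. -/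
def hermiteDeriv (q : ℕ) (x : ℝ) : ℝ :=
  ladder q * hermiteFun (q - 1) x - ladder (q + 1) * hermiteFun (q + 1) x

/-- A product of Hermite functions along a coordinate axis, without the factor of this axis. -/
def axisFactor (i : Fin d) (q : Fin d → ℕ) : ℝ := ∏ j ∈ Finset.univ.erase i, hermiteFun (q j) 0

theorem hermiteSpace_single (i : Fin d) (q : Fin d → ℕ) (r : ℝ) :
    hermiteSpace q (EuclideanSpace.single i r) = axisFactor i q * hermiteFun (q i) r := by
  rw [hermiteSpace, ← Finset.mul_prod_erase _ _ (Finset.mem_univ i), mul_comm, axisFactor]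
  congr 1
  · refine Finset.prod_congr rfl fun j hj => ?_
    simp [Finset.ne_of_mem_erase hj]
  · simp

/-- The coordinates set to zero are estimated by the uniform bound; the remaining one may carry
derivatives, as long as these cost no more than the cube of its rate. -/
theorem abs_axisFactor_mul_le (i : Fin d) (q : Fin d → ℕ) {y B : ℝ}
    (hy : |y| ≤ B * hermiteRate (q i) ^ 3) :
    |axisFactor i q * y| ≤ 2 ^ d * B * rateProd q ^ 3 := by
  have h1 : |axisFactor i q| ≤ 2 ^ d * ∏ j ∈ Finset.univ.erase i, hermiteRate (q j) ^ 3 := by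
    rw [axisFactor, Finset.abs_prod]
    calc _ ≤ ∏ j ∈ Finset.univ.erase i, 2 * hermiteRate (q j) ^ 3 :=
          Finset.prod_le_prod (fun _ _ => abs_nonneg _) fun j _ =>
            (abs_hermiteFun_le _ _).trans (mul_le_mul_of_nonneg_left
              (le_self_pow₀ (one_le_hermiteRate _) three_ne_zero) (by norm_num))
      _ = 2 ^ (d - 1) * ∏ j ∈ Finset.univ.erase i, hermiteRate (q j) ^ 3 := by
          rw [Finset.prod_mul_distrib, Finset.prod_const, Finset.card_erase_of_mem
            (Finset.mem_univ i), Finset.card_univ, Fintype.card_fin]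
      _ ≤ _ := by
          refine mul_le_mul_of_nonneg_right (pow_le_pow_right₀ (by norm_num) (Nat.sub_le d 1))
            (Finset.prod_nonneg fun j _ => ?_)
          have := hermiteRate_pos (q j)
          positivity
  rw [abs_mul, rateProd, ← Finset.mul_prod_erase _ _ (Finset.mem_univ i), mul_pow,
    ← Finset.prod_pow]
  refine (mul_le_mul h1 hy (abs_nonneg _) ((abs_nonneg _).trans h1)).trans (le_of_eq ?_)
  ring

/-- A radial amplitude on the energy shell is a function of one variable, read off at k = l on a
coordinate axis. Two termwise derivatives cost at most the cubic weights, which the series can pay.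
-/
theorem IsHermiteSeries.contDiff_axis {v : Space d → Space d → ℂ}
    {c : (Fin d → ℕ) × (Fin d → ℕ) → ℂ} (h : IsHermiteSeries v c) (i : Fin d) :
    ContDiff ℝ 2 fun r : ℝ => v (EuclideanSpace.single i r) (EuclideanSpace.single i r) := by
  let f : (Fin d → ℕ) → ℝ → ℝ := fun q r => axisFactor i q * hermiteFun (q i) r
  let f' : (Fin d → ℕ) → ℝ → ℝ := fun q r => axisFactor i q * hermiteDeriv (q i) r
  let f'' : (Fin d → ℕ) → ℝ → ℝ := fun q r =>
    axisFactor i q * ((r ^ 2 - (2 * (q i : ℕ) + 1)) * hermiteFun (q i) r)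
  -- 18 is the constant for the first derivative; it also covers 2 for the function itself and 8 for
  -- the second derivative, whose bound carries the factor (|r| + 1)³.
  let D : ℝ → ℝ := fun t => 2 ^ d * (18 * (t + 1) ^ 3)
  have hf : ∀ q r, HasDerivAt (f q) (f' q r) r := fun q r =>
    (hasDerivAt_hermiteFun (q i) r).const_mul _
  have hf' : ∀ q r, HasDerivAt (f' q) (f'' q r) r := fun q r =>
    (hasDerivAt_hermiteFun_deriv (q i) r).const_mul _
  have hfc : ∀ q, Continuous (f'' q) := fun q => by
    have := continuous_hermiteFun (q i)
    fun_prop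
  have hone : ∀ r : ℝ, 1 ≤ (|r| + 1) ^ 3 := fun r =>
    one_le_pow₀ (by linarith [abs_nonneg r])
  have b0 : ∀ q r, |f q r| ≤ D |r| * rateProd q ^ 3 := fun q r =>
    abs_axisFactor_mul_le i q (by
      have h1 := abs_hermiteFun_le (q i) r
      have h2 := one_le_hermiteRate (q i)
      have h3 := le_self_pow₀ h2 three_ne_zero
      have h4 := hone r
      have h5 : 0 ≤ hermiteRate (q i) ^ 3 := by positivity
      nlinarith)
  have b1 : ∀ q r, |f' q r| ≤ D |r| * rateProd q ^ 3 := fun q r =>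
    abs_axisFactor_mul_le i q (by
      have h1 := abs_hermiteFun_deriv_le (q i) r
      have h2 := hermiteRate_pos (q i)
      have h4 := hone r
      have h5 : 0 ≤ hermiteRate (q i) ^ 3 := by positivity
      rw [hermiteDeriv]
      nlinarith)
  have b2 : ∀ q r, |f'' q r| ≤ D |r| * rateProd q ^ 3 := fun q r =>
    abs_axisFactor_mul_le i q (by
      have h1 := abs_hermiteFun_deriv_two_le (q i) r
      have h2 := hermiteRate_pos (q i)
      have h4 := hone r
      have h5 : 0 ≤ (|r| + 1) ^ 3 * hermiteRate (q i) ^ 3 := by positivity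
      nlinarith)
  have e : (fun r : ℝ => v (EuclideanSpace.single i r) (EuclideanSpace.single i r)) =
      fun r => ∑' q : (Fin d → ℕ) × (Fin d → ℕ), c q * ((f q.1 r * f q.2 r : ℝ) : ℂ) :=
    funext fun r => by
      rw [← (h.hasSum _ _).tsum_eq]
      simp only [hermiteSpace_single, f]
  rw [e]
  have hmul : ∀ {x y X Y D : ℝ}, |x| ≤ D * X → |y| ≤ D * Y → |x * y| ≤ D ^ 2 * (X * Y) :=
    fun {x y X Y D} hx hy => by
      rw [abs_mul]
      exact (mul_le_mul hx hy (abs_nonneg _) ((abs_nonneg _).trans hx)).trans (le_of_eq (by ring))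
  have hr : ∀ q : (Fin d → ℕ) × (Fin d → ℕ), 0 ≤ rateProd q.1 ^ 3 * rateProd q.2 ^ 3 := fun q => by
    have h1 := rateProd_pos q.1
    have h2 := rateProd_pos q.2
    positivity
  have hn : ∀ (q : (Fin d → ℕ) × (Fin d → ℕ)) (x r : ℝ),
      |x| ≤ 4 * (D |r| ^ 2 * (rateProd q.1 ^ 3 * rateProd q.2 ^ 3)) → ‖c q * (x : ℂ)‖ ≤
      ‖c q‖ * (rateProd q.1 ^ 3 * rateProd q.2 ^ 3) * (4 * D |r| ^ 2) := fun q x r hx => by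
    rw [norm_mul, norm_real, Real.norm_eq_abs]
    exact (mul_le_mul_of_nonneg_left hx (norm_nonneg _)).trans (le_of_eq (by ring))
  -- The second derivative of a product has four terms of the same size, hence the factor 4.
  refine contDiff_two_tsum (B := fun t => 4 * D t ^ 2)
    (u' := fun q r => c q * ((f' q.1 r * f q.2 r + f q.1 r * f' q.2 r : ℝ) : ℂ))
    (u'' := fun q r => c q * ((f'' q.1 r * f q.2 r + f' q.1 r * f' q.2 r +
      (f' q.1 r * f' q.2 r + f q.1 r * f'' q.2 r) : ℝ) : ℂ)) h.summable
    (fun q => mul_nonneg (norm_nonneg _) (hr q)) (fun x y hx hxy => ?_)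
    (fun q r => (((hf q.1 r).fun_mul (hf q.2 r)).ofReal_comp).const_mul _)
    (fun q r => ((((hf' q.1 r).fun_mul (hf q.2 r)).fun_add
      ((hf q.1 r).fun_mul (hf' q.2 r))).ofReal_comp).const_mul _) (fun q => ?_)
    (fun q r => hn q _ r ?_) (fun q r => hn q _ r ?_) (fun q r => hn q _ r ?_)
  · simp only [D]
    gcongr
  · have c0 : ∀ q, Continuous (f q) := fun q => continuous_iff_continuousAt.2 fun x =>
      (hf q x).continuousAt
    have c1 : ∀ q, Continuous (f' q) := fun q => continuous_iff_continuousAt.2 fun x =>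
      (hf' q x).continuousAt
    have := c0 q.1
    have := c0 q.2
    have := c1 q.1
    have := c1 q.2
    have := hfc q.1
    have := hfc q.2
    fun_prop
  · have h1 := hmul (b0 q.1 r) (b0 q.2 r)
    have h2 : 0 ≤ D |r| ^ 2 * (rateProd q.1 ^ 3 * rateProd q.2 ^ 3) :=
      mul_nonneg (sq_nonneg _) (hr q)
    linarith
  · have h1 := hmul (b1 q.1 r) (b0 q.2 r)
    have h3 := hmul (b0 q.1 r) (b1 q.2 r)
    have h2 : 0 ≤ D |r| ^ 2 * (rateProd q.1 ^ 3 * rateProd q.2 ^ 3) :=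
      mul_nonneg (sq_nonneg _) (hr q)
    refine (abs_add_le _ _).trans ?_
    linarith
  · have h1 := hmul (b2 q.1 r) (b0 q.2 r)
    have h3 := hmul (b0 q.1 r) (b2 q.2 r)
    have h4 := hmul (b1 q.1 r) (b1 q.2 r)
    refine (abs_add_le _ _).trans ?_
    have h5 := abs_add_le (f'' q.1 r * f q.2 r) (f' q.1 r * f' q.2 r)
    have h6 := abs_add_le (f' q.1 r * f' q.2 r) (f q.1 r * f'' q.2 r)
    linarith

/-! ### The resistance of a radial junction in three dimensions -/

section Radial

variable {w : Kernel 3 1} {g : ℝ → ℝ → ℂ}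

theorem norm_transmission_eq (hg : ∀ k l : Space 3, kernelFourier w .II .I k l = g ‖k‖ ‖l‖)
    (k l : Space 3) : ‖transmission w k l‖ = ‖g ‖k‖ ‖l‖‖ := by
  rw [transmission, hg, norm_neg]

/-- Up to the factor 8π³r, f is the squared modulus of the axis restriction, composed with the
square root, which is smooth away from 0. -/
theorem contDiffOn_energy_density (hw : WeightedSobolev w)
    (hg : ∀ k l : Space 3, kernelFourier w .II .I k l = g ‖k‖ ‖l‖) {f : ℝ → ℝ}
    (hf : ∀ r : ℝ, f r = 8 * Real.pi ^ 3 * r * ‖g (√r) (√r)‖ ^ 2) :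
    ContDiffOn ℝ 2 f (Set.Ioi 0) := by
  have hγ := (isHermiteSeries_transmission hw).contDiff_axis 0
  set γ : ℝ → ℂ := fun r : ℝ =>
    transmission w (EuclideanSpace.single 0 r) (EuclideanSpace.single 0 r) with hγdef
  have e : f = fun r => 8 * Real.pi ^ 3 * r * ‖γ (√r)‖ ^ 2 := by
    ext r
    rw [hf, hγdef]
    simp only
    rw [norm_transmission_eq hg]
    simp [abs_of_nonneg (Real.sqrt_nonneg r)]
  rw [e]
  have hs : ContDiffOn ℝ 2 (fun r : ℝ => √r) (Set.Ioi 0) := fun r hr =>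
    (Real.contDiffAt_sqrt (ne_of_gt hr)).contDiffWithinAt
  exact (contDiffOn_const.mul contDiffOn_id).mul ((hγ.comp_contDiffOn hs).norm_sq ℝ)

/-- The factor 16π² is (4π)²: one area of the unit sphere for each of the two momenta. -/
theorem integral_fun_norm_energyShell (Φ : ℝ → ℝ) :
    ∫ y : Space 3 × UnitSphere 3, Φ ‖y.1‖ ∂((volume : Measure (Space 3)).prod (sphereMeasure 3)) =
      16 * Real.pi ^ 2 * ∫ r in Set.Ioi (0 : ℝ), r ^ 2 * Φ r := by
  have hb : (volume : Measure (Space 3)).real (Metric.ball 0 1) = Real.pi * 4 / 3 := by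
    have hpi := Real.pi_pos
    rw [Measure.real, EuclideanSpace.volume_ball_fin_three]
    simp
    positivity
  rw [integral_fun_fst (fun k : Space 3 => Φ ‖k‖), Measure.toSphere_real_apply_univ,
    integral_fun_norm_addHaar, finrank_euclideanSpace_fin, hb]
  simp only [smul_eq_mul, nsmul_eq_mul]
  push_cast
  ring

theorem integrableOn_of_integrable_norm {Φ : ℝ → ℝ}
    (h : Integrable (fun y : Space 3 × UnitSphere 3 => Φ ‖y.1‖)
      ((volume : Measure (Space 3)).prod (sphereMeasure 3))) :
    IntegrableOn (fun r => r ^ 2 * Φ r) (Set.Ioi 0) := by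
  have h1 := h.integral_prod_left
  simp only [integral_const, smul_eq_mul] at h1
  have hσ : (sphereMeasure 3).real Set.univ ≠ 0 := by
    rw [Measure.toSphere_real_apply_univ]
    have : 0 < (volume : Measure (Space 3)).real (Metric.ball 0 1) :=
      ENNReal.toReal_pos (Metric.isOpen_ball.measure_pos _ ⟨0, by simp⟩).ne'
        measure_ball_lt_top.ne
    rw [finrank_euclideanSpace_fin]
    positivity
  have h2 : Integrable fun k : Space 3 => Φ ‖k‖ := by
    refine (h1.const_mul ((sphereMeasure 3).real Set.univ)⁻¹).congr (ae_of_all _ fun k => ?_)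
    simp only
    rw [← mul_assoc, inv_mul_cancel₀ hσ, one_mul]
  have h3 := (integrable_fun_norm_addHaar (volume : Measure (Space 3)) (f := Φ)).1 h2
  simpa using h3

/-- In radial coordinates this is the integrability of |τ|² on the energy shell; it controls f both
at 0 and at infinity, where the smoothness of f says nothing. -/
theorem integrableOn_energy_density (hw : WeightedSobolev w)
    (hg : ∀ k l : Space 3, kernelFourier w .II .I k l = g ‖k‖ ‖l‖) {f : ℝ → ℝ}
    (hf : ∀ r : ℝ, f r = 8 * Real.pi ^ 3 * r * ‖g (√r) (√r)‖ ^ 2) :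
    IntegrableOn f (Set.Ioi 0) := by
  have h := integrable_transmission_sq le_rfl hw
  rw [integrable_energyShell_iff h.aestronglyMeasurable] at h
  have h1 : Integrable (fun y : Space 3 × UnitSphere 3 => ‖y.1‖ / 2 * ‖g ‖y.1‖ ‖y.1‖‖ ^ 2)
      ((volume : Measure (Space 3)).prod (sphereMeasure 3)) := by
    refine h.congr (ae_of_all _ fun y => ?_)
    simp [shellDensity, shellPoint, norm_transmission_eq hg, norm_smul, Real.sqrt_sq]
  have h2 := integrableOn_of_integrable_norm (Φ := fun r => r / 2 * ‖g r r‖ ^ 2) h1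
  -- The substitution ω = r², with Jacobian 2r, passes from the radius to the energy.
  rw [← integrableOn_Ioi_comp_rpow_iff f (p := 2) two_ne_zero]
  refine (h2.const_mul (32 * Real.pi ^ 3)).congr ?_
  filter_upwards [ae_restrict_mem measurableSet_Ioi] with r hr
  have hr : 0 < r := hr
  rw [hf, Real.rpow_two, Real.sqrt_sq hr.le, show (2 : ℝ) - 1 = 1 by norm_num, Real.rpow_one,
    abs_of_pos two_pos, smul_eq_mul]
  ring

theorem inv_resistance_eq (hw : WeightedSobolev w)
    (hg : ∀ k l : Space 3, kernelFourier w .II .I k l = g ‖k‖ ‖l‖) {f : ℝ → ℝ}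
    (hf : ∀ r : ℝ, f r = 8 * Real.pi ^ 3 * r * ‖g (√r) (√r)‖ ^ 2) (μ : ℝ) {T : ℝ} (hT : 0 < T) :
    (resistance w μ (1 / T))⁻¹ = thermalAverage ((Set.Ioi 0).indicator f) μ T := by
  have h1 : ∫ p, resistanceIntegrand w μ (1 / T) p ∂(energyShell 3) =
      ∫ y : Space 3 × UnitSphere 3, (fun r => r / 2 * (thermal ((r ^ 2 - μ) / T) *
        ‖g r r‖ ^ 2)) ‖y.1‖ ∂((volume : Measure (Space 3)).prod (sphereMeasure 3)) := by
    rw [integral_energyShell (continuous_resistanceIntegrand hw μ (1 / T)).aestronglyMeasurable]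
    refine integral_congr_ae (ae_of_all _ fun y => ?_)
    simp only [resistanceIntegrand_eq, one_div_mul_eq_div]
    simp [shellDensity, shellPoint, norm_transmission_eq hg, norm_smul, Real.sqrt_sq]
  have h2 := integral_comp_rpow_Ioi (fun ω => f ω * thermal ((ω - μ) / T)) (p := 2) two_ne_zero
  -- With ω = r² one has f(ω) dω = 16π³ r³ |g|² dr, against r³ |g|² dr / 2 on the left. Together
  -- with 2π and 16π² the constant (32π³)⁻¹ leaves exactly T⁻¹.
  have h3 : ∫ r in Set.Ioi (0 : ℝ), r ^ 2 * (r / 2 * (thermal ((r ^ 2 - μ) / T) * ‖g r r‖ ^ 2)) =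
      (32 * Real.pi ^ 3)⁻¹ * ∫ ω in Set.Ioi (0 : ℝ), f ω * thermal ((ω - μ) / T) := by
    rw [← h2, ← integral_const_mul]
    refine setIntegral_congr_fun measurableSet_Ioi fun r hr => ?_
    have hr : 0 < r := hr
    have hpi := Real.pi_pos
    simp only [smul_eq_mul]
    rw [hf, Real.rpow_two, Real.sqrt_sq hr.le, show (2 : ℝ) - 1 = 1 by norm_num, Real.rpow_one,
      abs_of_pos two_pos]
    field_simp
    ring
  have h4 : ∫ ω, (Set.Ioi 0).indicator f ω * thermal ((ω - μ) / T) =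
      ∫ ω in Set.Ioi (0 : ℝ), f ω * thermal ((ω - μ) / T) := by
    rw [← integral_indicator measurableSet_Ioi]
    congr 1
    ext ω
    rw [Set.indicator_mul_left]
  rw [thermalAverage, integral_scale μ hT, h4, resistance, inv_inv,
    h1.trans (integral_fun_norm_energyShell
      fun r => r / 2 * (thermal ((r ^ 2 - μ) / T) * ‖g r r‖ ^ 2)), h3]
  have hpi := Real.pi_pos
  field_simp
  ring

end Radial

end Junction
end

theorem mainTheorem6 {d : ℕ} (hd : 3 ≤ d) (w : (N : ℕ) → Junction.Kernel d N)
    (hw : Junction.WeightedSobolev (w 1)) (hw' : Junction.HermitianKernel (w 1)) :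
    -- the integral that defines the resistance converges
    (∀ μ β : ℝ, 0 < β →
      Integrable (Junction.resistanceIntegrand (w 1) μ β) (Junction.energyShell d)) ∧
    -- Ohm's law to leading order in the voltage drop
    (∀ μ β : ℝ, 0 < β → ∃ J : ℝ → ℝ,
      (∀ Δμ : ℝ, Junction.IsCurrentTerm (fun _ => β) (Junction.Reservoir.pick μ (μ + Δμ)) w 2 2
        (J Δμ)) ∧
      (fun Δμ : ℝ => J Δμ - Δμ / Junction.resistance (w 1) μ β) =O[𝓝 0] fun Δμ : ℝ => Δμ ^ 2) ∧
    -- linear growth of the resistance at high temperature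
    ((∃ k l : Junction.Space d, ‖k‖ = ‖l‖ ∧ Junction.kernelFourier (w 1) .II .I k l ≠ 0) →
      (∀ μ β : ℝ, 0 < β → 0 < Junction.resistance (w 1) μ β) ∧
      ∀ μ : ℝ, 0 < μ → ∃ C : ℝ, 0 < C ∧
        Tendsto (fun T : ℝ => Junction.resistance (w 1) μ (1 / T) / T) atTop (𝓝 C)) ∧
    -- low temperature, in three dimensions, for a radial coupling
    (d = 3 → ∀ g : ℝ → ℝ → ℂ,
      (∀ k l : Junction.Space d, Junction.kernelFourier (w 1) .II .I k l = g ‖k‖ ‖l‖) →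
      ∀ f : ℝ → ℝ, (∀ r : ℝ, f r = 8 * Real.pi ^ 3 * r * ‖g (√r) (√r)‖ ^ 2) →
      ContDiffOn ℝ 2 f (Set.Ioi 0) ∧
      ∀ μ : ℝ, 0 < μ →
        (fun T : ℝ => (Junction.resistance (w 1) μ (1 / T))⁻¹ -
            (f μ + Real.pi ^ 2 * T ^ 2 * iteratedDeriv 2 f μ / 6)) =o[𝓝[>] 0]
          (fun T : ℝ => T ^ 2) ∧
        (f μ ≠ 0 →
          (fun T : ℝ => Junction.resistance (w 1) μ (1 / T) -
              1 / (f μ + Real.pi ^ 2 * T ^ 2 * iteratedDeriv 2 f μ / 6)) =o[𝓝[>] 0]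
            (fun T : ℝ => T ^ 2) ∧
          Tendsto (fun β : ℝ => Junction.resistance (w 1) μ β) atTop (𝓝 (f μ)⁻¹) ∧
          (iteratedDeriv 2 f μ < 0 → ∃ T₀ : ℝ, 0 < T₀ ∧
            StrictMonoOn (fun T : ℝ => Junction.resistance (w 1) μ (1 / T)) (Set.Ioo 0 T₀)) ∧
          (0 < iteratedDeriv 2 f μ → ∃ T₀ : ℝ, 0 < T₀ ∧
            StrictAntiOn (fun T : ℝ => Junction.resistance (w 1) μ (1 / T))
              (Set.Ioo 0 T₀)))) := by
  refine ⟨fun μ β _ => Junction.integrable_resistanceIntegrand hd hw μ β, fun μ β hβ =>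
    ⟨Junction.stationaryCurrent (w 1) β μ, fun Δ =>
      Junction.isCurrentTerm_stationaryCurrent hd hw hw' hβ μ Δ, Junction.ohm hd hw β μ⟩,
    fun hne => ⟨fun μ β hβ => Junction.resistance_pos hd hw hne μ hβ,
      fun μ _ => Junction.tendsto_resistance_div hd hw hne μ⟩, ?_⟩
  rintro rfl g hg f hf
  have hf2 := Junction.contDiffOn_energy_density hw hg hf
  exact ⟨hf2, fun μ hμ =>
    Junction.low_temperature_asymptotics (R := Junction.resistance (w 1) μ) hf2
      (Junction.integrableOn_energy_density hw hg hf)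
      (fun r hr => by have := Real.pi_pos; have : 0 < r := hr; rw [hf]; positivity) hμ
      fun T hT => Junction.inv_resistance_eq hw hg hf μ hT⟩
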